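/- **Proposition.** Let $M$ be a closed oriented smooth surface with a Riemannian metric $g$, let $J$ be the rotation by $+\pi/2$ in the tangent planes, and regard $(M,J)$ as a Riemann surface with canonical bundle $K_M$. Suppose that the Gauss curvature satisfies $K_g<0$ everywhere, let $m\ge 2$ be an integer, and let $A$ be a holomorphic differential of degree $m$, i.e. a holomorphic section of $K_M^{m}$. Let $SM$ be the unit tangent bundle of $(M,g)$, with the coframe $(\omega_1,\omega_2,\psi)$ given by $$\omega_1(\xi)=g(d\pi(\xi),v),\qquad \omega_2(\xi)=g(d\pi(\xi),Jv),\qquad \psi(\xi)=g\big(\tfrac{DZ}{dt}(0),Jv\big)\qquad(\xi\in T_vSM),$$ where $\pi:SM\to M$ is the projection and $Z$ is any curve in $SM$ with $Z(0)=v$, $\dot Z(0)=\xi$; let $(X,H,V)$ be the dual frame (so $X$ is the geodesic vector field and $V$ generates the rotation of the fibres). Let $a:SM\to\mathbb R$, $a(v)=\operatorname{Im}A(v,\dots,v)$, so that $\pi^*A=(Va/m+ia)(\omega_1+i\omega_2)^m$. The thermostat flow $\phi_t$ associated to $(g,A)$ is the smooth flow on $SM$ generated by $F=X+aV$; its orbits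 are the velocity curves of the unit speed curves $\gamma$ in $M$ with $\frac{D\dot\gamma}{dt}=a(\dot\gamma)\,J\dot\gamma$. 1. The flow $\phi_t$ has a dominated splitting: let $E=TSM/\mathbb RF$, identified with $SM\times\mathbb R^2$ by means of the classes of $H$ and $V$ and given the Euclidean norm of $\mathbb R^2$, and let $\Psi_t[\xi]=[d\phi_t\xi]$ be the action of $d\phi_t$ on $E$. There are continuous $\Psi_t$-invariant line subbundles $E^u,E^s$ with $E=E^u\oplus E^s$, and constants $C>0$, $0<\tau<1$, such that for all $v\in SM$ and $t>0$ $$\big\|\Psi_t|_{E^s(v)}\big\|\;\big\|\Psi_{-t}|_{E^u(\phi_t v)}\big\|\le C\,\tau^{t}.$$ 2. If $m=2$, then $\phi_t$ is Anosov: there is a continuous $d\phi_t$-invariant splitting $TSM=\mathbb RF\oplus E^s\oplus E^u$ with line bundles $E^s,E^u$, and there are constants $C>0$ and $0<\zeta<1<\eta$, such that for all $t>0$ $$\big\|d\phi_t|_{E^s}\big\|\le C\,\zeta^{t},\qquad \big\|d\phi_{-t}|_{E^u}\big\|\le C\,\eta^{-t},$$ with norms taken with respect to the Sasaki metric on $SM$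 (the metric for which $(X,H,V)$ is orthonormal). -/

import Mathlib

open Set Bundle VectorField
open scoped Manifold ContDiff Topology

noncomputable section

namespace Thermostat

/-- The model plane. -/
abbrev Plane : Type := EuclideanSpace ℝ (Fin 2)

section Surface

variable {M : Type*} [TopologicalSpace M] [ChartedSpace Plane M] [IsManifold (𝓡 2) ∞ M]

/-- A smooth Riemannian metric on the surface `M`. -/
abbrev Metric (M : Type*) [TopologicalSpace M] [ChartedSpace Plane M]
    [IsManifold (𝓡 2) ∞ M] : Type _ :=
  ContMDiffRiemannianMetric (𝓡 2) ∞ Plane (fun x : M => TangentSpace (𝓡 2) x)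

/-- An orientation of the Riemannian surface `(M, g)`, given by its rotation `J` through the angle
`+π/2`: a smooth bundle map such that `J v` is orthogonal to `v` and as long as `v`.
(On a surface with a metric, an orientation and such a `J` determine each other: for `v ≠ 0`,
the basis `(v, J v)` is positive.) -/
structure Rotation (g : Metric M) where
  /-- the rotation in each tangent plane -/
  toFun : ∀ x : M, TangentSpace (𝓡 2) x →L[ℝ] TangentSpace (𝓡 2) x
  smooth : ContMDiff (𝓡 2).tangent (𝓡 2).tangent ∞
    (fun v : TangentBundle (𝓡 2) M => (⟨v.1, toFun v.1 v.2⟩ : TangentBundle (𝓡 2) M))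
  inner_self : ∀ (x : M) (v : TangentSpace (𝓡 2) x), g.inner x (toFun x v) v = 0
  isometry : ∀ (x : M) (v : TangentSpace (𝓡 2) x),
    g.inner x (toFun x v) (toFun x v) = g.inner x v v

variable {g : Metric M}

/-! ### Moving frames, connection form and Gauss curvature -/

/-- The unit vector field obtained by normalising the first coordinate field of the preferred chart
at `x₀`; it is smooth on the domain of that chart. Together with its image under `J` it is a
positively oriented orthonormal frame there. -/
def unitField (g : Metric M) (x₀ : M) (y : M) : TangentSpace (𝓡 2) y :=
  let w : TangentSpace (𝓡 2) y :=
    (trivializationAt Plane (fun x : M => TangentSpace (𝓡 2) x) x₀).symm y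
      (EuclideanSpace.single 0 1)
  (Real.sqrt (g.inner y w w))⁻¹ • w

/-- The vector field `[e, J e]`. -/
def frameBracket (J : Rotation g) (e : ∀ y : M, TangentSpace (𝓡 2) y) (y : M) :
    TangentSpace (𝓡 2) y :=
  mlieBracket (𝓡 2) e (fun z => J.toFun z (e z)) y

/-- The Levi-Civita connection form `α` of the orthonormal frame `(e, J e)`, characterised by
`∇_w e = α(w) J e` and `∇_w (J e) = - α(w) e`. As `∇` has no torsion,
`[e, J e] = ∇_e (J e) - ∇_{J e} e = - α(e) e - α(J e) J e`, that is, `α(w) = - ⟨[e, J e], w⟩`. -/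
def connectionForm (J : Rotation g) (e : ∀ y : M, TangentSpace (𝓡 2) y) (y : M)
    (w : TangentSpace (𝓡 2) y) : ℝ :=
  - g.inner y (frameBracket J e y) w

/-- The Gauss curvature, computed in the orthonormal frame `(e, J e)` by the structure equation
`dα = - K ω₁ ∧ ω₂`, that is,
`K = - dα(e, J e) = - (e(α(J e)) - (J e)(α(e)) - α([e, J e]))`. -/
def frameCurvature (J : Rotation g) (e : ∀ y : M, TangentSpace (𝓡 2) y) (x : M) : ℝ :=
  -(mvfderiv (𝓡 2) (fun y => connectionForm J e y (J.toFun y (e y))) x (e x)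
    - mvfderiv (𝓡 2) (fun y => connectionForm J e y (e y)) x (J.toFun x (e x))
    - connectionForm J e x (frameBracket J e x))

/-- The Gauss curvature `K_g`; it does not depend on the local orthonormal frame that is used to
compute it. -/
def gaussCurvature (J : Rotation g) (x : M) : ℝ :=
  frameCurvature J (unitField g x) x

/-! ### Differentials of degree `m` -/

/-- A smooth differential of degree `m`, that is, a smooth section `A` of the `m`-th tensor power
of the canonical bundle: `A x` is an `m`-linear form on `T_x M`, complex linear in each argument
(where `J` acts as multiplication by `i` on `T_x M`). As the canonical bundle is a complex line
bundle, `A` is determined by the values `A(v, …, v)`, and it is smooth if and only if they depend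
smoothly on `v`. -/
structure Differential (J : Rotation g) (m : ℕ) where
  /-- the form at each point -/
  toFun : ∀ x : M, MultilinearMap ℝ (fun _ : Fin m => TangentSpace (𝓡 2) x) ℂ
  map_rotation : ∀ (x : M) (v : Fin m → TangentSpace (𝓡 2) x) (k : Fin m),
    toFun x (Function.update v k (J.toFun x (v k))) = Complex.I * toFun x v
  smooth : ContMDiff (𝓡 2).tangent 𝓘(ℝ, ℂ) ∞
    (fun v : TangentBundle (𝓡 2) M => toFun v.1 (fun _ => v.2))

/-- `z` is a holomorphic coordinate on the open set `U`, for the complex structure given by `J`. -/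
structure IsHolomorphicCoordinate (J : Rotation g) (z : M → ℂ) (U : Set M) : Prop where
  isOpen : IsOpen U
  smooth : ContMDiffOn (𝓡 2) 𝓘(ℝ, ℂ) ∞ z U
  injOn : InjOn z U
  immersion : ∀ x ∈ U, ∀ v : TangentSpace (𝓡 2) x, mvfderiv (𝓡 2) z x v = 0 → v = 0
  complexLinear : ∀ x ∈ U, ∀ v : TangentSpace (𝓡 2) x,
    mvfderiv (𝓡 2) z x (J.toFun x v) = Complex.I * mvfderiv (𝓡 2) z x v

/-- The differential `A` is holomorphic: near every point, `A = f(z) dz^m` for a holomorphic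
coordinate `z` and a holomorphic function `f`. -/
def Differential.IsHolomorphic {J : Rotation g} {m : ℕ} (A : Differential J m) : Prop :=
  ∀ x : M, ∃ (U : Set M) (z : M → ℂ) (f : ℂ → ℂ), x ∈ U ∧ IsHolomorphicCoordinate J z U ∧
    DifferentiableOn ℂ f (z '' U) ∧
    ∀ y ∈ U, ∀ v : Fin m → TangentSpace (𝓡 2) y,
      A.toFun y v = f (z y) * ∏ k, mvfderiv (𝓡 2) z y (v k)

/-- The function `a` on the unit tangent bundle that represents `A`: the function with
`V V a = - m² a` and `π^* A = (V a / m + i a) (ω₁ + i ω₂)^m`, that is, the imaginary part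
of `A(v, …, v)`. -/
def Differential.imPart {J : Rotation g} {m : ℕ} (A : Differential J m)
    (v : TangentBundle (𝓡 2) M) : ℝ :=
  (A.toFun v.1 (fun _ => v.2)).im

/-! ### The unit tangent bundle and its canonical coframe -/

/-- The unit tangent bundle `SM`. -/
def unitTangent (g : Metric M) : Set (TangentBundle (𝓡 2) M) :=
  {v | g.inner v.1 v.2 v.2 = 1}

/-- The tangent space `T_v SM` (for `v ∈ SM`) of the hypersurface `SM`, as a subspace of the tangent
space at `v` of the total space `TM`. -/
def tangentUnit (g : Metric M) (v : TangentBundle (𝓡 2) M) :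
    Submodule ℝ (TangentSpace (𝓡 2).tangent v) :=
  LinearMap.ker (mvfderiv (𝓡 2).tangent
    (fun w : TangentBundle (𝓡 2) M => g.inner w.1 w.2 w.2) v).toLinearMap

/-- The differential of the projection `π : TM → M`. -/
def dproj (v : TangentBundle (𝓡 2) M) (ξ : TangentSpace (𝓡 2).tangent v) :
    TangentSpace (𝓡 2) v.1 :=
  mfderiv (𝓡 2).tangent (𝓡 2) (fun w : TangentBundle (𝓡 2) M => w.1) v ξ

/-- `ω₁(ξ) = g(dπ(ξ), v)`. -/
def omega₁ (g : Metric M) (v : TangentBundle (𝓡 2) M) (ξ : TangentSpace (𝓡 2).tangent v) : ℝ :=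
  g.inner v.1 (dproj v ξ) v.2

/-- `ω₂(ξ) = g(dπ(ξ), J v)`. -/
def omega₂ (J : Rotation g) (v : TangentBundle (𝓡 2) M) (ξ : TangentSpace (𝓡 2).tangent v) : ℝ :=
  g.inner v.1 (dproj v ξ) (J.toFun v.1 v.2)

/-- The Levi-Civita connection form on `SM`: `ψ(ξ) = g(DZ/dt (0), J v)` for every curve `Z` in `SM`
with `Z(0) = v` and velocity `ξ` at `0`. If `Z = p e + q J e` in an orthonormal frame
with connection form `α`, then `DZ/dt = (p' - q α) e + (q' + p α) J e`, where `α` is evaluated at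
`dπ(ξ)`, and `J v = p J e - q e`, so that `ψ(ξ) = p q' - q p' + α(dπ(ξ))` because `p² + q² = 1`. -/
def psi (J : Rotation g) (v : TangentBundle (𝓡 2) M) (ξ : TangentSpace (𝓡 2).tangent v) : ℝ :=
  let e := unitField g v.1
  let p : TangentBundle (𝓡 2) M → ℝ := fun w => g.inner w.1 w.2 (e w.1)
  let q : TangentBundle (𝓡 2) M → ℝ := fun w => g.inner w.1 w.2 (J.toFun w.1 (e w.1))
  p v * mvfderiv (𝓡 2).tangent q v ξ - q v * mvfderiv (𝓡 2).tangent p v ξ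
    + connectionForm J e v.1 (dproj v ξ)

/-- The coordinates `(ω₁(ξ), ω₂(ξ), ψ(ξ))` of `ξ`, that is, its coordinates in the frame
`(X, H, V)` of `SM` formed by the geodesic, horizontal and vertical vector fields, which is dual
to `(ω₁, ω₂, ψ)`. For `v ∈ SM` this is an isomorphism from `T_v SM` onto `ℝ³`, and it is an isometry
for the Sasaki metric of `SM`. -/
def coframe (J : Rotation g) (v : TangentBundle (𝓡 2) M) (ξ : TangentSpace (𝓡 2).tangent v) :
    EuclideanSpace ℝ (Fin 3) :=
  !₂[omega₁ g v ξ, omega₂ J v ξ, psi J v ξ]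

/-! ### Thermostat flows -/

/-- `φ` is the thermostat flow of `lam`: the smooth flow on `SM` generated by the vector field
`F = X + lam V`, that is, by the vector field with `ω₁(F) = 1`, `ω₂(F) = 0` and `ψ(F) = lam`.
(The values of `φ t` and `lam` outside `SM` play no role.) -/
structure IsThermostatFlow (J : Rotation g) (lam : TangentBundle (𝓡 2) M → ℝ)
    (φ : ℝ → TangentBundle (𝓡 2) M → TangentBundle (𝓡 2) M) : Prop where
  mapsTo : ∀ t : ℝ, MapsTo (φ t) (unitTangent g) (unitTangent g)
  zero : ∀ v ∈ unitTangent g, φ 0 v = v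
  add : ∀ s t : ℝ, ∀ v ∈ unitTangent g, φ (s + t) v = φ s (φ t v)
  smooth : ContMDiffOn (𝓘(ℝ, ℝ).prod (𝓡 2).tangent) (𝓡 2).tangent ∞
    (fun P : ℝ × TangentBundle (𝓡 2) M => φ P.1 P.2) (univ ×ˢ unitTangent g)
  generator : ∀ v ∈ unitTangent g, ∀ t : ℝ,
    coframe J (φ t v)
      (mfderiv 𝓘(ℝ, ℝ) (𝓡 2).tangent (fun s : ℝ => φ s v) t (1 : ℝ)) = !₂[1, 0, lam (φ t v)]

/-- The differential `dφ_t` at `v ∈ SM`, to be applied to vectors in `T_v SM`. (On these it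
does not depend on the choice of a derivative within the hypersurface `SM`.) -/
def dflow (g : Metric M) (φ : ℝ → TangentBundle (𝓡 2) M → TangentBundle (𝓡 2) M) (t : ℝ)
    (v : TangentBundle (𝓡 2) M) (ξ : TangentSpace (𝓡 2).tangent v) :
    TangentSpace (𝓡 2).tangent (φ t v) :=
  mfderivWithin (𝓡 2).tangent (𝓡 2).tangent (φ t) (unitTangent g) v ξ

/-- A continuous line subbundle `L` of the trivial bundle `S × W` over `S`. -/
def IsLineSubbundle {X W : Type*} [TopologicalSpace X] [NormedAddCommGroup W] [NormedSpace ℝ W]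
    (S : Set X) (L : X → Submodule ℝ W) : Prop :=
  ∀ v ∈ S, ∃ (U : Set X) (σ : X → W), U ∈ 𝓝 v ∧ ContinuousOn σ (S ∩ U) ∧
    ∀ w ∈ S ∩ U, σ w ≠ 0 ∧ L w = Submodule.span ℝ {σ w}

/-- The class of `ξ ∈ T_v SM` in the quotient bundle `E = TSM / ℝF`, identified with `SM × ℝ²` by
means of the frame `(F, H, V)`: if `ξ = x F + y H + u V` then the class is `(y, u)`, and
`y = ω₂(ξ)`, `u = ψ(ξ) - lam ω₁(ξ)`. -/
def quotientClass (J : Rotation g) (lam : TangentBundle (𝓡 2) M → ℝ)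
    (v : TangentBundle (𝓡 2) M) (ξ : TangentSpace (𝓡 2).tangent v) :
    EuclideanSpace ℝ (Fin 2) :=
  !₂[omega₂ J v ξ, psi J v ξ - lam v * omega₁ g v ξ]

/-- The thermostat flow `φ` of `lam` has a dominated splitting: the bundle `E = TSM / ℝF` has a
continuous splitting `E = Eᵘ ⊕ Eˢ` into line subbundles that is invariant under the action of
`dφ_t` on `E`, and there are `C > 0` and `0 < τ < 1` such that
`‖Ψ_t|_{Eˢ(v)}‖ ‖Ψ_{-t}|_{Eᵘ(φ_t v)}‖ ≤ C τ^t` for all `v ∈ SM` and `t > 0`, where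
`Ψ_t [ξ] = [dφ_t ξ]`. -/
def HasDominatedSplitting (J : Rotation g) (lam : TangentBundle (𝓡 2) M → ℝ)
    (φ : ℝ → TangentBundle (𝓡 2) M → TangentBundle (𝓡 2) M) : Prop :=
  ∃ Eu Es : TangentBundle (𝓡 2) M → Submodule ℝ (EuclideanSpace ℝ (Fin 2)),
    IsLineSubbundle (unitTangent g) Eu ∧ IsLineSubbundle (unitTangent g) Es ∧
    (∀ v ∈ unitTangent g, IsCompl (Eu v) (Es v)) ∧
    (∀ v ∈ unitTangent g, ∀ t : ℝ, ∀ ξ ∈ tangentUnit g v,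
      (quotientClass J lam v ξ ∈ Eu v →
        quotientClass J lam (φ t v) (dflow g φ t v ξ) ∈ Eu (φ t v)) ∧
      (quotientClass J lam v ξ ∈ Es v →
        quotientClass J lam (φ t v) (dflow g φ t v ξ) ∈ Es (φ t v))) ∧
    ∃ C τ : ℝ, 0 < C ∧ 0 < τ ∧ τ < 1 ∧
      ∀ v ∈ unitTangent g, ∀ t : ℝ, 0 < t →
        ∀ ξ ∈ tangentUnit g v, ∀ η ∈ tangentUnit g (φ t v),
          quotientClass J lam v ξ ∈ Es v → quotientClass J lam (φ t v) η ∈ Eu (φ t v) →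
          ‖quotientClass J lam (φ t v) (dflow g φ t v ξ)‖ *
              ‖quotientClass J lam (φ (-t) (φ t v)) (dflow g φ (-t) (φ t v) η)‖ ≤
            C * τ ^ t * (‖quotientClass J lam v ξ‖ * ‖quotientClass J lam (φ t v) η‖)

/-- The thermostat flow `φ` of `lam` is Anosov: `TSM = ℝF ⊕ Eˢ ⊕ Eᵘ` with continuous line subbundles
`Eˢ`, `Eᵘ` that are invariant under `dφ_t`, and such that, for the Sasaki metric, `dφ_t` contracts
`Eˢ` exponentially as `t → ∞` and `Eᵘ` exponentially as `t → -∞`. Subspaces of `T_v SM` are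
described by their coordinates `(ω₁, ω₂, ψ)`, in which `F = (1, 0, lam)`. -/
def IsAnosov (J : Rotation g) (lam : TangentBundle (𝓡 2) M → ℝ)
    (φ : ℝ → TangentBundle (𝓡 2) M → TangentBundle (𝓡 2) M) : Prop :=
  ∃ Es Eu : TangentBundle (𝓡 2) M → Submodule ℝ (EuclideanSpace ℝ (Fin 3)),
    IsLineSubbundle (unitTangent g) Es ∧ IsLineSubbundle (unitTangent g) Eu ∧
    (∀ v ∈ unitTangent g, Submodule.span ℝ {!₂[1, 0, lam v]} ⊔ Es v ⊔ Eu v = ⊤) ∧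
    (∀ v ∈ unitTangent g, ∀ t : ℝ, ∀ ξ ∈ tangentUnit g v,
      (coframe J v ξ ∈ Es v → coframe J (φ t v) (dflow g φ t v ξ) ∈ Es (φ t v)) ∧
      (coframe J v ξ ∈ Eu v → coframe J (φ t v) (dflow g φ t v ξ) ∈ Eu (φ t v))) ∧
    ∃ C ζ η : ℝ, 0 < C ∧ 0 < ζ ∧ ζ < 1 ∧ 1 < η ∧
      ∀ v ∈ unitTangent g, ∀ t : ℝ, 0 < t → ∀ ξ ∈ tangentUnit g v,
        (coframe J v ξ ∈ Es v →
          ‖coframe J (φ t v) (dflow g φ t v ξ)‖ ≤ C * ζ ^ t * ‖coframe J v ξ‖) ∧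
        (coframe J v ξ ∈ Eu v →
          ‖coframe J (φ (-t) v) (dflow g φ (-t) v ξ)‖ ≤ C * η ^ (-t) * ‖coframe J v ξ‖)

end Surface

end Thermostat

end

noncomputable section

namespace Thermostat

/-! ### Derivatives of vector-valued functions on manifolds -/

section Calculus

variable {E : Type*} [NormedAddCommGroup E] [NormedSpace ℝ E] {H : Type*} [TopologicalSpace H]
  {I : ModelWithCorners ℝ E H} {N : Type*} [TopologicalSpace N] [ChartedSpace H N]
  {W : Type*} [NormedAddCommGroup W] [NormedSpace ℝ W]

/-! Write `A(v, …, v) = b + i a`, and let `x, y, ψ` be the coordinates of `dφ_t ξ` in the frame `(X,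
H, V)`. They satisfy the Jacobi equations `x' = a y`, `y' = ψ - a x`, `ψ' = da(dφ_t ξ) - K y`.
Everything rests on the variable `w = ψ - a x - b y`. Holomorphy means that on `SM` one has `dA = D
(ω₁ + i ω₂) + i m A ψ` with one complex number `D` at each point, so the derivatives of `A` cancel
and there remains (`hasDerivAt_dflow`) `y' = b y + w`, `w' = P y + (m - 1) b w`, where `P = -K + (m
- 1) |A|² > 0`.

Domination. Since `P > 0`, the cone `y w > 0` is preserved. The quotient `r = w / y` solves the
Riccati equation `r' = P + (q - p) r - r²`, with `p = b` and `q = (m - 1) b`. By compactness some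
interval `[ε, L]` with `ε > 0` is invariant (`exists_isTrap`), and in it two solutions approach each
other exponentially in the distance of their logarithms (`sq_sub_le_of_isRiccati`). Letting the
initial time tend to `-∞` gives a continuous invariant slope `Ru > 0` (`exists_unstable_slope`);
reversing time and the sign of `w` gives `Rs < 0` (`exists_stable_slope`). On a line `w = R y` one
has `y' = (p + R) y`, so the uniform gap between `Ru` and `Rs` is the domination (`abs_mul_abs_le`).

The Anosov property. For `m = 2` one has `p = q = b` and `P - p² = -K + a² ≥ k > 0`, whence `(y w)'
= (p y + w)² + (P - p²) y² ≥ k y²`. On the stable line `y w` is negative and comparable to `y²`, so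
`y` decays exponentially (`exists_stable_decay`). Then `x' = a y` is integrable, and the choice of
`x(0)` for which `x` tends to `0` lifts the line from the quotient to `TSM` (`exists_stable_lift`).
The unstable line comes from reversed time.

The Jacobi equations are derived in a holomorphic coordinate `z`. With `W = dz(v)` the structure
equations read `dz = W (ω₁ + i ω₂)` and `dW = W (i ψ + μ dz)`, and `dμ ∧ dz` carries the curvature.
Equality of mixed partial derivatives of `z` and `W` along a variation through orbits gives the
result (`Thermostat.hasDerivAt_variation`). -/

theorem hasDerivAt_comp_curve {F : N → W} {γ : ℝ → N} {s : ℝ}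
    (hF : MDifferentiableAt I 𝓘(ℝ, W) F (γ s)) (hγ : MDifferentiableAt 𝓘(ℝ, ℝ) I γ s) :
    HasDerivAt (fun r => F (γ r)) (mvfderiv I F (γ s) (mfderiv 𝓘(ℝ, ℝ) I γ s (1 : ℝ))) s := by
  let L : ℝ →L[ℝ] W := (mfderiv I 𝓘(ℝ, W) F (γ s)).comp (mfderiv 𝓘(ℝ, ℝ) I γ s)
  have h : HasFDerivAt (F ∘ γ) L s := (hF.hasMFDerivAt.comp s hγ.hasMFDerivAt).hasFDerivAt
  exact h.hasDerivAt

theorem mvfderiv_clm_comp {W' : Type*} [NormedAddCommGroup W'] [NormedSpace ℝ W'] (L : W →L[ℝ] W')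
    {F : N → W} {x : N} (hF : MDifferentiableAt I 𝓘(ℝ, W) F x) (v : TangentSpace I x) :
    mvfderiv I (fun y => L (F y)) x v = L (mvfderiv I F x v) := by
  have h1 : HasMFDerivAt 𝓘(ℝ, W) 𝓘(ℝ, W') L (F x) L := L.hasFDerivAt.hasMFDerivAt
  have h := (h1.comp x hF.hasMFDerivAt).mfderiv
  show mfderiv I 𝓘(ℝ, W') (L ∘ F) x v = _
  rw [h]; rfl

theorem mvfderiv_congr {F G : N → W} {x : N} (h : F =ᶠ[𝓝 x] G) :
    mvfderiv I F x = mvfderiv I G x := by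
  ext v
  exact congrArg (fun L : TangentSpace I x →L[ℝ] W => L v) h.mfderiv_eq

theorem mvfderiv_cmul {F G : N → ℂ} {x : N} (hF : MDifferentiableAt I 𝓘(ℝ, ℂ) F x)
    (hG : MDifferentiableAt I 𝓘(ℝ, ℂ) G x) (v : TangentSpace I x) :
    mvfderiv I (fun y => F y * G y) x v = F x * mvfderiv I G x v + mvfderiv I F x v * G x := by
  have h := (hF.hasMFDerivAt.mul' hG.hasMFDerivAt).mfderiv
  show mfderiv I 𝓘(ℝ, ℂ) (F * G) x v = _
  rw [h]; rfl

theorem mdifferentiableAt_cmul {F G : N → ℂ} {x : N} (hF : MDifferentiableAt I 𝓘(ℝ, ℂ) F x)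
    (hG : MDifferentiableAt I 𝓘(ℝ, ℂ) G x) :
    MDifferentiableAt I 𝓘(ℝ, ℂ) (fun y => F y * G y) x :=
  (hF.hasMFDerivAt.mul' hG.hasMFDerivAt).mdifferentiableAt

theorem mdifferentiableAt_cinv {F : N → ℂ} {x : N} (hF : MDifferentiableAt I 𝓘(ℝ, ℂ) F x)
    (h0 : F x ≠ 0) : MDifferentiableAt I 𝓘(ℝ, ℂ) (fun y => (F y)⁻¹) x := by
  have h1 : MDifferentiableAt 𝓘(ℝ, ℂ) 𝓘(ℝ, ℂ) (fun w : ℂ => w⁻¹) (F x) :=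
    (differentiableAt_inv (𝕜 := ℝ) h0).mdifferentiableAt
  exact h1.comp x hF

theorem mvfderiv_cinv {F : N → ℂ} {x : N} (hF : MDifferentiableAt I 𝓘(ℝ, ℂ) F x)
    (h0 : F x ≠ 0) (v : TangentSpace I x) :
    mvfderiv I (fun y => (F y)⁻¹) x v = - mvfderiv I F x v / F x ^ 2 := by
  have h1 : mvfderiv I (fun y => F y * (F y)⁻¹) x v = 0 := by
    have : (fun y => F y * (F y)⁻¹) =ᶠ[𝓝 x] fun _ => (1 : ℂ) := by
      filter_upwards [hF.continuousAt.eventually_ne h0] with y hy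
      exact mul_inv_cancel₀ hy
    rw [mvfderiv_congr this, mvfderiv_const]; rfl
  rw [mvfderiv_cmul hF (mdifferentiableAt_cinv hF h0)] at h1
  field_simp at h1 ⊢
  linear_combination h1

/-- The function `v ↦ dF(v)` on the tangent bundle is smooth. -/
theorem contMDiffOn_mvfderiv [IsManifold I ∞ N] {F : N → W} {U : Set N} (hU : IsOpen U)
    (hF : ContMDiffOn I 𝓘(ℝ, W) ∞ F U) :
    ContMDiffOn I.tangent 𝓘(ℝ, W) ∞ (fun v : TangentBundle I N => mvfderiv I F v.1 v.2)
      (TotalSpace.proj ⁻¹' U) := by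
  have h := hF.contMDiffOn_tangentMapWithin (m := ∞) le_rfl hU.uniqueMDiffOn
  have h2 := (contMDiff_snd_tangentBundle_modelSpace (n := ∞) W 𝓘(ℝ, W)).comp_contMDiffOn h
  refine h2.congr fun v hv => ?_
  have : mfderivWithin I 𝓘(ℝ, W) F U v.1 = mfderiv I 𝓘(ℝ, W) F v.1 :=
    mfderivWithin_of_isOpen hU hv
  show mfderiv I 𝓘(ℝ, W) F v.1 v.2 = mfderivWithin I 𝓘(ℝ, W) F U v.1 v.2
  rw [this]

variable [I.Boundaryless] [IsManifold I ∞ N]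

/-- The pullback of `V` to the chart applies the inverse of the differential of the inverse chart,
which the chain rule undoes. This moves directional derivatives, and with them the bracket identity,
into the model space. -/
theorem fderiv_comp_extChartAt_symm {G : N → W} {x y : N} (hy : y ∈ (extChartAt I x).source)
    (hG : MDifferentiableAt I 𝓘(ℝ, W) G y) (V : ∀ y : N, TangentSpace I y) :
    fderiv ℝ (G ∘ (extChartAt I x).symm) (extChartAt I x y)
      (mpullbackWithin 𝓘(ℝ, E) I (extChartAt I x).symm V (range I) (extChartAt I x y))
      = mvfderiv I G y (V y) := by
  have hm : extChartAt I x y ∈ (extChartAt I x).target := (extChartAt I x).map_source hy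
  have hinv := isInvertible_mfderivWithin_extChartAt_symm (I := I) hm
  have hl : (extChartAt I x).symm (extChartAt I x y) = y := (extChartAt I x).left_inv hy
  have hr : range I = univ := I.range_eq_univ
  have hs : MDifferentiableAt 𝓘(ℝ, E) I (extChartAt I x).symm (extChartAt I x y) := by
    have := (contMDiffOn_extChartAt_symm (I := I) (n := ∞) x).contMDiffAt
      ((isOpen_extChartAt_target x).mem_nhds hm)
    exact this.mdifferentiableAt (by simp)
  have hG' : MDifferentiableAt I 𝓘(ℝ, W) G ((extChartAt I x).symm (extChartAt I x y)) := by
    rwa [hl]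
  let L : E →L[ℝ] W := (mfderiv I 𝓘(ℝ, W) G ((extChartAt I x).symm (extChartAt I x y))).comp
    (mfderiv 𝓘(ℝ, E) I (extChartAt I x).symm (extChartAt I x y))
  have h : HasFDerivAt (G ∘ (extChartAt I x).symm) L (extChartAt I x y) :=
    (hG'.hasMFDerivAt.comp _ hs.hasMFDerivAt).hasFDerivAt
  rw [h.fderiv, mpullbackWithin_apply, hr, mfderivWithin_univ]
  rw [hr, mfderivWithin_univ] at hinv
  obtain ⟨e, he⟩ := hinv
  have key : ∀ w, (mfderiv 𝓘(ℝ, E) I (extChartAt I x).symm (extChartAt I x y))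
      ((mfderiv 𝓘(ℝ, E) I (extChartAt I x).symm (extChartAt I x y)).inverse w) = w := by
    intro w
    rw [← he, ContinuousLinearMap.inverse_equiv]
    exact e.apply_symm_apply w
  have key2 := key (V ((extChartAt I x).symm (extChartAt I x y)))
  show mfderiv I 𝓘(ℝ, W) G ((extChartAt I x).symm (extChartAt I x y))
    (mfderiv 𝓘(ℝ, E) I (extChartAt I x).symm (extChartAt I x y)
      ((mfderiv 𝓘(ℝ, E) I (extChartAt I x).symm (extChartAt I x y)).inverse _)) =
      mfderiv I 𝓘(ℝ, W) G y (V y)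
  rw [key2, hl]

/-- `dF([V, W]) = V(W F) - W(V F)`. -/
theorem mvfderiv_mlieBracket [CompleteSpace E] {F : N → W} {x : N} (hF : ∀ᶠ y in 𝓝 x, ContMDiffAt I 𝓘(ℝ, W) ∞ F y)
    {X Y : ∀ y : N, TangentSpace I y}
    (hX : ContMDiffAt I I.tangent ∞ (fun y => (⟨y, X y⟩ : TangentBundle I N)) x)
    (hY : ContMDiffAt I I.tangent ∞ (fun y => (⟨y, Y y⟩ : TangentBundle I N)) x)
    (hXF : MDifferentiableAt I 𝓘(ℝ, W) (fun y => mvfderiv I F y (X y)) x)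
    (hYF : MDifferentiableAt I 𝓘(ℝ, W) (fun y => mvfderiv I F y (Y y)) x) :
    mvfderiv I F x (mlieBracket I X Y x) =
      mvfderiv I (fun y => mvfderiv I F y (Y y)) x (X x)
        - mvfderiv I (fun y => mvfderiv I F y (X y)) x (Y x) := by
  have hr : range I = univ := I.range_eq_univ
  have : IsManifold I 2 N := IsManifold.of_le (n := ∞) ENat.LEInfty.out
  set φ := extChartAt I x with hφ
  let P : (∀ y : N, TangentSpace I y) → E → E := fun V => mpullbackWithin 𝓘(ℝ, E) I φ.symm V (range I)
  set F' : E → W := F ∘ φ.symm with hF'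
  have hxs : x ∈ φ.source := mem_extChartAt_source x
  have hFx : ContMDiffAt I 𝓘(ℝ, W) ∞ F x := hF.self_of_nhds
  have hsm : ContMDiffAt 𝓘(ℝ, E) I ∞ φ.symm (φ x) :=
    (contMDiffOn_extChartAt_symm (I := I) (n := ∞) x).contMDiffAt
      ((isOpen_extChartAt_target x).mem_nhds (φ.map_source hxs))
  have hlx : φ.symm (φ x) = x := φ.left_inv hxs
  have hF's : ContDiffAt ℝ ∞ F' (φ x) := by
    have : ContMDiffAt I 𝓘(ℝ, W) ∞ F (φ.symm (φ x)) := by rwa [hlx]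
    exact (this.comp _ hsm).contDiffAt
  have dX : DifferentiableAt ℝ (P X) (φ x) := by
    have := MDifferentiableWithinAt.differentiableWithinAt_mpullbackWithin_vectorField (s := univ)
      (V := X) (x := x) (by
        exact (hX.mdifferentiableAt (by simp)).mdifferentiableWithinAt)
    rw [preimage_univ, univ_inter] at this
    refine this.differentiableAt ?_
    rw [hr]; exact Filter.univ_mem
  have dY : DifferentiableAt ℝ (P Y) (φ x) := by
    have := MDifferentiableWithinAt.differentiableWithinAt_mpullbackWithin_vectorField (s := univ)
      (V := Y) (x := x) (by
        exact (hY.mdifferentiableAt (by simp)).mdifferentiableWithinAt)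
    rw [preimage_univ, univ_inter] at this
    refine this.differentiableAt ?_
    rw [hr]; exact Filter.univ_mem
  have d2F : DifferentiableAt ℝ (fderiv ℝ F') (φ x) :=
    (hF's.fderiv_right (m := 1) (show ((1 : ℕ∞ω) + 1) ≤ ∞ by rw [one_add_one_eq_two]; exact ENat.LEInfty.out)).differentiableAt (by simp)
  have hev : ∀ᶠ u in 𝓝 (φ x), u ∈ φ.target ∧ ContMDiffAt I 𝓘(ℝ, W) ∞ F (φ.symm u) := by
    refine Filter.Eventually.and ((isOpen_extChartAt_target x).mem_nhds (φ.map_source hxs)) ?_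
    have := hsm.continuousAt
    rw [ContinuousAt, hlx] at this
    exact this.eventually hF
  have hdir : ∀ V : ∀ y : N, TangentSpace I y,
      (fun u => fderiv ℝ F' u (P V u))
        =ᶠ[𝓝 (φ x)] (fun y => mvfderiv I F y (V y)) ∘ φ.symm := by
    intro V
    filter_upwards [hev] with u hu
    have h1 := fderiv_comp_extChartAt_symm (x := x) (y := φ.symm u) (G := F) (φ.map_target hu.1)
      (hu.2.mdifferentiableAt (by simp)) V
    rw [← hφ, φ.right_inv hu.1] at h1
    exact h1
  have hbr : mvfderiv I F x (mlieBracket I X Y x)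
      = fderiv ℝ F' (φ x) (lieBracket ℝ (P X) (P Y) (φ x)) := by
    let br : E := lieBracket ℝ (P X) (P Y) (φ x)
    have h1 : mlieBracket I X Y x = (mfderiv I 𝓘(ℝ, E) φ x).inverse br := by
      rw [← mlieBracketWithin_univ, mlieBracketWithin_apply]
      have : φ.symm ⁻¹' univ ∩ range I = univ := by rw [hr]; simp
      rw [← hφ, this]
      exact congrArg _ (congrFun lieBracketWithin_univ _)
    rw [← fderiv_comp_extChartAt_symm (x := x) hxs (hFx.mdifferentiableAt (by simp))
      (mlieBracket I X Y), ← hφ, mpullbackWithin_apply, hlx, h1]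
    congr 1
    have h2 := mfderivWithin_extChartAt_symm_comp_mfderiv_extChartAt' (I := I) (x := x) (y := x)
      hxs
    rw [← hφ] at h2
    have i1 : (mfderivWithin 𝓘(ℝ, E) I φ.symm (range I) (φ x)).IsInvertible :=
      isInvertible_mfderivWithin_extChartAt_symm (φ.map_source hxs)
    have i2 : (mfderiv I 𝓘(ℝ, E) φ x).IsInvertible :=
      isInvertible_mfderiv_extChartAt hxs
    obtain ⟨a, ha⟩ := i1
    obtain ⟨b, hb⟩ := i2
    rw [← ha, ← hb] at h2 ⊢
    rw [ContinuousLinearMap.inverse_equiv]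
    refine Eq.trans (b := a.symm (b.symm br))
      (DFunLike.congr_fun (ContinuousLinearMap.inverse_equiv a) _) ?_
    have h3 : a (b (b.symm br)) = b.symm br := DFunLike.congr_fun h2 (b.symm br)
    have h4 : a (b (b.symm br)) = a br := congrArg a (b.apply_symm_apply br)
    exact (congrArg a.symm (h3.symm.trans h4)).trans (a.symm_apply_apply br)
  -- Differentiating a directional derivative again gives a Hessian term and a term containing the
  -- derivative of the field. In the difference the Hessian terms cancel by symmetry, and the other
  -- terms form the bracket in the chart.
  have hsecond : ∀ (V V' : ∀ y : N, TangentSpace I y),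
      DifferentiableAt ℝ (P V) (φ x) →
      MDifferentiableAt I 𝓘(ℝ, W) (fun y => mvfderiv I F y (V y)) x →
      mvfderiv I (fun y => mvfderiv I F y (V y)) x (V' x) =
        fderiv ℝ (fderiv ℝ F') (φ x) (P V' (φ x))
          (P V (φ x))
        + fderiv ℝ F' (φ x) (fderiv ℝ (P V) (φ x)
          (P V' (φ x))) := by
    intro V V' dV hV
    rw [← fderiv_comp_extChartAt_symm (x := x) hxs hV V', ← hφ, ← (hdir V).fderiv_eq]
    have h := (d2F.hasFDerivAt.clm_apply dV.hasFDerivAt).fderiv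
    erw [h]
    simp
    exact add_comm _ _
  have hsymm := (hF's.isSymmSndFDerivAt (n := ∞) (by rw [minSmoothness_of_isRCLikeNormedField]; exact ENat.LEInfty.out)).eq (P X (φ x)) (P Y (φ x))
  rw [hbr, hsecond Y X dY hYF, hsecond X Y dX hXF, lieBracket_eq, map_sub]
  rw [hsymm]
  abel

end Calculus

section Surface

variable {M : Type*} [TopologicalSpace M] [ChartedSpace Plane M] [IsManifold (𝓡 2) ∞ M]
variable {g : Metric M}

/-! ### Plane geometry in the tangent spaces -/

namespace Rotation

variable (J : Rotation g) {x : M}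

theorem inner_left (v w : TangentSpace (𝓡 2) x) :
    g.inner x (J.toFun x v) w = - g.inner x v (J.toFun x w) := by
  have h := J.inner_self x (v + w)
  simp only [map_add, add_apply] at h
  have h1 := J.inner_self x v
  have h2 := J.inner_self x w
  have h3 := g.symm x (J.toFun x w) v
  linarith

theorem inner_right (v : TangentSpace (𝓡 2) x) : g.inner x v (J.toFun x v) = 0 := by
  rw [g.symm, J.inner_self]

theorem inner_rot (v w : TangentSpace (𝓡 2) x) :
    g.inner x (J.toFun x v) (J.toFun x w) = g.inner x v w := by
  have h := J.isometry x (v + w)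
  simp only [map_add, add_apply] at h
  have h1 := J.isometry x v
  have h2 := J.isometry x w
  have h3 := g.symm x (J.toFun x w) (J.toFun x v)
  have h4 := g.symm x w v
  linarith

/-- Skewness and isometry make `J J v + v` orthogonal to every vector, hence zero by positivity. -/
theorem rot_rot (v : TangentSpace (𝓡 2) x) : J.toFun x (J.toFun x v) = - v := by
  by_contra h
  have h0 : J.toFun x (J.toFun x v) + v ≠ 0 := fun h' => h (eq_neg_of_add_eq_zero_left h')
  have h1 := g.pos x _ h0
  have h2 : ∀ w, g.inner x (J.toFun x (J.toFun x v) + v) w = 0 := by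
    intro w
    rw [map_add, add_apply, J.inner_left, J.inner_rot]
    ring
  rw [h2] at h1
  exact lt_irrefl _ h1

theorem eq_add {e : TangentSpace (𝓡 2) x} (he : g.inner x e e = 1) (v : TangentSpace (𝓡 2) x) :
    v = g.inner x v e • e + g.inner x v (J.toFun x e) • J.toFun x e := by
  have he' : g.inner x (J.toFun x e) (J.toFun x e) = 1 := by rw [J.isometry, he]
  have h1 : g.inner x e (J.toFun x e) = 0 := J.inner_right e
  have h2 : g.inner x (J.toFun x e) e = 0 := J.inner_self x e
  have hli : LinearIndependent ℝ ![e, J.toFun x e] := by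
    rw [LinearIndependent.pair_iff]
    intro s t hst
    have a1 := congrArg (fun w => g.inner x w e) hst
    have a2 := congrArg (fun w => g.inner x w (J.toFun x e)) hst
    simp only [map_add, map_smul, add_apply, smul_apply,
      he, he', h1, h2, smul_eq_mul, map_zero, zero_apply] at a1 a2
    constructor <;> linarith
  have : FiniteDimensional ℝ (TangentSpace (𝓡 2) x) :=
    inferInstanceAs (FiniteDimensional ℝ Plane)
  have hfr : Module.finrank ℝ (TangentSpace (𝓡 2) x) = 2 := by
    show Module.finrank ℝ (EuclideanSpace ℝ (Fin 2)) = 2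
    simp
  have hspan := hli.span_eq_top_of_card_eq_finrank (by rw [hfr]; simp)
  have hv : v ∈ Submodule.span ℝ (Set.range ![e, J.toFun x e]) := by rw [hspan]; trivial
  simp only [Matrix.range_cons, Matrix.range_empty, union_empty, singleton_union] at hv
  obtain ⟨s, t, rfl⟩ := Submodule.mem_span_pair.1 hv
  simp [he, he', h1, h2]

end Rotation

/-! ### Smoothness of lifts to the tangent bundle -/

section Lifts

variable {E' : Type*} [NormedAddCommGroup E'] [NormedSpace ℝ E'] {H' : Type*} [TopologicalSpace H']
  {I' : ModelWithCorners ℝ E' H'} {N : Type*} [TopologicalSpace N] [ChartedSpace H' N]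

theorem contMDiffAt_inner {b : N → M} {v w : ∀ n, TangentSpace (𝓡 2) (b n)} {n : N}
    (hv : ContMDiffAt I' (𝓡 2).tangent ∞ (fun n => (⟨b n, v n⟩ : TangentBundle (𝓡 2) M)) n)
    (hw : ContMDiffAt I' (𝓡 2).tangent ∞ (fun n => (⟨b n, w n⟩ : TangentBundle (𝓡 2) M)) n) :
    ContMDiffAt I' 𝓘(ℝ, ℝ) ∞ (fun n => g.inner (b n) (v n) (w n)) n := by
  have hb : ContMDiffAt I' (𝓡 2) ∞ b n := by
    rw [contMDiffAt_totalSpace] at hv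
    exact hv.1
  have : ContMDiffAt I' ((𝓡 2).prod 𝓘(ℝ)) ∞
      (fun m ↦ TotalSpace.mk' ℝ (E := Bundle.Trivial M ℝ) (b m) (g.inner (b m) (v m) (w m))) n := by
    apply ContMDiffAt.clm_bundle_apply₂ (F₁ := Plane) (F₂ := Plane)
    · exact ContMDiffAt.comp n g.contMDiff.contMDiffAt hb
    · exact hv
    · exact hw
  rw [contMDiffAt_totalSpace] at this
  exact this.2

theorem contMDiffAt_smul_add_smul {b : N → M} {v w : ∀ n, TangentSpace (𝓡 2) (b n)} {p q : N → ℝ}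
    {n : N} (hp : ContMDiffAt I' 𝓘(ℝ, ℝ) ∞ p n) (hq : ContMDiffAt I' 𝓘(ℝ, ℝ) ∞ q n)
    (hv : ContMDiffAt I' (𝓡 2).tangent ∞ (fun n => (⟨b n, v n⟩ : TangentBundle (𝓡 2) M)) n)
    (hw : ContMDiffAt I' (𝓡 2).tangent ∞ (fun n => (⟨b n, w n⟩ : TangentBundle (𝓡 2) M)) n) :
    ContMDiffAt I' (𝓡 2).tangent ∞
      (fun n => (⟨b n, p n • v n + q n • w n⟩ : TangentBundle (𝓡 2) M)) n := by
  rw [contMDiffAt_totalSpace] at hv hw ⊢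
  refine ⟨hv.1, ?_⟩
  have h := (hp.smul hv.2).add (hq.smul hw.2)
  refine h.congr_of_eventuallyEq ?_
  have hb : ∀ᶠ m in 𝓝 n, b m ∈ (trivializationAt Plane (TangentSpace (𝓡 2)) (b n)).baseSet :=
    hv.1.continuousAt.eventually
      ((trivializationAt Plane (TangentSpace (𝓡 2)) (b n)).open_baseSet.mem_nhds
        (mem_baseSet_trivializationAt _ _ _))
  filter_upwards [hb] with m hm
  have hl := Trivialization.linear ℝ (trivializationAt Plane (TangentSpace (𝓡 2)) (b n)) hm
  rw [hl.map_add, hl.map_smul, hl.map_smul]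
  rfl

theorem contMDiffAt_rotation (J : Rotation g) {b : N → M} {v : ∀ n, TangentSpace (𝓡 2) (b n)}
    {n : N}
    (hv : ContMDiffAt I' (𝓡 2).tangent ∞ (fun n => (⟨b n, v n⟩ : TangentBundle (𝓡 2) M)) n) :
    ContMDiffAt I' (𝓡 2).tangent ∞
      (fun n => (⟨b n, J.toFun (b n) (v n)⟩ : TangentBundle (𝓡 2) M)) n :=
  ContMDiffAt.comp n J.smooth.contMDiffAt hv

end Lifts

/-! ### The local unit field -/

theorem contMDiffOn_coordField (x₀ : M) :
    ContMDiffOn (𝓡 2) (𝓡 2).tangent ∞ (fun y => (⟨y, (trivializationAt Plane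
      (fun x : M => TangentSpace (𝓡 2) x) x₀).symm y (EuclideanSpace.single 0 1)⟩ :
        TangentBundle (𝓡 2) M)) (chartAt Plane x₀).source := by
  have h := Trivialization.contMDiffOn_symm (IB := 𝓡 2) (n := ∞)
    (trivializationAt Plane (TangentSpace (𝓡 2) : M → Type _) x₀)
  have h2 : ContMDiffOn (𝓡 2) ((𝓡 2).prod 𝓘(ℝ, Plane)) ∞
      (fun y : M => (y, (EuclideanSpace.single 0 1 : Plane))) (chartAt Plane x₀).source :=
    contMDiffOn_id.prodMk contMDiffOn_const
  refine (h.comp h2 ?_).congr ?_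
  · intro y hy
    show (y, (EuclideanSpace.single 0 1 : Plane)) ∈
      (trivializationAt Plane (TangentSpace (𝓡 2) : M → Type _) x₀).target
    rw [Trivialization.mem_target]
    exact hy
  · intro y hy
    exact Trivialization.mk_symm _ hy _

theorem coordField_ne_zero {x₀ y : M} (hy : y ∈ (chartAt Plane x₀).source) :
    (trivializationAt Plane (fun x : M => TangentSpace (𝓡 2) x) x₀).symm y
      (EuclideanSpace.single 0 1) ≠ 0 := by
  set t := trivializationAt Plane (fun x : M => TangentSpace (𝓡 2) x) x₀
  have hy' : y ∈ t.baseSet := hy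
  rw [← Trivialization.symmL_apply (R := ℝ) t hy', ← Trivialization.symm_continuousLinearEquivAt_eq (R := ℝ) t hy']
  intro h
  have h1 : (EuclideanSpace.single 0 1 : Plane) = 0 :=
    (t.continuousLinearEquivAt ℝ y hy').symm.map_eq_zero_iff.1 h
  have := congrArg (fun w : Plane => w 0) h1
  simp at this

theorem inner_unitField {x₀ y : M} (hy : y ∈ (chartAt Plane x₀).source) :
    g.inner y (unitField g x₀ y) (unitField g x₀ y) = 1 := by
  have hpos := g.pos y _ (coordField_ne_zero hy)
  simp only [unitField, map_smul, smul_apply, smul_eq_mul]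
  set a := g.inner y _ _ with ha
  have : Real.sqrt a * Real.sqrt a = a := Real.mul_self_sqrt hpos.le
  have h0 : Real.sqrt a ≠ 0 := (Real.sqrt_pos.2 hpos).ne'
  field_simp
  rw [sq, this]

theorem contMDiffAt_unitField {x₀ y : M} (hy : y ∈ (chartAt Plane x₀).source) :
    ContMDiffAt (𝓡 2) (𝓡 2).tangent ∞
      (fun y => (⟨y, unitField g x₀ y⟩ : TangentBundle (𝓡 2) M)) y := by
  have h := (contMDiffOn_coordField x₀).contMDiffAt ((chartAt Plane x₀).open_source.mem_nhds hy)
  have hpos := g.pos y _ (coordField_ne_zero hy)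
  have hi := contMDiffAt_inner (g := g) h h
  have hs : ContMDiffAt (𝓡 2) 𝓘(ℝ, ℝ) ∞ (fun y : M => (Real.sqrt (g.inner y
      ((trivializationAt Plane (fun x : M => TangentSpace (𝓡 2) x) x₀).symm y
        (EuclideanSpace.single 0 1))
      ((trivializationAt Plane (fun x : M => TangentSpace (𝓡 2) x) x₀).symm y
        (EuclideanSpace.single 0 1))))⁻¹) y := by
    have h1 : ContDiffAt ℝ ∞ (fun r : ℝ => (Real.sqrt r)⁻¹) (g.inner y
      ((trivializationAt Plane (fun x : M => TangentSpace (𝓡 2) x) x₀).symm y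
        (EuclideanSpace.single 0 1))
      ((trivializationAt Plane (fun x : M => TangentSpace (𝓡 2) x) x₀).symm y
        (EuclideanSpace.single 0 1))) :=
      (Real.contDiffAt_sqrt hpos.ne').inv (Real.sqrt_pos.2 hpos).ne'
    exact ContMDiffAt.comp (g := fun r : ℝ => (Real.sqrt r)⁻¹) y h1.contMDiffAt hi
  have := contMDiffAt_smul_add_smul hs (contMDiffAt_const (c := (0 : ℝ))) h h
  simpa only [unitField, zero_smul, add_zero] using this

theorem exists_eq_cos_sin {x : M} (J : Rotation g) {e : TangentSpace (𝓡 2) x}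
    (he : g.inner x e e = 1) {v : TangentSpace (𝓡 2) x} (hv : g.inner x v v = 1) :
    ∃ θ : ℝ, v = Real.cos θ • e + Real.sin θ • J.toFun x e := by
  set p := g.inner x v e
  set q := g.inner x v (J.toFun x e)
  have hd : v = p • e + q • J.toFun x e := J.eq_add he v
  have hpq : p ^ 2 + q ^ 2 = 1 := by
    have h := hv
    rw [hd] at h
    simp only [map_add, map_smul, add_apply, smul_apply,
      he, J.isometry, J.inner_self, J.inner_right, smul_eq_mul] at h
    linarith
  have hn : ‖(⟨p, q⟩ : ℂ)‖ = 1 := by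
    rw [Complex.norm_eq_sqrt_sq_add_sq, hpq, Real.sqrt_one]
  refine ⟨Complex.arg ⟨p, q⟩, ?_⟩
  have h0 : (⟨p, q⟩ : ℂ) ≠ 0 := by
    intro h; rw [h] at hn; simp at hn
  rw [Complex.cos_arg h0, Complex.sin_arg, hn]
  simpa using hd

theorem inner_cos_sin {x : M} (J : Rotation g) {e : TangentSpace (𝓡 2) x}
    (he : g.inner x e e = 1) (θ : ℝ) :
    g.inner x (Real.cos θ • e + Real.sin θ • J.toFun x e)
      (Real.cos θ • e + Real.sin θ • J.toFun x e) = 1 := by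
  simp only [map_add, map_smul, add_apply, smul_apply,
      he, J.isometry, J.inner_self, J.inner_right, smul_eq_mul]
  nlinarith [Real.sin_sq_add_cos_sq θ]

/-- The function `N` with `|dz(v)|² = N g(v, v)` for a holomorphic coordinate `z`. -/
def conformalFactor (g : Metric M) (z : M → ℂ) (y : M) : ℝ :=
  Complex.normSq (mvfderiv (𝓡 2) z y (unitField g y y))

/-- The function `μ` with `dN(w) - i dN(J w) = 2 N μ dz(w)` for a holomorphic coordinate `z` with
conformal factor `N`, that is, `μ = ∂ log N / ∂z`. -/
def logDerivFactor (J : Rotation g) (z : M → ℂ) (y : M) : ℂ :=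
  (mvfderiv (𝓡 2) (conformalFactor g z) y (unitField g y y)
    - Complex.I * mvfderiv (𝓡 2) (conformalFactor g z) y (J.toFun y (unitField g y y)))
    / (2 * conformalFactor g z y * mvfderiv (𝓡 2) z y (unitField g y y))

/-- A smooth orthonormal frame `(e, J e)` on a neighbourhood of `y`, given by `e`. -/
structure IsUnitFieldAt (g : Metric M) (e : ∀ y : M, TangentSpace (𝓡 2) y) (y : M) : Prop where
  smooth : ∀ᶠ x in 𝓝 y, ContMDiffAt (𝓡 2) (𝓡 2).tangent ∞
    (fun y => (⟨y, e y⟩ : TangentBundle (𝓡 2) M)) x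
  unit : ∀ᶠ x in 𝓝 y, g.inner x (e x) (e x) = 1

theorem isUnitFieldAt_unitField {x₀ y : M} (hy : y ∈ (chartAt Plane x₀).source) :
    IsUnitFieldAt g (unitField g x₀) y := by
  have h := (chartAt Plane x₀).open_source.mem_nhds hy
  constructor
  · filter_upwards [h] with x hx using contMDiffAt_unitField hx
  · filter_upwards [h] with x hx using inner_unitField hx

theorem inner_unitField_self (y : M) : g.inner y (unitField g y y) (unitField g y y) = 1 :=
  inner_unitField (mem_chart_source _ y)

theorem IsUnitFieldAt.eventually {e : ∀ y : M, TangentSpace (𝓡 2) y} {y : M}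
    (h : IsUnitFieldAt g e y) : ∀ᶠ x in 𝓝 y, IsUnitFieldAt g e x := by
  filter_upwards [h.smooth.eventually_nhds, h.unit.eventually_nhds] with x h1 h2 using ⟨h1, h2⟩

theorem contMDiffAt_mvfderiv_field {W : Type*} [NormedAddCommGroup W] [NormedSpace ℝ W]
    {F : M → W} {y : M} (hF : ∀ᶠ x in 𝓝 y, ContMDiffAt (𝓡 2) 𝓘(ℝ, W) ∞ F x)
    {e : ∀ y : M, TangentSpace (𝓡 2) y} (he : ContMDiffAt (𝓡 2) (𝓡 2).tangent ∞
      (fun y => (⟨y, e y⟩ : TangentBundle (𝓡 2) M)) y) :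
    ContMDiffAt (𝓡 2) 𝓘(ℝ, W) ∞ (fun y => mvfderiv (𝓡 2) F y (e y)) y := by
  obtain ⟨O, hO, hOo, hyO⟩ := eventually_nhds_iff.1 hF
  have h := contMDiffOn_mvfderiv hOo (fun x hx => (hO x hx).contMDiffWithinAt)
  have hopen : IsOpen (TotalSpace.proj ⁻¹' O : Set (TangentBundle (𝓡 2) M)) :=
    hOo.preimage (FiberBundle.continuous_proj Plane (TangentSpace (𝓡 2)))
  have h2 := h.contMDiffAt (x := ⟨y, e y⟩) (hopen.mem_nhds hyO)
  exact ContMDiffAt.comp y h2 he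

/-! ### Holomorphic coordinates: conformal factor, connection form and curvature. -/

namespace IsHolomorphicCoordinate

variable {J : Rotation g} {z : M → ℂ} {U : Set M} (hz : IsHolomorphicCoordinate J z U)
include hz

theorem contMDiffAt {y : M} (hy : y ∈ U) : ContMDiffAt (𝓡 2) 𝓘(ℝ, ℂ) ∞ z y :=
  hz.smooth.contMDiffAt (hz.isOpen.mem_nhds hy)

theorem eventually_contMDiffAt {y : M} (hy : y ∈ U) :
    ∀ᶠ x in 𝓝 y, ContMDiffAt (𝓡 2) 𝓘(ℝ, ℂ) ∞ z x := by
  filter_upwards [hz.isOpen.mem_nhds hy] with x hx using hz.contMDiffAt hx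

theorem mvfderiv_eq {y : M} (hy : y ∈ U) {e : TangentSpace (𝓡 2) y} (he : g.inner y e e = 1)
    (v : TangentSpace (𝓡 2) y) : mvfderiv (𝓡 2) z y v =
      (g.inner y v e + Complex.I * g.inner y v (J.toFun y e)) * mvfderiv (𝓡 2) z y e := by
  conv_lhs => rw [J.eq_add he v]
  rw [map_add, map_smul, map_smul, hz.complexLinear y hy]
  simp only [Complex.real_smul]
  ring

theorem mvfderiv_ne_zero {y : M} (hy : y ∈ U) {v : TangentSpace (𝓡 2) y} (hv : v ≠ 0) :
    mvfderiv (𝓡 2) z y v ≠ 0 := fun h => hv (hz.immersion y hy v h)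

theorem mvfderiv_ne_zero_of_unit {y : M} (hy : y ∈ U) {v : TangentSpace (𝓡 2) y}
    (hv : g.inner y v v = 1) : mvfderiv (𝓡 2) z y v ≠ 0 := by
  refine hz.mvfderiv_ne_zero hy ?_
  rintro rfl
  simp at hv

/-- Two unit vectors differ by a rotation, which multiplies `dz` by a complex number of modulus one.
This matters because `unitField g y y` changes its chart with `y` and need not be smooth:
`conformalFactor` may now be computed with one smooth frame near each point. -/
theorem normSq_mvfderiv {y : M} (hy : y ∈ U) {v : TangentSpace (𝓡 2) y}
    (hv : g.inner y v v = 1) :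
    Complex.normSq (mvfderiv (𝓡 2) z y v) = conformalFactor g z y := by
  rw [hz.mvfderiv_eq hy hv (unitField g y y) |> fun h => (by rw [conformalFactor, h] :
    conformalFactor g z y = _), map_mul]
  have h := J.eq_add hv (unitField g y y)
  have h1 := inner_unitField_self (g := g) y
  set p := g.inner y (unitField g y y) v
  set q := g.inner y (unitField g y y) (J.toFun y v)
  rw [h] at h1
  simp only [map_add, map_smul, add_apply, smul_apply, hv, J.isometry, J.inner_self,
    J.inner_right, smul_eq_mul] at h1
  have : Complex.normSq (p + Complex.I * q) = 1 := by
    rw [Complex.normSq_apply]; simp; linarith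
  rw [this, one_mul]

theorem conformalFactor_pos {y : M} (hy : y ∈ U) : 0 < conformalFactor g z y :=
  Complex.normSq_pos.2 (hz.mvfderiv_ne_zero_of_unit hy (inner_unitField_self y))

theorem inner_mul_conformalFactor {y : M} (hy : y ∈ U) (v w : TangentSpace (𝓡 2) y) :
    g.inner y v w * conformalFactor g z y =
      (mvfderiv (𝓡 2) z y v * (starRingEnd ℂ) (mvfderiv (𝓡 2) z y w)).re := by
  have he := inner_unitField_self (g := g) y
  set e := unitField g y y with hee
  have hc : conformalFactor g z y = Complex.normSq (mvfderiv (𝓡 2) z y e) := rfl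
  have hw : g.inner y v w = g.inner y v e * g.inner y w e
      + g.inner y v (J.toFun y e) * g.inner y w (J.toFun y e) := by
    conv_lhs => rw [J.eq_add he w]
    simp only [map_add, map_smul, smul_eq_mul]
    ring
  rw [hw, hz.mvfderiv_eq hy he v, hz.mvfderiv_eq hy he w, hc, Complex.normSq_apply]
  simp
  ring

theorem contMDiffAt_field {e : ∀ y : M, TangentSpace (𝓡 2) y} {y : M} (hy : y ∈ U)
    (he : ContMDiffAt (𝓡 2) (𝓡 2).tangent ∞
      (fun y => (⟨y, e y⟩ : TangentBundle (𝓡 2) M)) y) :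
    ContMDiffAt (𝓡 2) 𝓘(ℝ, ℂ) ∞ (fun y => mvfderiv (𝓡 2) z y (e y)) y :=
  contMDiffAt_mvfderiv_field (hz.eventually_contMDiffAt hy) he

theorem eventually_conformalFactor_eq {e : ∀ y : M, TangentSpace (𝓡 2) y} {y : M} (hy : y ∈ U)
    (he : IsUnitFieldAt g e y) :
    conformalFactor g z =ᶠ[𝓝 y] fun x => Complex.normSq (mvfderiv (𝓡 2) z x (e x)) := by
  filter_upwards [hz.isOpen.mem_nhds hy, he.unit] with x hx hux
  rw [hz.normSq_mvfderiv hx hux]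

theorem contMDiffAt_conformalFactor {y : M} (hy : y ∈ U) :
    ContMDiffAt (𝓡 2) 𝓘(ℝ, ℝ) ∞ (conformalFactor g z) y := by
  have he := isUnitFieldAt_unitField (g := g) (mem_chart_source Plane y)
  have h := hz.contMDiffAt_field hy he.smooth.self_of_nhds
  refine ContMDiffAt.congr_of_eventuallyEq ?_ (hz.eventually_conformalFactor_eq hy he)
  have hn : ContDiff ℝ ∞ (fun w : ℂ => Complex.normSq w) := by
    simp only [Complex.normSq_apply]
    exact (Complex.reCLM.contDiff.mul Complex.reCLM.contDiff).add
      (Complex.imCLM.contDiff.mul Complex.imCLM.contDiff)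
  exact ContMDiffAt.comp (g := fun w : ℂ => Complex.normSq w) y hn.contMDiff.contMDiffAt h

theorem mvfderiv_conformalFactor {e : ∀ y : M, TangentSpace (𝓡 2) y} {y : M} (hy : y ∈ U)
    (he : IsUnitFieldAt g e y) (w : TangentSpace (𝓡 2) y) :
    mvfderiv (𝓡 2) (conformalFactor g z) y w =
      2 * ((starRingEnd ℂ) (mvfderiv (𝓡 2) z y (e y))
        * mvfderiv (𝓡 2) (fun x => mvfderiv (𝓡 2) z x (e x)) y w).re := by
  set c : M → ℂ := fun x => mvfderiv (𝓡 2) z x (e x) with hc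
  have hcd : MDifferentiableAt (𝓡 2) 𝓘(ℝ, ℂ) c y :=
    (hz.contMDiffAt_field hy he.smooth.self_of_nhds).mdifferentiableAt (by simp)
  have hcc : MDifferentiableAt (𝓡 2) 𝓘(ℝ, ℂ) (fun x => (starRingEnd ℂ) (c x)) y :=
    (Complex.conjCLE.toContinuousLinearMap.contDiff (n := ∞)).contMDiff.contMDiffAt.mdifferentiableAt
      (by simp) |>.comp y hcd
  have h1 := mvfderiv_cmul hcc hcd w
  have h2 := mvfderiv_clm_comp Complex.conjCLE.toContinuousLinearMap hcd w
  have h3 := mvfderiv_clm_comp Complex.reCLM (mdifferentiableAt_cmul hcc hcd) w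
  have h4 : conformalFactor g z =ᶠ[𝓝 y] fun x => Complex.reCLM ((starRingEnd ℂ) (c x) * c x) := by
    filter_upwards [hz.eventually_conformalFactor_eq hy he] with x hx
    rw [hx, Complex.normSq_apply]
    simp [c]
  rw [mvfderiv_congr h4, h3, h1]
  have h2' : mvfderiv (𝓡 2) (fun x => (starRingEnd ℂ) (c x)) y w
    = (starRingEnd ℂ) (mvfderiv (𝓡 2) c y w) := h2
  rw [h2']
  simp [c]
  ring

/-- Both sides are complex linear in `w`, since replacing `w` by `J w` multiplies them by `i`; so it
is enough to compare them on the unit vector in the definition of `logDerivFactor`. Afterwards any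
vector may be used to compute `μ`, in particular a smooth field. -/
theorem logDerivFactor_spec {y : M} (hy : y ∈ U) (w : TangentSpace (𝓡 2) y) :
    mvfderiv (𝓡 2) (conformalFactor g z) y w
      - Complex.I * mvfderiv (𝓡 2) (conformalFactor g z) y (J.toFun y w)
      = 2 * conformalFactor g z y * logDerivFactor J z y * mvfderiv (𝓡 2) z y w := by
  have he := inner_unitField_self (g := g) y
  have h0 := hz.mvfderiv_ne_zero_of_unit hy he
  have hN : (conformalFactor g z y : ℂ) ≠ 0 := by exact_mod_cast (hz.conformalFactor_pos hy).ne'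
  rw [hz.mvfderiv_eq hy he w, logDerivFactor]
  field_simp
  conv_lhs => rw [J.eq_add he w]
  simp only [map_add, map_smul, smul_eq_mul, J.rot_rot, map_neg]
  push_cast
  linear_combination (g.inner y w (J.toFun y (unitField g y y)) *
    mvfderiv (𝓡 2) (conformalFactor g z) y (J.toFun y (unitField g y y)) : ℂ) * Complex.I_sq

theorem contMDiffAt_logDerivFactor {y : M} (hy : y ∈ U) :
    ContMDiffAt (𝓡 2) 𝓘(ℝ, ℂ) ∞ (logDerivFactor J z) y := by
  have he := isUnitFieldAt_unitField (g := g) (mem_chart_source Plane y)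
  set e := unitField g y
  have hs := he.smooth.self_of_nhds
  have hN : ∀ᶠ x in 𝓝 y, ContMDiffAt (𝓡 2) 𝓘(ℝ, ℝ) ∞ (conformalFactor g z) x := by
    filter_upwards [hz.isOpen.mem_nhds hy] with x hx using hz.contMDiffAt_conformalFactor hx
  have ho : ContMDiff 𝓘(ℝ, ℝ) 𝓘(ℝ, ℂ) ∞ (fun r : ℝ => (r : ℂ)) :=
    (Complex.ofRealCLM.contDiff (n := ∞)).contMDiff
  have h1 := ho.contMDiffAt.comp y (contMDiffAt_mvfderiv_field hN hs)
  have h2 := ho.contMDiffAt.comp y (contMDiffAt_mvfderiv_field hN (contMDiffAt_rotation J hs))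
  have h3 := ho.contMDiffAt.comp y hN.self_of_nhds
  have h4 := hz.contMDiffAt_field hy hs
  have h0 := hz.mvfderiv_ne_zero_of_unit hy he.unit.self_of_nhds
  have hF : ContDiffAt ℝ ∞ (fun P : ((ℂ × ℂ) × (ℂ × ℂ)) =>
      (P.1.1 - Complex.I * P.1.2) * (2 * P.2.1 * P.2.2)⁻¹)
      (((mvfderiv (𝓡 2) (conformalFactor g z) y (e y) : ℂ),
        (mvfderiv (𝓡 2) (conformalFactor g z) y (J.toFun y (e y)) : ℂ)),
        ((conformalFactor g z y : ℂ), mvfderiv (𝓡 2) z y (e y))) := by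
    refine ContDiffAt.mul (by fun_prop) (ContDiffAt.inv (by fun_prop) ?_)
    have : (conformalFactor g z y : ℂ) ≠ 0 := by exact_mod_cast (hz.conformalFactor_pos hy).ne'
    simp [this, h0]
  have h := ContMDiffAt.comp y hF.contMDiffAt
    ((h1.prodMk_space h2).prodMk_space (h3.prodMk_space h4))
  refine h.congr_of_eventuallyEq ?_
  filter_upwards [hz.isOpen.mem_nhds hy, he.unit] with x hx hux
  have hsp := hz.logDerivFactor_spec hx (e x)
  have h0 := hz.mvfderiv_ne_zero_of_unit hx hux
  have hN : (conformalFactor g z x : ℂ) ≠ 0 := by exact_mod_cast (hz.conformalFactor_pos hx).ne'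
  simp only [Function.comp]
  rw [hsp]
  field_simp

theorem mvfderiv_frameBracket {e : ∀ y : M, TangentSpace (𝓡 2) y} {y : M} (hy : y ∈ U)
    (he : IsUnitFieldAt g e y) :
    mvfderiv (𝓡 2) z y (frameBracket J e y) =
      Complex.I * mvfderiv (𝓡 2) (fun x => mvfderiv (𝓡 2) z x (e x)) y (e y)
        - mvfderiv (𝓡 2) (fun x => mvfderiv (𝓡 2) z x (e x)) y (J.toFun y (e y)) := by
  have hs := he.smooth.self_of_nhds
  have hsJ := contMDiffAt_rotation J hs
  have hc := (hz.contMDiffAt_field hy hs).mdifferentiableAt (by simp)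
  have h := mvfderiv_mlieBracket (hz.eventually_contMDiffAt hy) hs hsJ hc
    ((hz.contMDiffAt_field hy hsJ).mdifferentiableAt (by simp))
  rw [frameBracket, h]
  congr 1
  have h2 : (fun x => mvfderiv (𝓡 2) z x (J.toFun x (e x))) =ᶠ[𝓝 y]
      fun x => Complex.I * mvfderiv (𝓡 2) z x (e x) := by
    filter_upwards [hz.isOpen.mem_nhds hy] with x hx using hz.complexLinear x hx _
  rw [mvfderiv_congr h2]
  exact mvfderiv_clm_comp (ContinuousLinearMap.mul ℝ ℂ Complex.I) hc _

/-- The connection form in a holomorphic coordinate. -/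
theorem I_mul_connectionForm {e : ∀ y : M, TangentSpace (𝓡 2) y} {y : M} (hy : y ∈ U)
    (he : IsUnitFieldAt g e y) (w : TangentSpace (𝓡 2) y) :
    Complex.I * connectionForm J e y w =
      mvfderiv (𝓡 2) (fun x => mvfderiv (𝓡 2) z x (e x)) y w / mvfderiv (𝓡 2) z y (e y)
        - logDerivFactor J z y * mvfderiv (𝓡 2) z y w := by
  have hu := he.unit.self_of_nhds
  have hN := hz.normSq_mvfderiv hy hu
  have hNp := hz.conformalFactor_pos hy
  have hNc : (conformalFactor g z y : ℂ) ≠ 0 := by exact_mod_cast hNp.ne'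
  have h0 := hz.mvfderiv_ne_zero_of_unit hy hu
  have hsp := hz.logDerivFactor_spec hy w
  have hdw := hz.mvfderiv_conformalFactor hy he w
  have hdJw := hz.mvfderiv_conformalFactor hy he (J.toFun y w)
  have hal := hz.inner_mul_conformalFactor hy (frameBracket J e y) w
  have hcf : g.inner y (frameBracket J e y) w = -connectionForm J e y w := by
    rw [connectionForm, neg_neg]
  rw [hcf] at hal
  rw [hz.mvfderiv_frameBracket hy he, hz.mvfderiv_eq hy hu w] at hal
  have hw := J.eq_add hu w
  set p := g.inner y w (e y)
  set q := g.inner y w (J.toFun y (e y))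
  have hJw : J.toFun y w = p • J.toFun y (e y) - q • e y := by
    conv_lhs => rw [hw]
    rw [map_add, map_smul, map_smul, J.rot_rot, smul_neg, sub_eq_add_neg]
  set dc := mvfderiv (𝓡 2) (fun x => mvfderiv (𝓡 2) z x (e x)) y with hdc
  have hdcw : dc w = p * dc (e y) + q * dc (J.toFun y (e y)) := by
    conv_lhs => rw [hw]
    simp
  have hdcJw : dc (J.toFun y w) = p * dc (J.toFun y (e y)) - q * dc (e y) := by
    rw [hJw]; simp
  have hmu : logDerivFactor J z y * mvfderiv (𝓡 2) z y w =
      (mvfderiv (𝓡 2) (conformalFactor g z) y w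
      - Complex.I * mvfderiv (𝓡 2) (conformalFactor g z) y (J.toFun y w))
      / (2 * conformalFactor g z y) := by
    rw [hsp]; field_simp
  rw [hmu, hdw, hdJw, hdcJw]
  rw [hdcw]
  set c := mvfderiv (𝓡 2) z y (e y)
  set A := dc (e y)
  set B := dc (J.toFun y (e y))
  have hcc : (conformalFactor g z y : ℂ) = c * (starRingEnd ℂ) c := by
    rw [Complex.mul_conj, hN]
  have hinv : (p * A + q * B) / c = (p * A + q * B) * (starRingEnd ℂ) c / conformalFactor g z y := by
    rw [hcc]
    have : (starRingEnd ℂ) c ≠ 0 := by simpa using h0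
    field_simp
  rw [hinv]
  -- The real part of `dc(w) / c` is `d log |c| (w) = dN(w) / (2 N)`, which is also the real part of
  -- `μ dz(w)`. Hence the difference is purely imaginary, as the connection form requires.
  have key : Complex.I * (connectionForm J e y w * conformalFactor g z y : ℝ) =
      (p * A + q * B) * (starRingEnd ℂ) c - (((starRingEnd ℂ) c * (p * A + q * B)).re
        - Complex.I * ((starRingEnd ℂ) c * (p * B - q * A)).re) := by
    have : connectionForm J e y w * conformalFactor g z y = - ((Complex.I * A - B) *
      (starRingEnd ℂ) ((p + Complex.I * q) * c)).re := by linarith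
    rw [this]
    apply Complex.ext
    · simp
      ring
    · simp
      ring
  generalize ((starRingEnd ℂ) c * (p * A + q * B)).re = R at key ⊢
  generalize ((starRingEnd ℂ) c * (p * B - q * A)).re = S at key ⊢
  push_cast at key ⊢
  field_simp
  linear_combination key

/-- The Gauss curvature in a holomorphic coordinate. -/
theorem I_mul_gaussCurvature {y : M} (hy : y ∈ U) :
    Complex.I * gaussCurvature J y =
      (Complex.I * mvfderiv (𝓡 2) (logDerivFactor J z) y (unitField g y y)
        - mvfderiv (𝓡 2) (logDerivFactor J z) y (J.toFun y (unitField g y y)))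
        * mvfderiv (𝓡 2) z y (unitField g y y) := by
  have he := isUnitFieldAt_unitField (g := g) (mem_chart_source Plane y)
  rw [gaussCurvature, frameCurvature]
  set e := unitField g y
  have hs := he.smooth.self_of_nhds
  have hsJ := contMDiffAt_rotation J hs
  set c : M → ℂ := fun x => mvfderiv (𝓡 2) z x (e x) with hc
  have hcs : ∀ᶠ x in 𝓝 y, ContMDiffAt (𝓡 2) 𝓘(ℝ, ℂ) ∞ c x := by
    filter_upwards [hz.isOpen.mem_nhds hy, he.smooth] with x hx hsx using hz.contMDiffAt_field hx hsx
  have hcd := hcs.self_of_nhds.mdifferentiableAt (by simp)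
  have hc0 : c y ≠ 0 := hz.mvfderiv_ne_zero_of_unit hy he.unit.self_of_nhds
  have hci := mdifferentiableAt_cinv hcd hc0
  have hmu := (hz.contMDiffAt_logDerivFactor hy).mdifferentiableAt (by simp)
  have hce := (contMDiffAt_mvfderiv_field hcs hs).mdifferentiableAt (by simp)
  have hcJ := (contMDiffAt_mvfderiv_field hcs hsJ).mdifferentiableAt (by simp)
  -- The part `dc / c` of `i α` is closed: applied to `c` itself, the bracket identity removes all
  -- second derivatives of `c` from `dα(e, J e)`. Only the contribution of `dμ ∧ dz` remains.
  have hbr := mvfderiv_mlieBracket hcs hs hsJ hce hcJ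
  have hIα := hz.I_mul_connectionForm hy he (frameBracket J e y)
  have hzbr := hz.mvfderiv_frameBracket hy he
  -- the derivative of a complex expression for `α(w)` computes the derivative of `α(w)`
  have hreal : ∀ (w : ∀ y : M, TangentSpace (𝓡 2) y) (F : M → ℂ),
      MDifferentiableAt (𝓡 2) 𝓘(ℝ, ℂ) F y →
      (∀ᶠ x in 𝓝 y, Complex.I * connectionForm J e x (w x) = F x) →
      ∀ v, Complex.I * mvfderiv (𝓡 2) (fun x => connectionForm J e x (w x)) y v
        = mvfderiv (𝓡 2) F y v := by
    intro w F hF hev v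
    have h1 : (fun x => connectionForm J e x (w x)) =ᶠ[𝓝 y] fun x => Complex.imCLM (F x) := by
      filter_upwards [hev] with x hx
      rw [← hx]; simp
    have h2 : F =ᶠ[𝓝 y] fun x => (ContinuousLinearMap.mul ℝ ℂ Complex.I).comp
        (Complex.ofRealCLM.comp Complex.imCLM) (F x) := by
      filter_upwards [hev] with x hx
      rw [← hx]; simp
    rw [mvfderiv_congr h1, mvfderiv_clm_comp _ hF]
    conv_rhs => rw [mvfderiv_congr h2, mvfderiv_clm_comp _ hF]
    simp
  have hev : ∀ w : ∀ y : M, TangentSpace (𝓡 2) y, ∀ᶠ x in 𝓝 y,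
      Complex.I * connectionForm J e x (w x) =
        mvfderiv (𝓡 2) c x (w x) * (c x)⁻¹ - logDerivFactor J z x * mvfderiv (𝓡 2) z x (w x) := by
    intro w
    filter_upwards [hz.isOpen.mem_nhds hy, he.eventually] with x hx hex
    rw [hz.I_mul_connectionForm hx hex, div_eq_mul_inv]
  have hIc : (fun x => mvfderiv (𝓡 2) z x (J.toFun x (e x))) =ᶠ[𝓝 y] fun x => Complex.I * c x := by
    filter_upwards [hz.isOpen.mem_nhds hy] with x hx using hz.complexLinear x hx _
  have hdIc : ∀ v, mvfderiv (𝓡 2) (fun x => mvfderiv (𝓡 2) z x (J.toFun x (e x))) y v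
      = Complex.I * mvfderiv (𝓡 2) c y v := by
    intro v
    rw [mvfderiv_congr hIc]
    exact mvfderiv_clm_comp (ContinuousLinearMap.mul ℝ ℂ Complex.I) hcd _
  have hzJ := (hz.contMDiffAt_field hy hsJ).mdifferentiableAt (by simp)
  have sub : ∀ (F G : M → ℂ), MDifferentiableAt (𝓡 2) 𝓘(ℝ, ℂ) F y →
      MDifferentiableAt (𝓡 2) 𝓘(ℝ, ℂ) G y → ∀ v, mvfderiv (𝓡 2) (fun x => F x - G x) y v
        = mvfderiv (𝓡 2) F y v - mvfderiv (𝓡 2) G y v := by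
    intro F G hF hG v
    rw [mvfderiv_fun_sub hF hG]; rfl
  have d1 := hreal (fun x => J.toFun x (e x)) _ ((mdifferentiableAt_cmul hcJ hci).sub
    (mdifferentiableAt_cmul hmu hzJ)) (hev _) (e y)
  have d2 := hreal e _ ((mdifferentiableAt_cmul hce hci).sub
    (mdifferentiableAt_cmul hmu hcd)) (hev _) (J.toFun y (e y))
  erw [sub _ _ (mdifferentiableAt_cmul hcJ hci) (mdifferentiableAt_cmul hmu hzJ),
    mvfderiv_cmul hcJ hci, mvfderiv_cmul hmu hzJ, mvfderiv_cinv hcd hc0, hdIc,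
    hz.complexLinear y hy] at d1
  erw [sub _ _ (mdifferentiableAt_cmul hce hci) (mdifferentiableAt_cmul hmu hcd),
    mvfderiv_cmul hce hci, mvfderiv_cmul hmu hcd, mvfderiv_cinv hcd hc0] at d2
  rw [hzbr] at hIα
  rw [frameBracket, hbr] at hIα
  push_cast
  rw [frameBracket]
  linear_combination -d1 + d2 + hIα

end IsHolomorphicCoordinate

namespace IsHolomorphicCoordinate

variable {J : Rotation g} {z : M → ℂ} {U : Set M} (hz : IsHolomorphicCoordinate J z U)
include hz

/-- The first factor is antilinear in `v` and `dz(v)` is linear, so rotating `v` multiplies the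
product by `|p + i q|² = 1`. -/
theorem I_mul_gaussCurvature_of_unit {y : M} (hy : y ∈ U) {v : TangentSpace (𝓡 2) y}
    (hv : g.inner y v v = 1) :
    Complex.I * gaussCurvature J y =
      (Complex.I * mvfderiv (𝓡 2) (logDerivFactor J z) y v
        - mvfderiv (𝓡 2) (logDerivFactor J z) y (J.toFun y v)) * mvfderiv (𝓡 2) z y v := by
  have he := inner_unitField_self (g := g) y
  have h := hz.I_mul_gaussCurvature hy
  have h1 := J.eq_add he v
  rw [hz.mvfderiv_eq hy he v]
  set e := unitField g y y
  set p := g.inner y v e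
  set q := g.inner y v (J.toFun y e)
  have h2 : J.toFun y v = p • J.toFun y e - q • e := by
    conv_lhs => rw [h1]
    rw [map_add, map_smul, map_smul, J.rot_rot, smul_neg, sub_eq_add_neg]
  have hpq : (p : ℂ) ^ 2 + q ^ 2 = 1 := by
    rw [h1] at hv
    simp only [map_add, map_smul, add_apply, smul_apply, he, J.isometry, J.inner_self,
      J.inner_right, smul_eq_mul] at hv
    have : p ^ 2 + q ^ 2 = 1 := by linarith
    exact_mod_cast this
  rw [h2]
  conv_rhs => rw [h1]
  simp only [map_add, map_sub, map_smul, Complex.real_smul]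
  rw [h]
  set a := mvfderiv (𝓡 2) (logDerivFactor J z) y e
  set b := mvfderiv (𝓡 2) (logDerivFactor J z) y (J.toFun y e)
  linear_combination (-(Complex.I * a - b) * mvfderiv (𝓡 2) z y e) * hpq
    - mvfderiv (𝓡 2) z y e * (q ^ 2 * b + p * q * a) * Complex.I_sq

/-- This is `dμ ∧ dz` evaluated on `(w, v)`, the form in which the curvature enters the variation of
an orbit. -/
theorem logDerivFactor_antisymm {y : M} (hy : y ∈ U) {v : TangentSpace (𝓡 2) y}
    (hv : g.inner y v v = 1) (w : TangentSpace (𝓡 2) y) :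
    mvfderiv (𝓡 2) (logDerivFactor J z) y w * mvfderiv (𝓡 2) z y v
      - mvfderiv (𝓡 2) (logDerivFactor J z) y v * mvfderiv (𝓡 2) z y w =
      - Complex.I * gaussCurvature J y * g.inner y w (J.toFun y v) := by
  have h := hz.I_mul_gaussCurvature_of_unit hy hv
  rw [hz.mvfderiv_eq hy hv w]
  have h1 := J.eq_add hv w
  have h2 : mvfderiv (𝓡 2) (logDerivFactor J z) y w =
      g.inner y w v * mvfderiv (𝓡 2) (logDerivFactor J z) y v
      + g.inner y w (J.toFun y v) * mvfderiv (𝓡 2) (logDerivFactor J z) y (J.toFun y v) := by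
    conv_lhs => rw [h1]
    simp
  rw [h2]
  linear_combination (g.inner y w (J.toFun y v) : ℂ) * h

/-- `gaussCurvature` uses a different frame at every point. In a holomorphic coordinate a single
smooth frame computes it at all nearby points, which gives continuity. -/
theorem continuousAt_gaussCurvature {y : M} (hy : y ∈ U) :
    ContinuousAt (gaussCurvature J) y := by
  have he := isUnitFieldAt_unitField (g := g) (mem_chart_source Plane y)
  have hs := he.smooth.self_of_nhds
  have hmu : ∀ᶠ x in 𝓝 y, ContMDiffAt (𝓡 2) 𝓘(ℝ, ℂ) ∞ (logDerivFactor J z) x := by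
    filter_upwards [hz.isOpen.mem_nhds hy] with x hx using hz.contMDiffAt_logDerivFactor hx
  have h1 := (contMDiffAt_mvfderiv_field hmu hs).continuousAt
  have h2 := (contMDiffAt_mvfderiv_field hmu (contMDiffAt_rotation J hs)).continuousAt
  have h3 := (hz.contMDiffAt_field hy hs).continuousAt
  have h4 := Complex.continuous_im.continuousAt.comp (((continuousAt_const (y := Complex.I)).mul h1
    |>.sub h2).mul h3)
  refine h4.congr ?_
  filter_upwards [hz.isOpen.mem_nhds hy, he.unit] with x hx hux
  have := hz.I_mul_gaussCurvature_of_unit hx hux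
  simp only [Function.comp, Pi.sub_apply, Pi.mul_apply]
  rw [← this]
  simp

end IsHolomorphicCoordinate

/-! ### The coframe along curves in the unit tangent bundle -/

theorem contMDiff_proj_tangent :
    ContMDiff (𝓡 2).tangent (𝓡 2) ∞ (fun w : TangentBundle (𝓡 2) M => w.1) :=
  contMDiff_proj (TangentSpace (𝓡 2) : M → Type _)

theorem contMDiff_energy :
    ContMDiff (𝓡 2).tangent 𝓘(ℝ, ℝ) ∞ (fun w : TangentBundle (𝓡 2) M => g.inner w.1 w.2 w.2) :=
  fun w => contMDiffAt_inner (b := fun w : TangentBundle (𝓡 2) M => w.1) (v := fun w => w.2)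
    (w := fun w => w.2) (n := w) contMDiffAt_id contMDiffAt_id

theorem contMDiffAt_inner_field {e : ∀ y : M, TangentSpace (𝓡 2) y} {v : TangentBundle (𝓡 2) M}
    (he : ContMDiffAt (𝓡 2) (𝓡 2).tangent ∞
      (fun y => (⟨y, e y⟩ : TangentBundle (𝓡 2) M)) v.1) :
    ContMDiffAt (𝓡 2).tangent 𝓘(ℝ, ℝ) ∞
      (fun w : TangentBundle (𝓡 2) M => g.inner w.1 w.2 (e w.1)) v :=
  contMDiffAt_inner (b := fun w : TangentBundle (𝓡 2) M => w.1) (v := fun w => w.2)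
    (w := fun w => e w.1) contMDiffAt_id
      (ContMDiffAt.comp v he contMDiff_proj_tangent.contMDiffAt)

theorem energy_eq (J : Rotation g) {e : ∀ y : M, TangentSpace (𝓡 2) y}
    {w : TangentBundle (𝓡 2) M} (he : g.inner w.1 (e w.1) (e w.1) = 1) :
    g.inner w.1 w.2 w.2 = g.inner w.1 w.2 (e w.1) ^ 2
      + g.inner w.1 w.2 (J.toFun w.1 (e w.1)) ^ 2 := by
  have h1 := J.eq_add he w.2
  have : g.inner w.1 w.2 w.2 = g.inner w.1 w.2 (g.inner w.1 w.2 (e w.1) • (e w.1)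
      + g.inner w.1 w.2 (J.toFun w.1 (e w.1)) • J.toFun w.1 (e w.1)) := by
    conv_lhs => rw [h1]
    conv_rhs => rw [h1]
    simp [he, J.isometry, J.inner_self, J.inner_right]
  rw [this, map_add, map_smul, map_smul]
  simp only [smul_eq_mul]
  ring

section Curve

variable {γ : ℝ → TangentBundle (𝓡 2) M} {s : ℝ}
  (hγ : MDifferentiableAt 𝓘(ℝ, ℝ) (𝓡 2).tangent γ s)
include hγ

/-- The energy is constant along the curve, so its differential kills the velocity. -/
theorem mfderiv_mem_tangentUnit (hu : ∀ᶠ r in 𝓝 s, γ r ∈ unitTangent g) :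
    mfderiv 𝓘(ℝ, ℝ) (𝓡 2).tangent γ s (1 : ℝ) ∈ tangentUnit g (γ s) := by
  have h := hasDerivAt_comp_curve
    ((contMDiff_energy (g := g)).contMDiffAt.mdifferentiableAt (by simp)) hγ
  have h2 : HasDerivAt (fun r => g.inner (γ r).1 (γ r).2 (γ r).2) 0 s := by
    refine (hasDerivAt_const s (1 : ℝ)).congr_of_eventuallyEq ?_
    filter_upwards [hu] with r hr using hr
  exact LinearMap.mem_ker.2 (h.unique h2)

theorem hasDerivAt_proj_curve {W : Type*} [NormedAddCommGroup W] [NormedSpace ℝ W] {F : M → W}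
    (hF : MDifferentiableAt (𝓡 2) 𝓘(ℝ, W) F (γ s).1) :
    HasDerivAt (fun r => F (γ r).1) (mvfderiv (𝓡 2) F (γ s).1
      (dproj (γ s) (mfderiv 𝓘(ℝ, ℝ) (𝓡 2).tangent γ s (1 : ℝ)))) s := by
  have hp : MDifferentiableAt (𝓡 2).tangent (𝓡 2) (fun w : TangentBundle (𝓡 2) M => w.1) (γ s) :=
    contMDiff_proj_tangent.contMDiffAt.mdifferentiableAt (by simp)
  have h := hasDerivAt_comp_curve (F := fun r => F r) (γ := fun r => (γ r).1) hF
    (MDifferentiableAt.comp s hp hγ)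
  have h2 : mfderiv 𝓘(ℝ, ℝ) (𝓡 2) (fun r => (γ r).1) s (1 : ℝ)
      = dproj (γ s) (mfderiv 𝓘(ℝ, ℝ) (𝓡 2).tangent γ s (1 : ℝ)) :=
    DFunLike.congr_fun (mfderiv_comp s hp hγ) (1 : ℝ)
  rw [h2] at h
  exact h

omit hγ in
theorem IsHolomorphicCoordinate.omega_eq {J : Rotation g} {z : M → ℂ} {U : Set M}
    (hz : IsHolomorphicCoordinate J z U) {v : TangentBundle (𝓡 2) M} (hv : v ∈ unitTangent g)
    (hU : v.1 ∈ U) (ξ : TangentSpace (𝓡 2).tangent v) :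
    omega₁ g v ξ + Complex.I * omega₂ J v ξ =
      mvfderiv (𝓡 2) z v.1 (dproj v ξ) / mvfderiv (𝓡 2) z v.1 v.2 := by
  rw [hz.mvfderiv_eq hU hv (dproj v ξ), mul_div_cancel_right₀ _ (hz.mvfderiv_ne_zero_of_unit hU hv)]
  rfl

/-- The connection form along a curve in the unit tangent bundle, in a holomorphic coordinate. -/
theorem IsHolomorphicCoordinate.I_mul_psi {J : Rotation g} {z : M → ℂ} {U : Set M}
    (hz : IsHolomorphicCoordinate J z U) (hu : ∀ᶠ r in 𝓝 s, γ r ∈ unitTangent g)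
    (hU : (γ s).1 ∈ U) {W' : ℂ}
    (hW : HasDerivAt (fun r => mvfderiv (𝓡 2) z (γ r).1 (γ r).2) W' s) :
    Complex.I * psi J (γ s) (mfderiv 𝓘(ℝ, ℝ) (𝓡 2).tangent γ s (1 : ℝ)) =
      W' / mvfderiv (𝓡 2) z (γ s).1 (γ s).2 - logDerivFactor J z (γ s).1 *
        mvfderiv (𝓡 2) z (γ s).1 (dproj (γ s) (mfderiv 𝓘(ℝ, ℝ) (𝓡 2).tangent γ s (1 : ℝ))) := by
  have he := isUnitFieldAt_unitField (g := g) (mem_chart_source Plane (γ s).1)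
  rw [psi]
  set e := unitField g (γ s).1 with hee
  have hs := he.smooth.self_of_nhds
  have hsJ := contMDiffAt_rotation J hs
  have hp := hasDerivAt_comp_curve
    ((contMDiffAt_inner_field (g := g) hs).mdifferentiableAt (by simp)) hγ
  have hq := hasDerivAt_comp_curve
    ((contMDiffAt_inner_field (g := g) hsJ).mdifferentiableAt (by simp)) hγ
  have hc := hasDerivAt_proj_curve hγ ((hz.contMDiffAt_field hU hs).mdifferentiableAt (by simp))
  have hα := hz.I_mul_connectionForm hU he
    (dproj (γ s) (mfderiv 𝓘(ℝ, ℝ) (𝓡 2).tangent γ s (1 : ℝ)))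
  set ξ := mfderiv 𝓘(ℝ, ℝ) (𝓡 2).tangent γ s (1 : ℝ)
  set p : TangentBundle (𝓡 2) M → ℝ := fun w => g.inner w.1 w.2 (e w.1) with hpd
  set q : TangentBundle (𝓡 2) M → ℝ := fun w => g.inner w.1 w.2 (J.toFun w.1 (e w.1)) with hqd
  replace hp : HasDerivAt (fun r => p (γ r)) (mvfderiv (𝓡 2).tangent p (γ s) ξ) s := hp
  replace hq : HasDerivAt (fun r => q (γ r)) (mvfderiv (𝓡 2).tangent q (γ s) ξ) s := hq
  have hcont : ContinuousAt (fun r => (γ r).1) s :=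
    (contMDiff_proj_tangent (M := M)).continuous.continuousAt.comp hγ.continuousAt
  have hunit := hcont.eventually he.unit
  have hUev := hcont.eventually (hz.isOpen.mem_nhds hU)
  have h1 : HasDerivAt (fun r => p (γ r) * p (γ r) + q (γ r) * q (γ r)) 0 s := by
    refine (hasDerivAt_const s (1 : ℝ)).congr_of_eventuallyEq ?_
    filter_upwards [hu, hunit] with r hr hr2
    have := energy_eq J hr2
    rw [show g.inner (γ r).1 (γ r).2 (γ r).2 = 1 from hr] at this
    simp only [p, q]
    linarith
  have h1' := ((hp.mul hp).add (hq.mul hq)).unique h1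
  have h2 : HasDerivAt (fun r => ((p (γ r) : ℂ) + Complex.I * q (γ r))
      * mvfderiv (𝓡 2) z (γ r).1 (e (γ r).1)) W' s := by
    refine hW.congr_of_eventuallyEq ?_
    filter_upwards [hunit, hUev] with r hr hr2
    rw [hz.mvfderiv_eq hr2 hr (γ r).2]
  have h2' : (mvfderiv (𝓡 2).tangent p (γ s) ξ + Complex.I * mvfderiv (𝓡 2).tangent q (γ s) ξ)
      * mvfderiv (𝓡 2) z (γ s).1 (e (γ s).1) + (p (γ s) + Complex.I * q (γ s)) *
        mvfderiv (𝓡 2) (fun x => mvfderiv (𝓡 2) z x (e x)) (γ s).1 (dproj (γ s) ξ) = W' :=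
    ((hp.ofReal_comp.add (hq.ofReal_comp.const_mul Complex.I)).mul hc).unique h2
  have h3 : p (γ s) ^ 2 + q (γ s) ^ 2 = 1 := by
    have := energy_eq J hunit.self_of_nhds
    rw [show g.inner (γ s).1 (γ s).2 (γ s).2 = 1 from hu.self_of_nhds] at this
    exact this.symm
  have h4 : mvfderiv (𝓡 2) z (γ s).1 (γ s).2
      = ((p (γ s) : ℂ) + Complex.I * q (γ s)) * mvfderiv (𝓡 2) z (γ s).1 (e (γ s).1) :=
    hz.mvfderiv_eq hU hunit.self_of_nhds (γ s).2
  have hc0 := hz.mvfderiv_ne_zero_of_unit hU hunit.self_of_nhds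
  have hχ0 : (p (γ s) : ℂ) + Complex.I * q (γ s) ≠ 0 := by
    intro h
    rw [h, zero_mul] at h4
    exact hz.mvfderiv_ne_zero_of_unit hU hu.self_of_nhds h4
  rw [h4, ← h2']
  push_cast
  rw [mul_add, hα]
  set c := mvfderiv (𝓡 2) z (γ s).1 (e (γ s).1)
  set p' := mvfderiv (𝓡 2).tangent p (γ s) ξ
  set q' := mvfderiv (𝓡 2).tangent q (γ s) ξ
  generalize p (γ s) = P at *
  generalize q (γ s) = Q at *
  have h1'' : (P : ℂ) * p' + Q * q' = 0 := by
    have : P * p' + Q * q' = 0 := by linarith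
    exact_mod_cast this
  have h3' : (P : ℂ) ^ 2 + Q ^ 2 = 1 := by exact_mod_cast h3
  -- As `P² + Q² = 1`, the inverse of `P + i Q` is its conjugate, and the real part `P p' + Q q'` of
  -- the quotient vanishes by `h1''`.
  have key : Complex.I * (P * q' - Q * p') = (p' + Complex.I * q') / (P + Complex.I * Q) := by
    rw [eq_div_iff hχ0]
    linear_combination (-(P + Complex.I * Q) : ℂ) * h1'' + (p' + Complex.I * q') * h3'
      + (P * Q * q' - Q ^ 2 * p' : ℂ) * Complex.I_sq
  rw [key]
  field_simp
  ring

end Curve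

/-! ### The coframe is an isomorphism on the tangent spaces of the unit tangent bundle -/

/-- A chart of `TM` consists of a chart of the base and the fibre coordinate of a trivialization. If
the differentials of both kill `ξ`, so does that of the chart, which is invertible. -/
theorem eq_zero_of_dproj_eq_zero {v : TangentBundle (𝓡 2) M} {ξ : TangentSpace (𝓡 2).tangent v}
    (h1 : dproj v ξ = 0)
    (h2 : mvfderiv (𝓡 2).tangent (fun w : TangentBundle (𝓡 2) M =>
      (trivializationAt Plane (TangentSpace (𝓡 2) : M → Type _) v.1 w).2) v ξ = 0) : ξ = 0 := by
  set t := trivializationAt Plane (TangentSpace (𝓡 2) : M → Type _) v.1 with ht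
  let Φ : TangentBundle (𝓡 2) M → Plane × Plane := fun w => extChartAt (𝓡 2).tangent v w
  have hinv : (mfderiv (𝓡 2).tangent 𝓘(ℝ, Plane × Plane) Φ v).IsInvertible :=
    isInvertible_mfderiv_extChartAt (mem_extChartAt_source v)
  have hd : MDifferentiableAt (𝓡 2).tangent 𝓘(ℝ, Plane × Plane) Φ v :=
    (contMDiffAt_extChartAt (n := ∞)).mdifferentiableAt (by simp)
  have hsrc : ∀ᶠ w in 𝓝 v, w ∈ t.source :=
    t.open_source.mem_nhds (FiberBundle.mem_trivializationAt_proj_source)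
  have hsp : ∀ w, Φ w = (extChartAt (𝓡 2) v.1 (t w).1, (t w).2) := by
    intro w
    show extChartAt (𝓡 2).tangent v w = _
    rw [FiberBundle.extChartAt]
    rfl
  have hfst : mvfderiv (𝓡 2).tangent (fun w => (Φ w).1) v ξ = 0 := by
    have h3 : (fun w => (Φ w).1) =ᶠ[𝓝 v] (extChartAt (𝓡 2) v.1) ∘
        (fun w : TangentBundle (𝓡 2) M => w.1) := by
      filter_upwards [hsrc] with w hw
      rw [hsp]
      show extChartAt (𝓡 2) v.1 (t w).1 = extChartAt (𝓡 2) v.1 w.1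
      rw [t.coe_fst hw]
    rw [mvfderiv_congr h3]
    have hp : MDifferentiableAt (𝓡 2).tangent (𝓡 2) (fun w : TangentBundle (𝓡 2) M => w.1) v :=
      contMDiff_proj_tangent.contMDiffAt.mdifferentiableAt (by simp)
    have he : MDifferentiableAt (𝓡 2) 𝓘(ℝ, Plane) (extChartAt (𝓡 2) v.1) v.1 :=
      (contMDiffAt_extChartAt (n := ∞)).mdifferentiableAt (by simp)
    have h4 := DFunLike.congr_fun (mfderiv_comp v he hp) ξ
    refine h4.trans ?_
    show mfderiv (𝓡 2) 𝓘(ℝ, Plane) (extChartAt (𝓡 2) v.1) v.1 (dproj v ξ) = 0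
    rw [h1, map_zero]
  have hsnd : mvfderiv (𝓡 2).tangent (fun w => (Φ w).2) v ξ = 0 := by
    have h3 : (fun w => (Φ w).2) = fun w => (t w).2 := by
      funext w
      rw [hsp]
    rw [h3]; exact h2
  have h5 := mvfderiv_clm_comp (ContinuousLinearMap.fst ℝ Plane Plane) hd ξ
  have h6 := mvfderiv_clm_comp (ContinuousLinearMap.snd ℝ Plane Plane) hd ξ
  have h7 : mvfderiv (𝓡 2).tangent Φ v ξ = 0 :=
    Prod.ext (h5.symm.trans hfst) (h6.symm.trans hsnd)
  obtain ⟨a, ha⟩ := hinv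
  have h8 : mfderiv (𝓡 2).tangent 𝓘(ℝ, Plane × Plane) Φ v ξ = 0 := h7
  rw [← ha] at h8
  exact a.map_eq_zero_iff.1 h8

/-- With `dπ(ξ) = 0`, the form `ψ` reduces to `p dq - q dp`, while tangency to `SM` gives `p dp + q
dq = 0`; as `p² + q² = 1`, both `dp` and `dq` kill `ξ`. The fibre coordinate is a combination of two
functions of the base point with coefficients `p` and `q`, so its differential kills `ξ` too. -/
theorem eq_zero_of_coframe_eq_zero (J : Rotation g) {v : TangentBundle (𝓡 2) M}
    (hv : v ∈ unitTangent g) {ξ : TangentSpace (𝓡 2).tangent v} (hξ : ξ ∈ tangentUnit g v)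
    (h1 : omega₁ g v ξ = 0) (h2 : omega₂ J v ξ = 0) (h3 : psi J v ξ = 0) : ξ = 0 := by
  have hd : dproj v ξ = 0 := by
    have h := J.eq_add (show g.inner v.1 v.2 v.2 = 1 from hv) (dproj v ξ)
    rw [omega₁] at h1
    rw [omega₂] at h2
    rwa [h1, h2, zero_smul, zero_smul, add_zero] at h
  refine eq_zero_of_dproj_eq_zero hd ?_
  have he := isUnitFieldAt_unitField (g := g) (mem_chart_source Plane v.1)
  rw [psi, hd] at h3
  set e := unitField g v.1 with hee
  have hs := he.smooth.self_of_nhds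
  have hsJ := contMDiffAt_rotation J hs
  have hp := (contMDiffAt_inner_field (g := g) hs).mdifferentiableAt (by simp)
  have hq := (contMDiffAt_inner_field (g := g) hsJ).mdifferentiableAt (by simp)
  set p : TangentBundle (𝓡 2) M → ℝ := fun w => g.inner w.1 w.2 (e w.1) with hpd
  set q : TangentBundle (𝓡 2) M → ℝ := fun w => g.inner w.1 w.2 (J.toFun w.1 (e w.1)) with hqd
  have hpr : ContinuousAt (fun w : TangentBundle (𝓡 2) M => w.1) v :=
    (contMDiff_proj_tangent (M := M)).continuous.continuousAt
  have hunit := hpr.eventually he.unit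
  have h4 : p v * mvfderiv (𝓡 2).tangent q v ξ - q v * mvfderiv (𝓡 2).tangent p v ξ = 0 := by
    have : connectionForm J e v.1 0 = 0 := by simp [connectionForm]
    linarith
  have h5 : p v * mvfderiv (𝓡 2).tangent p v ξ + q v * mvfderiv (𝓡 2).tangent q v ξ = 0 := by
    have h6 : (fun w : TangentBundle (𝓡 2) M => g.inner w.1 w.2 w.2) =ᶠ[𝓝 v]
        fun w => p w * p w + q w * q w := by
      filter_upwards [hunit] with w hw
      rw [energy_eq J hw]
      simp only [p, q]
      ring
    have h7 : mvfderiv (𝓡 2).tangent (fun w : TangentBundle (𝓡 2) M => g.inner w.1 w.2 w.2) v ξ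
        = 0 := LinearMap.mem_ker.1 hξ
    rw [mvfderiv_congr h6] at h7
    have h8 := DFunLike.congr_fun (((hp.hasMFDerivAt.mul hp.hasMFDerivAt).add
      (hq.hasMFDerivAt.mul hq.hasMFDerivAt)).mfderiv) ξ
    have h9 : mvfderiv (𝓡 2).tangent (fun w => p w * p w + q w * q w) v ξ
      = (p v * mvfderiv (𝓡 2).tangent p v ξ + p v * mvfderiv (𝓡 2).tangent p v ξ)
      + (q v * mvfderiv (𝓡 2).tangent q v ξ + q v * mvfderiv (𝓡 2).tangent q v ξ) := h8
    linarith
  have h6 : p v ^ 2 + q v ^ 2 = 1 := by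
    have := energy_eq J hunit.self_of_nhds
    rw [show g.inner v.1 v.2 v.2 = 1 from hv] at this
    exact this.symm
  have hdp : mvfderiv (𝓡 2).tangent p v ξ = 0 := by
    linear_combination p v * h5 - q v * h4 - mvfderiv (𝓡 2).tangent p v ξ * h6
  have hdq : mvfderiv (𝓡 2).tangent q v ξ = 0 := by
    linear_combination q v * h5 + p v * h4 - mvfderiv (𝓡 2).tangent q v ξ * h6
  set t := trivializationAt Plane (TangentSpace (𝓡 2) : M → Type _) v.1 with ht
  have hE : ∀ f : ∀ y : M, TangentSpace (𝓡 2) y, ContMDiffAt (𝓡 2) (𝓡 2).tangent ∞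
      (fun y => (⟨y, f y⟩ : TangentBundle (𝓡 2) M)) v.1 →
      MDifferentiableAt (𝓡 2).tangent 𝓘(ℝ, Plane)
        (fun w : TangentBundle (𝓡 2) M => (t ⟨w.1, f w.1⟩).2) v ∧
      mvfderiv (𝓡 2).tangent (fun w : TangentBundle (𝓡 2) M => (t ⟨w.1, f w.1⟩).2) v ξ = 0 := by
    intro f hf
    have hf2 := ((contMDiffAt_totalSpace).1 hf).2.mdifferentiableAt (by simp)
    have hpm : MDifferentiableAt (𝓡 2).tangent (𝓡 2) (fun w : TangentBundle (𝓡 2) M => w.1) v :=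
      contMDiff_proj_tangent.contMDiffAt.mdifferentiableAt (by simp)
    refine ⟨hf2.comp v hpm, ?_⟩
    have h4 := DFunLike.congr_fun (mfderiv_comp v hf2 hpm) ξ
    refine h4.trans ?_
    show mfderiv (𝓡 2) 𝓘(ℝ, Plane) (fun y : M => (t ⟨y, f y⟩).2) v.1 (dproj v ξ) = 0
    rw [hd, map_zero]
  obtain ⟨ha, ha'⟩ := hE e hs
  obtain ⟨hb, hb'⟩ := hE (fun y => J.toFun y (e y)) hsJ
  have hev : (fun w : TangentBundle (𝓡 2) M => (t w).2) =ᶠ[𝓝 v]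
      fun w => p w • (t ⟨w.1, e w.1⟩).2 + q w • (t ⟨w.1, J.toFun w.1 (e w.1)⟩).2 := by
    have hb : ∀ᶠ w : TangentBundle (𝓡 2) M in 𝓝 v, w.1 ∈ t.baseSet :=
      hpr.eventually (t.open_baseSet.mem_nhds (mem_baseSet_trivializationAt _ _ _))
    filter_upwards [hunit, hb] with w hw hwb
    have hl := Trivialization.linear ℝ t hwb
    have := J.eq_add hw w.2
    have h10 : (t w).2 = (t ⟨w.1, p w • e w.1 + q w • J.toFun w.1 (e w.1)⟩).2 :=
      congrArg (fun u => (t ⟨w.1, u⟩).2) this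
    rw [h10, hl.map_add, hl.map_smul, hl.map_smul]
  have hpa : MDifferentiableAt (𝓡 2).tangent 𝓘(ℝ, Plane)
      (fun w : TangentBundle (𝓡 2) M => p w • (t ⟨w.1, e w.1⟩).2) v := hp.smul ha
  have hqb : MDifferentiableAt (𝓡 2).tangent 𝓘(ℝ, Plane)
      (fun w : TangentBundle (𝓡 2) M => q w • (t ⟨w.1, J.toFun w.1 (e w.1)⟩).2) v := hq.smul hb
  rw [mvfderiv_congr hev, mvfderiv_fun_add hpa hqb, mvfderiv_fun_smul hp ha,
    mvfderiv_fun_smul hq hb]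
  simp [ha', hb', hdp, hdq]

theorem omega₁_sub (v : TangentBundle (𝓡 2) M) (ξ η : TangentSpace (𝓡 2).tangent v) :
    omega₁ g v (ξ - η) = omega₁ g v ξ - omega₁ g v η := by
  simp [omega₁, dproj]

theorem omega₂_sub (J : Rotation g) (v : TangentBundle (𝓡 2) M)
    (ξ η : TangentSpace (𝓡 2).tangent v) :
    omega₂ J v (ξ - η) = omega₂ J v ξ - omega₂ J v η := by
  simp [omega₂, dproj]

theorem psi_sub (J : Rotation g) (v : TangentBundle (𝓡 2) M)
    (ξ η : TangentSpace (𝓡 2).tangent v) :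
    psi J v (ξ - η) = psi J v ξ - psi J v η := by
  simp only [psi, dproj, connectionForm, map_sub]
  ring

theorem eq_of_coframe_eq (J : Rotation g) {v : TangentBundle (𝓡 2) M}
    (hv : v ∈ unitTangent g) {ξ η : TangentSpace (𝓡 2).tangent v} (hξ : ξ ∈ tangentUnit g v)
    (hη : η ∈ tangentUnit g v) (h1 : omega₁ g v ξ = omega₁ g v η)
    (h2 : omega₂ J v ξ = omega₂ J v η) (h3 : psi J v ξ = psi J v η) : ξ = η := by
  refine sub_eq_zero.1 (eq_zero_of_coframe_eq_zero J hv (sub_mem hξ hη) ?_ ?_ ?_)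
  · rw [omega₁_sub, h1, sub_self]
  · rw [omega₂_sub, h2, sub_self]
  · rw [psi_sub, h3, sub_self]

/-- The parametrisation of the unit tangent bundle given by a unit field and the angle. -/
def unitParam (J : Rotation g) (e : ∀ y : M, TangentSpace (𝓡 2) y) (P : M × ℝ) :
    TangentBundle (𝓡 2) M :=
  ⟨P.1, Real.cos P.2 • e P.1 + Real.sin P.2 • J.toFun P.1 (e P.1)⟩

theorem contMDiffAt_unitParam (J : Rotation g) {e : ∀ y : M, TangentSpace (𝓡 2) y} {P : M × ℝ}
    (he : ContMDiffAt (𝓡 2) (𝓡 2).tangent ∞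
      (fun y => (⟨y, e y⟩ : TangentBundle (𝓡 2) M)) P.1) :
    ContMDiffAt ((𝓡 2).prod 𝓘(ℝ, ℝ)) (𝓡 2).tangent ∞ (unitParam J e) P := by
  have h1 : ContMDiffAt ((𝓡 2).prod 𝓘(ℝ, ℝ)) (𝓡 2).tangent ∞
      (fun P : M × ℝ => (⟨P.1, e P.1⟩ : TangentBundle (𝓡 2) M)) P := he.comp P contMDiffAt_fst
  have hc : ContMDiffAt ((𝓡 2).prod 𝓘(ℝ, ℝ)) 𝓘(ℝ, ℝ) ∞ (fun P : M × ℝ => Real.cos P.2) P :=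
    Real.contDiff_cos.contMDiff.contMDiffAt.comp P contMDiffAt_snd
  have hs : ContMDiffAt ((𝓡 2).prod 𝓘(ℝ, ℝ)) 𝓘(ℝ, ℝ) ∞ (fun P : M × ℝ => Real.sin P.2) P :=
    Real.contDiff_sin.contMDiff.contMDiffAt.comp P contMDiffAt_snd
  exact contMDiffAt_smul_add_smul (b := fun P : M × ℝ => P.1) hc hs h1 (contMDiffAt_rotation J h1)

/-- Every value of the coframe is taken by the velocity of a curve in the unit tangent bundle. -/
theorem exists_curve (J : Rotation g) {v : TangentBundle (𝓡 2) M} (hv : v ∈ unitTangent g)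
    (h₁ h₂ k : ℝ) :
    ∃ (γ : ℝ → TangentBundle (𝓡 2) M) (O : Set ℝ), IsOpen O ∧ (0 : ℝ) ∈ O ∧
      ContMDiffOn 𝓘(ℝ, ℝ) (𝓡 2).tangent ∞ γ O ∧ MapsTo γ O (unitTangent g) ∧ γ 0 = v ∧
      omega₁ g (γ 0) (mfderiv 𝓘(ℝ, ℝ) (𝓡 2).tangent γ 0 (1 : ℝ)) = h₁ ∧
      omega₂ J (γ 0) (mfderiv 𝓘(ℝ, ℝ) (𝓡 2).tangent γ 0 (1 : ℝ)) = h₂ ∧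
      psi J (γ 0) (mfderiv 𝓘(ℝ, ℝ) (𝓡 2).tangent γ 0 (1 : ℝ)) = k := by
  obtain ⟨x, v⟩ := v
  replace hv : g.inner x v v = 1 := hv
  set e := unitField g x with hee
  have hex : g.inner x (e x) (e x) = 1 := inner_unitField_self x
  obtain ⟨θ, hθ⟩ := exists_eq_cos_sin J hex hv
  let w : TangentSpace (𝓡 2) x := h₁ • v + h₂ • J.toFun x v
  let f : M → Plane := fun y => extChartAt (𝓡 2) x y
  have hf : MDifferentiableAt (𝓡 2) 𝓘(ℝ, Plane) f x :=
    (contMDiffAt_extChartAt (n := ∞)).mdifferentiableAt (by simp)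
  have hinv : (mfderiv (𝓡 2) 𝓘(ℝ, Plane) f x).IsInvertible :=
    isInvertible_mfderiv_extChartAt (mem_extChartAt_source x)
  let η : Plane := mvfderiv (𝓡 2) f x w
  -- The curve moves with velocity `w` in the base while its angle to `e` turns with speed `κ`.
  -- Since `ψ` is the angular speed plus `α(w)`, this `κ` makes it equal to `k`.
  let κ : ℝ := k - connectionForm J e x w
  -- The quantification over `u` is needed because `γ 0` equals `⟨x, v⟩` only propositionally, so
  -- that its tangent space is not literally that of `x`.
  have key : ∀ u : TangentBundle (𝓡 2) M, u = ⟨x, v⟩ → ∀ ζ : TangentSpace (𝓡 2) u.1,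
      mvfderiv (𝓡 2) f u.1 ζ = η → g.inner u.1 ζ u.2 = h₁ ∧
        g.inner u.1 ζ (J.toFun u.1 u.2) = h₂ ∧ connectionForm J e u.1 ζ = k - κ := by
    rintro _ rfl ζ hζ
    obtain ⟨a, ha⟩ := hinv
    have h1 : mfderiv (𝓡 2) 𝓘(ℝ, Plane) f x ζ = mfderiv (𝓡 2) 𝓘(ℝ, Plane) f x w := hζ
    rw [← ha] at h1
    have h2 : ζ = w := a.injective h1
    subst h2
    refine ⟨?_, ?_, ?_⟩
    · simp [w, hv, J.inner_self]
    · simp [w, hv, J.inner_right, J.isometry]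
    · simp [κ]
  let l : ℝ → Plane := fun s => f x + s • η
  have hl : ContDiff ℝ ∞ l := by fun_prop
  let O : Set ℝ := l ⁻¹' (extChartAt (𝓡 2) x).target
  let β : ℝ → M := fun s => (extChartAt (𝓡 2) x).symm (l s)
  let γ : ℝ → TangentBundle (𝓡 2) M := fun s => unitParam J e (β s, θ + κ * s)
  have hO : IsOpen O := (isOpen_extChartAt_target x).preimage hl.continuous
  have h0 : (0 : ℝ) ∈ O := by
    show f x + (0 : ℝ) • η ∈ (extChartAt (𝓡 2) x).target
    rw [zero_smul, add_zero]
    exact mem_extChartAt_target x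
  have hβ0 : β 0 = x := by
    show (extChartAt (𝓡 2) x).symm (f x + (0 : ℝ) • η) = x
    rw [zero_smul, add_zero]
    exact extChartAt_to_inv x
  have hβ : ContMDiffOn 𝓘(ℝ, ℝ) (𝓡 2) ∞ β O :=
    (contMDiffOn_extChartAt_symm x).comp hl.contMDiff.contMDiffOn (fun s hs => hs)
  have hβs : ∀ s ∈ O, β s ∈ (chartAt Plane x).source := fun s hs => by
    rw [← extChartAt_source (𝓡 2)]
    exact (extChartAt (𝓡 2) x).map_target hs
  have hun : ∀ s ∈ O, g.inner (β s) (e (β s)) (e (β s)) = 1 := fun s hs =>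
    inner_unitField (hβs s hs)
  have hγO : ContMDiffOn 𝓘(ℝ, ℝ) (𝓡 2).tangent ∞ γ O := by
    intro s hs
    have h1 : ContMDiffAt 𝓘(ℝ, ℝ) 𝓘(ℝ, ℝ) ∞ (fun s : ℝ => θ + κ * s) s := by
      have : ContDiff ℝ ∞ (fun s : ℝ => θ + κ * s) := by fun_prop
      exact this.contMDiff.contMDiffAt
    have h2 := (hβ.contMDiffAt (hO.mem_nhds hs)).prodMk h1
    exact (ContMDiffAt.comp s (contMDiffAt_unitParam J
      (contMDiffAt_unitField (hβs s hs))) h2).contMDiffWithinAt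
  have hγu : MapsTo γ O (unitTangent g) := fun s hs => inner_cos_sin J (hun s hs) _
  have hγ0 : γ 0 = ⟨x, v⟩ := by
    show unitParam J e (β 0, θ + κ * 0) = _
    rw [hβ0, mul_zero, add_zero, hθ]
    rfl
  have hd : MDifferentiableAt 𝓘(ℝ, ℝ) (𝓡 2).tangent γ 0 :=
    (hγO.contMDiffAt (hO.mem_nhds h0)).mdifferentiableAt (by simp)
  have hζ : mvfderiv (𝓡 2) f (γ 0).1
      (dproj (γ 0) (mfderiv 𝓘(ℝ, ℝ) (𝓡 2).tangent γ 0 (1 : ℝ))) = η := by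
    have hf' : MDifferentiableAt (𝓡 2) 𝓘(ℝ, Plane) f (γ 0).1 := by rw [hγ0]; exact hf
    have h1 := hasDerivAt_proj_curve hd hf'
    have h2 : HasDerivAt l η 0 := by
      have h3 := ((hasDerivAt_id (0 : ℝ)).smul_const η).const_add (f x)
      rwa [one_smul] at h3
    refine h1.unique (h2.congr_of_eventuallyEq ?_)
    filter_upwards [hO.mem_nhds h0] with s hs
    exact (extChartAt (𝓡 2) x).right_inv hs
  obtain ⟨k1, k2, k3⟩ := key (γ 0) hγ0 _ hζ
  refine ⟨γ, O, hO, h0, hγO, hγu, hγ0, k1, k2, ?_⟩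
  have hux : unitField g (γ 0).1 = e := by rw [hγ0]
  have hsm : ContMDiffAt (𝓡 2) (𝓡 2).tangent ∞
      (fun y => (⟨y, e y⟩ : TangentBundle (𝓡 2) M)) (γ 0).1 := by
    rw [hγ0]; exact contMDiffAt_unitField (mem_chart_source Plane x)
  have hp := hasDerivAt_comp_curve
    ((contMDiffAt_inner_field (g := g) hsm).mdifferentiableAt (by simp)) hd
  have hq := hasDerivAt_comp_curve ((contMDiffAt_inner_field (g := g)
    (contMDiffAt_rotation J hsm)).mdifferentiableAt (by simp)) hd
  have hang : HasDerivAt (fun s : ℝ => θ + κ * s) κ 0 := by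
    simpa using ((hasDerivAt_id (0 : ℝ)).const_mul κ).const_add θ
  have hpe : ∀ s ∈ O, g.inner (γ s).1 (γ s).2 (e (γ s).1) = Real.cos (θ + κ * s) := by
    intro s hs
    show g.inner (β s) (Real.cos (θ + κ * s) • e (β s) + Real.sin (θ + κ * s) •
      J.toFun (β s) (e (β s))) (e (β s)) = _
    simp only [map_add, map_smul, add_apply, smul_apply, hun s hs, J.inner_self, smul_eq_mul,
      mul_one, mul_zero, add_zero]
  have hqe : ∀ s ∈ O, g.inner (γ s).1 (γ s).2 (J.toFun _ (e (γ s).1)) = Real.sin (θ + κ * s) := by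
    intro s hs
    show g.inner (β s) (Real.cos (θ + κ * s) • e (β s) + Real.sin (θ + κ * s) •
      J.toFun (β s) (e (β s))) (J.toFun (β s) (e (β s))) = _
    simp only [map_add, map_smul, add_apply, smul_apply, hun s hs, J.inner_right, J.isometry,
      smul_eq_mul, mul_one, mul_zero, zero_add]
  have hp' := hp.unique (hang.cos.congr_of_eventuallyEq
    (by filter_upwards [hO.mem_nhds h0] with s hs using hpe s hs))
  have hq' := hq.unique (hang.sin.congr_of_eventuallyEq
    (by filter_upwards [hO.mem_nhds h0] with s hs using hqe s hs))
  simp only [psi, hux]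
  rw [hp', hq', k3, hpe 0 h0, hqe 0 h0]
  linear_combination κ * Real.cos_sq_add_sin_sq (θ + κ * 0)

/-- Finitely many compact sets, each inside a chart, cover `M`. Over each of them `SM` is covered by
the continuous image of that set times `[0, 2π]`, and `SM` is closed as a level set of the energy.
-/
theorem isCompact_unitTangent [CompactSpace M] [T2Space M] (J : Rotation g) :
    IsCompact (unitTangent g) := by
  have : LocallyCompactSpace M := ChartedSpace.locallyCompactSpace Plane M
  choose K hKn hKs hKc using fun x : M => local_compact_nhds
    ((chartAt Plane x).open_source.mem_nhds (mem_chart_source Plane x))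
  obtain ⟨T, -, hT⟩ := isCompact_univ.elim_nhds_subcover K fun x _ => hKn x
  let I : M → Set (TangentBundle (𝓡 2) M) := fun x =>
    unitParam J (unitField g x) '' (K x ×ˢ Icc 0 (2 * Real.pi))
  have hI : ∀ x, IsCompact (I x) := by
    intro x
    refine ((hKc x).prod isCompact_Icc).image_of_continuousOn fun P hP => ?_
    exact (contMDiffAt_unitParam J (contMDiffAt_unitField (hKs x hP.1))).continuousAt
      |>.continuousWithinAt
  refine (T.isCompact_biUnion fun x _ => hI x).of_isClosed_subset ?_ ?_
  · exact isClosed_eq (contMDiff_energy (g := g)).continuous continuous_const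
  · rintro ⟨y, v⟩ hv
    obtain ⟨x, hx, hy⟩ := mem_iUnion₂.1 (hT (mem_univ y))
    refine mem_iUnion₂.2 ⟨x, hx, ?_⟩
    obtain ⟨θ, hθ⟩ := exists_eq_cos_sin J (inner_unitField (g := g) (hKs x hy))
      (show g.inner y v v = 1 from hv)
    have hper : Function.Periodic (fun θ => (Real.cos θ, Real.sin θ)) (2 * Real.pi) :=
      fun θ => by simp
    obtain ⟨θ', hθ', he⟩ := hper.exists_mem_Ico₀ Real.two_pi_pos θ
    obtain ⟨hc, hs⟩ := Prod.ext_iff.1 he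
    simp only at hc hs
    refine ⟨(y, θ'), ⟨hy, Ico_subset_Icc_self hθ'⟩, ?_⟩
    rw [hθ, hc, hs]
    rfl

theorem Differential.IsHolomorphic.continuous_gaussCurvature {J : Rotation g} {m : ℕ}
    {A : Differential J m} (hA : A.IsHolomorphic) : Continuous (gaussCurvature J) := by
  rw [continuous_iff_continuousAt]
  intro x
  obtain ⟨U, z, f, hx, hz, -⟩ := hA x
  exact hz.continuousAt_gaussCurvature hx

/-- The function `A(v, …, v)` on the tangent bundle. -/
def Differential.value {J : Rotation g} {m : ℕ} (A : Differential J m)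
    (v : TangentBundle (𝓡 2) M) : ℂ :=
  A.toFun v.1 (fun _ => v.2)

theorem IsHolomorphicCoordinate.contMDiffAt_mvfderiv {J : Rotation g} {z : M → ℂ} {U : Set M}
    (hz : IsHolomorphicCoordinate J z U) {v : TangentBundle (𝓡 2) M} (hv : v.1 ∈ U) :
    ContMDiffAt (𝓡 2).tangent 𝓘(ℝ, ℂ) ∞
      (fun v : TangentBundle (𝓡 2) M => mvfderiv (𝓡 2) z v.1 v.2) v :=
  (contMDiffOn_mvfderiv hz.isOpen hz.smooth).contMDiffAt
    ((hz.isOpen.preimage (FiberBundle.continuous_proj Plane (TangentSpace (𝓡 2)))).mem_nhds hv)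

/-! ### Structure equations along curves in a holomorphic coordinate. -/

section Curve

variable {γ : ℝ → TangentBundle (𝓡 2) M} {s : ℝ}
  (hγ : MDifferentiableAt 𝓘(ℝ, ℝ) (𝓡 2).tangent γ s)
  (hu : ∀ᶠ r in 𝓝 s, γ r ∈ unitTangent g)
  {J : Rotation g} {z : M → ℂ} {U : Set M} (hz : IsHolomorphicCoordinate J z U)
  (hU : (γ s).1 ∈ U)
include hγ hu hz hU

theorem IsHolomorphicCoordinate.hasDerivAt_curve :
    HasDerivAt (fun r => z (γ r).1) (mvfderiv (𝓡 2) z (γ s).1 (γ s).2 *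
      (omega₁ g (γ s) (mfderiv 𝓘(ℝ, ℝ) (𝓡 2).tangent γ s (1 : ℝ)) +
        Complex.I * omega₂ J (γ s) (mfderiv 𝓘(ℝ, ℝ) (𝓡 2).tangent γ s (1 : ℝ)))) s := by
  have hu0 := hu.self_of_nhds
  have h1 := hasDerivAt_proj_curve hγ ((hz.contMDiffAt hU).mdifferentiableAt (by simp))
  rw [hz.omega_eq hu0 hU, mul_div_cancel₀ _ (hz.mvfderiv_ne_zero_of_unit hU hu0)]
  exact h1

theorem IsHolomorphicCoordinate.hasDerivAt_mvfderiv_curve :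
    HasDerivAt (fun r => mvfderiv (𝓡 2) z (γ r).1 (γ r).2) (mvfderiv (𝓡 2) z (γ s).1 (γ s).2 *
      (Complex.I * psi J (γ s) (mfderiv 𝓘(ℝ, ℝ) (𝓡 2).tangent γ s (1 : ℝ)) +
        logDerivFactor J z (γ s).1 * (mvfderiv (𝓡 2) z (γ s).1 (γ s).2 *
      (omega₁ g (γ s) (mfderiv 𝓘(ℝ, ℝ) (𝓡 2).tangent γ s (1 : ℝ)) +
        Complex.I * omega₂ J (γ s) (mfderiv 𝓘(ℝ, ℝ) (𝓡 2).tangent γ s (1 : ℝ)))))) s := by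
  have hu0 := hu.self_of_nhds
  have hW0 := hz.mvfderiv_ne_zero_of_unit hU hu0
  have h1 := hasDerivAt_comp_curve ((hz.contMDiffAt_mvfderiv hU).mdifferentiableAt (by simp)) hγ
  have h2 := hz.I_mul_psi hγ hu hU h1
  rw [hz.omega_eq hu0 hU, mul_div_cancel₀ _ hW0]
  refine h1.congr_deriv ?_
  rw [h2]
  field_simp
  ring

/-- Writing the value as `f(z) W^m` and inserting the equations for `dz` and `dW` yields `D (ω₁ + i
ω₂) + i m A ψ`. Because `f` is holomorphic there is no term in `ω₁ - i ω₂`. -/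
theorem Differential.hasDerivAt_value_curve {m : ℕ} {A : Differential J m} {f : ℂ → ℂ}
    (hf : DifferentiableOn ℂ f (z '' U))
    (hAf : ∀ y ∈ U, ∀ v : Fin m → TangentSpace (𝓡 2) y,
      A.toFun y v = f (z y) * ∏ k, mvfderiv (𝓡 2) z y (v k)) :
    HasDerivAt (fun r => A.value (γ r))
      ((derivWithin f (z '' U) (z (γ s).1) + m * logDerivFactor J z (γ s).1 * f (z (γ s).1)) *
        mvfderiv (𝓡 2) z (γ s).1 (γ s).2 ^ (m + 1) *
      (omega₁ g (γ s) (mfderiv 𝓘(ℝ, ℝ) (𝓡 2).tangent γ s (1 : ℝ)) +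
        Complex.I * omega₂ J (γ s) (mfderiv 𝓘(ℝ, ℝ) (𝓡 2).tangent γ s (1 : ℝ))) +
      Complex.I * m * A.value (γ s) *
        psi J (γ s) (mfderiv 𝓘(ℝ, ℝ) (𝓡 2).tangent γ s (1 : ℝ))) s := by
  have hval : ∀ v : TangentBundle (𝓡 2) M, v.1 ∈ U →
      A.value v = f (z v.1) * mvfderiv (𝓡 2) z v.1 v.2 ^ m := by
    intro v hv
    simp [Differential.value, hAf v.1 hv]
  have hcont : ContinuousAt (fun r => (γ r).1) s :=
    (contMDiff_proj_tangent (M := M)).continuous.continuousAt.comp hγ.continuousAt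
  have hUev : ∀ᶠ r in 𝓝 s, (γ r).1 ∈ U := hcont.eventually (hz.isOpen.mem_nhds hU)
  have h1 := hz.hasDerivAt_curve hγ hu hU
  have h2 := hz.hasDerivAt_mvfderiv_curve hγ hu hU
  -- The derivative of `f` is taken within `z '' U`, so openness of the image is not needed; the
  -- curve stays over `U` near `s`, which gives a full derivative after composition.
  have hfz := (hf _ (mem_image_of_mem z hU)).hasDerivWithinAt
  have h3 := (hfz.scomp s h1.hasDerivWithinAt
    (fun r (hr : r ∈ {r | (γ r).1 ∈ U}) => mem_image_of_mem z hr)).hasDerivAt hUev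
  have h4 := h3.mul (h2.pow m)
  refine (h4.congr_of_eventuallyEq ?_).congr_deriv ?_
  · filter_upwards [hUev] with r hr
    rw [hval _ hr]
    rfl
  · rw [hval _ hU]
    simp only [smul_eq_mul, Function.comp, Pi.pow_apply]
    -- The power rule has the truncated exponent `m - 1`, hence the separate case `m = 0`.
    rcases m with _ | m
    · simp; ring
    · simp only [Nat.add_sub_cancel]
      push_cast
      ring

end Curve

end Surface

/-! ### Variations of curves in the plane -/

/-- Equality of mixed partial derivatives in a form suited to variation fields: `∂_s G` is given
only along the line `s = P.2`, and its differentiability in `t` is part of the conclusion. -/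
theorem hasDerivAt_partial_comm {W : Type*} [NormedAddCommGroup W] [NormedSpace ℝ W]
    {G Gt : ℝ × ℝ → W} {Gs : ℝ → W} {P : ℝ × ℝ} {D : W}
    (hG : ContDiffAt ℝ 2 G P)
    (hGt : ∀ᶠ Q in 𝓝 P, HasDerivAt (fun t => G (t, Q.2)) (Gt Q) Q.1)
    (hGs : ∀ᶠ t in 𝓝 P.1, HasDerivAt (fun s => G (t, s)) (Gs t) P.2)
    (hD : HasDerivAt (fun s => Gt (P.1, s)) D P.2) : HasDerivAt Gs D P.1 := by
  have hdiff : ∀ᶠ Q in 𝓝 P, DifferentiableAt ℝ G Q := by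
    filter_upwards [hG.eventually (by simp)] with Q hQ using hQ.differentiableAt (by simp)
  have hG1 : DifferentiableAt ℝ (fderiv ℝ G) P :=
    (hG.fderiv_right (m := 1) (by norm_num)).differentiableAt (by simp)
  have hsymm := hG.isSymmSndFDerivAt (by simp)
  have hct : Continuous fun t : ℝ => (t, P.2) := by fun_prop
  have hcs : Continuous fun s : ℝ => (P.1, s) := by fun_prop
  have hlt : ∀ Q : ℝ × ℝ, HasDerivAt (fun t : ℝ => (t, Q.2)) ((1 : ℝ), (0 : ℝ)) Q.1 :=
    fun Q => (hasDerivAt_id Q.1).prodMk (hasDerivAt_const Q.1 Q.2)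
  have hls : ∀ Q : ℝ × ℝ, HasDerivAt (fun s : ℝ => (Q.1, s)) ((0 : ℝ), (1 : ℝ)) Q.2 :=
    fun Q => (hasDerivAt_const Q.2 Q.1).prodMk (hasDerivAt_id Q.2)
  have e1 : ∀ᶠ t in 𝓝 P.1, Gs t = fderiv ℝ G (t, P.2) (0, 1) := by
    filter_upwards [hGs, (hct.continuousAt (x := P.1)).eventually hdiff] with t h1 h2
    exact h1.unique (h2.hasFDerivAt.comp_hasDerivAt P.2 (hls (t, P.2)))
  have e2 : ∀ᶠ s in 𝓝 P.2, Gt (P.1, s) = fderiv ℝ G (P.1, s) (1, 0) := by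
    filter_upwards [(hcs.continuousAt (x := P.2)).eventually hGt,
      (hcs.continuousAt (x := P.2)).eventually hdiff] with s h1 h2
    exact h1.unique (h2.hasFDerivAt.comp_hasDerivAt P.1 (hlt (P.1, s)))
  have h1 : HasDerivAt (fun t => fderiv ℝ G (t, P.2) (0, 1))
      (fderiv ℝ (fderiv ℝ G) P (1, 0) (0, 1)) P.1 := by
    have := (hG1.hasFDerivAt.comp_hasDerivAt P.1 (hlt P))
    exact this.clm_apply (hasDerivAt_const P.1 ((0 : ℝ), (1 : ℝ))) |>.congr_deriv (by simp)
  have h2 : HasDerivAt (fun s => fderiv ℝ G (P.1, s) (1, 0))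
      (fderiv ℝ (fderiv ℝ G) P (0, 1) (1, 0)) P.2 := by
    have := (hG1.hasFDerivAt.comp_hasDerivAt P.2 (hls P))
    exact this.clm_apply (hasDerivAt_const P.2 ((1 : ℝ), (0 : ℝ))) |>.congr_deriv (by simp)
  have h3 : D = fderiv ℝ (fderiv ℝ G) P (0, 1) (1, 0) :=
    hD.unique (h2.congr_of_eventuallyEq e2)
  rw [h3, hsymm]
  exact h1.congr_of_eventuallyEq e1

theorem hasDerivAt_re {f : ℝ → ℂ} {f' : ℂ} {t : ℝ} (h : HasDerivAt f f' t) :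
    HasDerivAt (fun t => (f t).re) f'.re t :=
  Complex.reCLM.hasFDerivAt.comp_hasDerivAt t h

theorem hasDerivAt_im {f : ℝ → ℂ} {f' : ℂ} {t : ℝ} (h : HasDerivAt f f' t) :
    HasDerivAt (fun t => (f t).im) f'.im t :=
  Complex.imCLM.hasFDerivAt.comp_hasDerivAt t h

/-- The variation of the solutions of `Z' = W`, `W' = W (i λ + μ W)`. -/
theorem hasDerivAt_variation {Z W μ : ℝ × ℝ → ℂ} {lam : ℝ × ℝ → ℝ} {P : ℝ × ℝ} {x y ψ : ℝ → ℝ}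
    {μt μs : ℂ} {lams K : ℝ} (hZ : ContDiffAt ℝ 2 Z P) (hW : ContDiffAt ℝ 2 W P) (hW0 : W P ≠ 0)
    (hZt : ∀ᶠ Q in 𝓝 P, HasDerivAt (fun t => Z (t, Q.2)) (W Q) Q.1)
    (hWt : ∀ᶠ Q in 𝓝 P, HasDerivAt (fun t => W (t, Q.2))
      (W Q * (Complex.I * lam Q + μ Q * W Q)) Q.1)
    (hZs : ∀ᶠ t in 𝓝 P.1, HasDerivAt (fun s => Z (t, s))
      (W (t, P.2) * (x t + Complex.I * y t)) P.2)
    (hWs : ∀ᶠ t in 𝓝 P.1, HasDerivAt (fun s => W (t, s)) (W (t, P.2) *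
      (Complex.I * ψ t + μ (t, P.2) * (W (t, P.2) * (x t + Complex.I * y t)))) P.2)
    (hμt : HasDerivAt (fun t => μ (t, P.2)) μt P.1) (hμs : HasDerivAt (fun s => μ (P.1, s)) μs P.2)
    (hlams : HasDerivAt (fun s => lam (P.1, s)) lams P.2)
    (hK : μs * W P - μt * (W P * (x P.1 + Complex.I * y P.1)) = - Complex.I * K * y P.1) :
    HasDerivAt x (lam P * y P.1) P.1 ∧ HasDerivAt y (ψ P.1 - lam P * x P.1) P.1 ∧
      HasDerivAt ψ (lams - K * y P.1) P.1 := by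
  have h1 := hasDerivAt_partial_comm hZ hZt hZs hWs.self_of_nhds
  have hWt0 := hWt.self_of_nhds
  have h2 := hasDerivAt_partial_comm hW hWt hWs (hWs.self_of_nhds.mul
    ((hlams.ofReal_comp.const_mul Complex.I).add (hμs.mul hWs.self_of_nhds)))
  have hne : ∀ᶠ t in 𝓝 P.1, W (t, P.2) ≠ 0 :=
    hWt0.continuousAt.eventually_ne hW0
  -- The coordinates are recovered from `Z_s / W = x + i y` and `W_s / W - μ Z_s = i ψ`.
  -- Differentiating these in `t` and taking real and imaginary parts gives the three equations.
  have h3 := h1.div hWt0 hW0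
  have h4 := (h2.div hWt0 hW0).sub (hμt.mul h1)
  simp only [Prod.mk.eta] at h3 h4
  set X := x P.1 + Complex.I * y P.1 with hX
  have h3' : HasDerivAt (fun t => (x t : ℂ) + Complex.I * y t)
      (Complex.I * ψ P.1 - Complex.I * lam P * X) P.1 := by
    refine (h3.congr_of_eventuallyEq ?_).congr_deriv ?_
    · filter_upwards [hne] with t ht
      simp only [Pi.div_apply]
      rw [mul_div_cancel_left₀ _ ht]
    · field_simp
      ring
  have h4' : HasDerivAt (fun t => Complex.I * (ψ t : ℂ))
      (Complex.I * (lams - K * y P.1)) P.1 := by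
    refine (h4.congr_of_eventuallyEq ?_).congr_deriv ?_
    · filter_upwards [hne] with t ht
      simp only [Pi.div_apply, Pi.sub_apply, Pi.mul_apply]
      rw [mul_div_cancel_left₀ _ ht]
      ring
    -- The only terms in derivatives of `μ` are `μ_s W - μ_t Z_s`, which is the curvature term of
    -- `hK`.
    · have : Complex.I * (lams - K * y P.1) = Complex.I * lams + (μs * W P - μt * (W P * X)) := by
        rw [hK]; ring
      rw [this]
      field_simp
      ring
  have hx := hasDerivAt_re h3'
  have hy := hasDerivAt_im h3'
  have hψ := hasDerivAt_im h4'
  simp [hX] at hx hy hψ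
  refine ⟨hx, hy.congr_deriv (by ring), hψ⟩

/-! ### The Jacobi equation of the thermostat flow. -/

section Surface

variable {M : Type*} [TopologicalSpace M] [ChartedSpace Plane M] [IsManifold (𝓡 2) ∞ M]
variable {g : Metric M}

/-- The two velocities lie in tangent spaces whose base points are only propositionally equal, so
they are compared in the total space. -/
theorem coframe_velocity_congr (J : Rotation g) {γ₁ γ₂ : ℝ → TangentBundle (𝓡 2) M} {s : ℝ}
    (h : γ₁ =ᶠ[𝓝 s] γ₂) :
    coframe J (γ₁ s) (mfderiv 𝓘(ℝ, ℝ) (𝓡 2).tangent γ₁ s (1 : ℝ)) =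
      coframe J (γ₂ s) (mfderiv 𝓘(ℝ, ℝ) (𝓡 2).tangent γ₂ s (1 : ℝ)) := by
  have h0 : γ₁ s = γ₂ s := h.self_of_nhds
  have h1 : (⟨γ₁ s, mfderiv 𝓘(ℝ, ℝ) (𝓡 2).tangent γ₁ s (1 : ℝ)⟩ :
      TangentBundle (𝓡 2).tangent (TangentBundle (𝓡 2) M)) =
      ⟨γ₂ s, mfderiv 𝓘(ℝ, ℝ) (𝓡 2).tangent γ₂ s (1 : ℝ)⟩ := by
    rw [h.mfderiv_eq]
    congr 1
  exact congrArg (fun w : TangentBundle (𝓡 2).tangent (TangentBundle (𝓡 2) M) =>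
    coframe J w.1 w.2) h1

theorem coframe_eq_iff (J : Rotation g) {v : TangentBundle (𝓡 2) M}
    {ξ : TangentSpace (𝓡 2).tangent v} {x y k : ℝ} :
    coframe J v ξ = !₂[x, y, k] ↔ omega₁ g v ξ = x ∧ omega₂ J v ξ = y ∧ psi J v ξ = k := by
  constructor
  · intro h
    exact ⟨congrArg (fun u => u 0) h, congrArg (fun u => u 1) h, congrArg (fun u => u 2) h⟩
  · rintro ⟨rfl, rfl, rfl⟩
    rfl

namespace IsThermostatFlow

variable {J : Rotation g} {lam : TangentBundle (𝓡 2) M → ℝ}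
  {φ : ℝ → TangentBundle (𝓡 2) M → TangentBundle (𝓡 2) M} (hφ : IsThermostatFlow J lam φ)
include hφ

theorem contMDiffOn_curve {γ : ℝ → TangentBundle (𝓡 2) M} {O : Set ℝ}
    (hγ : ContMDiffOn 𝓘(ℝ, ℝ) (𝓡 2).tangent ∞ γ O) (hγu : MapsTo γ O (unitTangent g)) :
    ContMDiffOn 𝓘(ℝ, ℝ × ℝ) (𝓡 2).tangent ∞ (fun P : ℝ × ℝ => φ P.1 (γ P.2)) (univ ×ˢ O) := by
  have h1 : ContMDiffOn 𝓘(ℝ, ℝ × ℝ) (𝓘(ℝ, ℝ).prod (𝓡 2).tangent) ∞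
      (fun P : ℝ × ℝ => (P.1, γ P.2)) (univ ×ˢ O) := by
    refine ContMDiffOn.prodMk ?_ ?_
    · exact (contDiff_fst (𝕜 := ℝ)).contMDiff.contMDiffOn
    · exact hγ.comp (contDiff_snd (𝕜 := ℝ)).contMDiff.contMDiffOn fun P hP => hP.2
  exact hφ.smooth.comp h1 fun P hP => ⟨mem_univ _, hγu hP.2⟩

/-- The chain rule along curves in `SM` fixes the value of the derivative within the hypersurface on
velocities, and turns statements about `dφ_t` into statements about the variation `φ_t(γ(s))`. -/
theorem dflow_velocity {γ : ℝ → TangentBundle (𝓡 2) M} {O : Set ℝ} (hO : IsOpen O)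
    (hγ : ContMDiffOn 𝓘(ℝ, ℝ) (𝓡 2).tangent ∞ γ O) (hγu : MapsTo γ O (unitTangent g)) {s : ℝ}
    (hs : s ∈ O) (t : ℝ) :
    dflow g φ t (γ s) (mfderiv 𝓘(ℝ, ℝ) (𝓡 2).tangent γ s (1 : ℝ)) =
      mfderiv 𝓘(ℝ, ℝ) (𝓡 2).tangent (fun s => φ t (γ s)) s (1 : ℝ) := by
  have h1 : ContMDiffOn (𝓡 2).tangent (𝓡 2).tangent ∞ (φ t) (unitTangent g) := by
    have h2 : ContMDiff (𝓡 2).tangent (𝓘(ℝ, ℝ).prod (𝓡 2).tangent) ∞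
        (fun w : TangentBundle (𝓡 2) M => (t, w)) := contMDiff_const.prodMk contMDiff_id
    exact hφ.smooth.comp h2.contMDiffOn fun w hw => ⟨mem_univ _, hw⟩
  have h2 := ((h1 _ (hγu hs)).mdifferentiableWithinAt (by simp)).hasMFDerivWithinAt
  have h3 := ((hγ.contMDiffAt (hO.mem_nhds hs)).mdifferentiableAt (by simp)).hasMFDerivAt
  have h4 := (h2.comp s (h3.hasMFDerivWithinAt (s := O)) hγu).hasMFDerivAt (hO.mem_nhds hs)
  exact (DFunLike.congr_fun h4.mfderiv (1 : ℝ)).symm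

end IsThermostatFlow

namespace IsThermostatFlow

/-- The Jacobi equation along a variation through orbits of the thermostat flow. -/
theorem hasDerivAt_variation {J : Rotation g} {m : ℕ} {A : Differential J m}
    {φ : ℝ → TangentBundle (𝓡 2) M → TangentBundle (𝓡 2) M}
    (hφ : IsThermostatFlow J A.imPart φ) (hA : A.IsHolomorphic)
    {γ : ℝ → TangentBundle (𝓡 2) M} {O : Set ℝ} (hO : IsOpen O) (h0 : (0 : ℝ) ∈ O)
    (hγ : ContMDiffOn 𝓘(ℝ, ℝ) (𝓡 2).tangent ∞ γ O) (hγu : MapsTo γ O (unitTangent g))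
    {x y ψ : ℝ → ℝ}
    (hx : ∀ t, x t = omega₁ g (φ t (γ 0))
      (mfderiv 𝓘(ℝ, ℝ) (𝓡 2).tangent (fun s => φ t (γ s)) 0 (1 : ℝ)))
    (hy : ∀ t, y t = omega₂ J (φ t (γ 0))
      (mfderiv 𝓘(ℝ, ℝ) (𝓡 2).tangent (fun s => φ t (γ s)) 0 (1 : ℝ)))
    (hψ : ∀ t, ψ t = psi J (φ t (γ 0))
      (mfderiv 𝓘(ℝ, ℝ) (𝓡 2).tangent (fun s => φ t (γ s)) 0 (1 : ℝ))) (t : ℝ) :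
    ∃ D : ℂ, HasDerivAt (fun t => A.value (φ t (γ 0)))
        (D + Complex.I * m * A.value (φ t (γ 0)) * A.imPart (φ t (γ 0))) t ∧
      HasDerivAt x (A.imPart (φ t (γ 0)) * y t) t ∧
      HasDerivAt y (ψ t - A.imPart (φ t (γ 0)) * x t) t ∧
      HasDerivAt ψ ((D * (x t + Complex.I * y t) + Complex.I * m * A.value (φ t (γ 0)) * ψ t).im
        - gaussCurvature J (φ t (γ 0)).1 * y t) t := by
  have hΦ := hφ.contMDiffOn_curve hγ hγu
  set Φ : ℝ × ℝ → TangentBundle (𝓡 2) M := fun P => φ P.1 (γ P.2) with hΦd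
  have hNo : IsOpen ((univ : Set ℝ) ×ˢ O) := isOpen_univ.prod hO
  have hΦu : ∀ P ∈ (univ : Set ℝ) ×ˢ O, Φ P ∈ unitTangent g := fun P hP =>
    hφ.mapsTo _ (hγu hP.2)
  obtain ⟨U, z, f, hU, hz, hf, hAf⟩ := hA (Φ (t, 0)).1
  have hpr := (contMDiff_proj_tangent (M := M))
  -- the open set of parameters over which the coordinate is defined
  let V : Set (ℝ × ℝ) := {P | P ∈ (univ : Set ℝ) ×ˢ O ∧ (Φ P).1 ∈ U}
  have hVo : IsOpen V :=
    (hpr.continuous.comp_continuousOn hΦ.continuousOn).isOpen_inter_preimage hNo hz.isOpen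
  have hPV : (t, (0 : ℝ)) ∈ V := ⟨⟨mem_univ _, h0⟩, hU⟩
  have hVn : ∀ᶠ P in 𝓝 (t, (0 : ℝ)), P ∈ V := hVo.mem_nhds hPV
  have hΦV : ∀ P ∈ V, ContMDiffAt 𝓘(ℝ, ℝ × ℝ) (𝓡 2).tangent ∞ Φ P := fun P hP =>
    hΦ.contMDiffAt (hNo.mem_nhds hP.1)
  have hslice1 : ∀ P ∈ V, MDifferentiableAt 𝓘(ℝ, ℝ) (𝓡 2).tangent (fun t => Φ (t, P.2)) P.1 := by
    intro P hP
    have h1 : ContMDiff 𝓘(ℝ, ℝ) 𝓘(ℝ, ℝ × ℝ) ∞ (fun t : ℝ => (t, P.2)) :=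
      (by fun_prop : ContDiff ℝ ∞ fun t : ℝ => (t, P.2)).contMDiff
    exact ((hΦV P hP).comp P.1 (h1.contMDiffAt (x := P.1))).mdifferentiableAt (by simp)
  have hslice2 : ∀ P ∈ V, MDifferentiableAt 𝓘(ℝ, ℝ) (𝓡 2).tangent (fun s => Φ (P.1, s)) P.2 := by
    intro P hP
    have h1 : ContMDiff 𝓘(ℝ, ℝ) 𝓘(ℝ, ℝ × ℝ) ∞ (fun s : ℝ => (P.1, s)) :=
      (by fun_prop : ContDiff ℝ ∞ fun s : ℝ => (P.1, s)).contMDiff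
    exact ((hΦV P hP).comp P.2 (h1.contMDiffAt (x := P.2))).mdifferentiableAt (by simp)
  have hu1 : ∀ P ∈ V, ∀ᶠ t in 𝓝 P.1, Φ (t, P.2) ∈ unitTangent g := fun P hP =>
    Filter.Eventually.of_forall fun t => hΦu _ ⟨mem_univ _, hP.1.2⟩
  have hu2 : ∀ P ∈ V, ∀ᶠ s in 𝓝 P.2, Φ (P.1, s) ∈ unitTangent g := fun P hP => by
    filter_upwards [hO.mem_nhds hP.1.2] with s hs using hΦu _ ⟨mem_univ _, hs⟩
  have hgen : ∀ P ∈ V, omega₁ g (Φ P)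
        (mfderiv 𝓘(ℝ, ℝ) (𝓡 2).tangent (fun t => Φ (t, P.2)) P.1 (1 : ℝ)) = 1 ∧
      omega₂ J (Φ P) (mfderiv 𝓘(ℝ, ℝ) (𝓡 2).tangent (fun t => Φ (t, P.2)) P.1 (1 : ℝ)) = 0 ∧
      psi J (Φ P) (mfderiv 𝓘(ℝ, ℝ) (𝓡 2).tangent (fun t => Φ (t, P.2)) P.1 (1 : ℝ))
        = A.imPart (Φ P) := fun P hP =>
    (coframe_eq_iff J).1 (hφ.generator (γ P.2) (hγu hP.1.2) P.1)
  let Z : ℝ × ℝ → ℂ := fun P => z (Φ P).1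
  let W : ℝ × ℝ → ℂ := fun P => mvfderiv (𝓡 2) z (Φ P).1 (Φ P).2
  let μ : ℝ × ℝ → ℂ := fun P => logDerivFactor J z (Φ P).1
  have hZ : ContDiffAt ℝ ∞ Z (t, 0) :=
    (ContMDiffAt.comp (g := z) (t, (0 : ℝ)) (hz.contMDiffAt hU)
      (hpr.contMDiffAt.comp (t, (0 : ℝ)) (hΦV _ hPV))).contDiffAt
  have hW : ContDiffAt ℝ ∞ W (t, 0) :=
    (ContMDiffAt.comp (g := fun v : TangentBundle (𝓡 2) M => mvfderiv (𝓡 2) z v.1 v.2)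
      (t, (0 : ℝ)) (hz.contMDiffAt_mvfderiv hU) (hΦV _ hPV)).contDiffAt
  have hW0 : W (t, 0) ≠ 0 := hz.mvfderiv_ne_zero_of_unit hU (hΦu _ hPV.1)
  have hZt : ∀ᶠ Q in 𝓝 (t, (0 : ℝ)), HasDerivAt (fun t => Z (t, Q.2)) (W Q) Q.1 := by
    filter_upwards [hVn] with Q hQ
    have h := hz.hasDerivAt_curve (hslice1 Q hQ) (hu1 Q hQ) hQ.2
    obtain ⟨g1, g2, -⟩ := hgen Q hQ
    exact h.congr_deriv (by erw [g1, g2]; simp [W])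
  have hWt : ∀ᶠ Q in 𝓝 (t, (0 : ℝ)), HasDerivAt (fun t => W (t, Q.2))
      (W Q * (Complex.I * (A.imPart (Φ Q)) + μ Q * W Q)) Q.1 := by
    filter_upwards [hVn] with Q hQ
    have h := hz.hasDerivAt_mvfderiv_curve (hslice1 Q hQ) (hu1 Q hQ) hQ.2
    obtain ⟨g1, g2, g3⟩ := hgen Q hQ
    exact h.congr_deriv (by erw [g1, g2, g3]; simp [W, μ])
  have hVt : ∀ᶠ r in 𝓝 t, (r, (0 : ℝ)) ∈ V :=
    ((by fun_prop : Continuous fun r : ℝ => (r, (0 : ℝ))).continuousAt (x := t)).eventually hVn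
  have hZs : ∀ᶠ r in 𝓝 t, HasDerivAt (fun s => Z (r, s))
      (W (r, 0) * (x r + Complex.I * y r)) 0 := by
    filter_upwards [hVt] with r hr
    have h := hz.hasDerivAt_curve (hslice2 _ hr) (hu2 _ hr) hr.2
    rw [hx, hy]
    exact h
  have hWs : ∀ᶠ r in 𝓝 t, HasDerivAt (fun s => W (r, s)) (W (r, 0) *
      (Complex.I * ψ r + μ (r, 0) * (W (r, 0) * (x r + Complex.I * y r)))) 0 := by
    filter_upwards [hVt] with r hr
    have h := hz.hasDerivAt_mvfderiv_curve (hslice2 _ hr) (hu2 _ hr) hr.2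
    rw [hx, hy, hψ]
    exact h
  have hμd : MDifferentiableAt (𝓡 2) 𝓘(ℝ, ℂ) (logDerivFactor J z) (Φ (t, 0)).1 :=
    (hz.contMDiffAt_logDerivFactor hU).mdifferentiableAt (by simp)
  have hμt := hasDerivAt_proj_curve (hslice1 _ hPV) hμd
  have hμs := hasDerivAt_proj_curve (hslice2 _ hPV) hμd
  have hAt := Differential.hasDerivAt_value_curve (hslice1 _ hPV) (hu1 _ hPV) hz hPV.2 hf hAf
  have hAs := Differential.hasDerivAt_value_curve (hslice2 _ hPV) (hu2 _ hPV) hz hPV.2 hf hAf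
  obtain ⟨g1, g2, g3⟩ := hgen _ hPV
  have hlams := hasDerivAt_im hAs
  -- The values `ω₁ = 1` and `ω₂ = 0` of the generator say that an orbit is the velocity curve of
  -- its projection.
  have hdt : dproj (Φ (t, 0))
      (mfderiv 𝓘(ℝ, ℝ) (𝓡 2).tangent (fun r => Φ (r, 0)) t (1 : ℝ)) = (Φ (t, 0)).2 := by
    have h := J.eq_add (show g.inner _ (Φ (t, 0)).2 (Φ (t, 0)).2 = 1 from hΦu _ hPV.1)
      (dproj (Φ (t, 0)) (mfderiv 𝓘(ℝ, ℝ) (𝓡 2).tangent (fun r => Φ (r, 0)) t (1 : ℝ)))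
    have g1' : g.inner _ (dproj (Φ (t, 0)) (mfderiv 𝓘(ℝ, ℝ) (𝓡 2).tangent
      (fun r => Φ (r, 0)) t (1 : ℝ))) (Φ (t, 0)).2 = 1 := g1
    have g2' : g.inner _ (dproj (Φ (t, 0)) (mfderiv 𝓘(ℝ, ℝ) (𝓡 2).tangent
      (fun r => Φ (r, 0)) t (1 : ℝ))) (J.toFun _ (Φ (t, 0)).2) = 0 := g2
    rw [g1', g2', one_smul, zero_smul, add_zero] at h
    exact h
  have hdW : mvfderiv (𝓡 2) z (Φ (t, 0)).1 (dproj (Φ (t, 0))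
      (mfderiv 𝓘(ℝ, ℝ) (𝓡 2).tangent (fun s => Φ (t, s)) 0 (1 : ℝ))) =
      W (t, 0) * (x t + Complex.I * y t) := by
    have h := hz.omega_eq (hΦu _ hPV.1) hU
      (mfderiv 𝓘(ℝ, ℝ) (𝓡 2).tangent (fun s => Φ (t, s)) 0 (1 : ℝ))
    rw [eq_div_iff hW0] at h
    rw [← h, hx, hy, mul_comm]
  have hK := hz.logDerivFactor_antisymm hU (show g.inner _ (Φ (t, 0)).2 (Φ (t, 0)).2 = 1
    from hΦu _ hPV.1) (dproj (Φ (t, 0))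
      (mfderiv 𝓘(ℝ, ℝ) (𝓡 2).tangent (fun s => Φ (t, s)) 0 (1 : ℝ)))
  rw [hdW] at hK
  have hyt : y t = g.inner _ (dproj (Φ (t, 0))
      (mfderiv 𝓘(ℝ, ℝ) (𝓡 2).tangent (fun s => Φ (t, s)) 0 (1 : ℝ)))
      (J.toFun _ (Φ (t, 0)).2) := hy t
  rw [← hyt] at hK
  have hmain := Thermostat.hasDerivAt_variation (lam := fun Q => A.imPart (Φ Q))
    (hZ.of_le ENat.LEInfty.out) (hW.of_le ENat.LEInfty.out) hW0 hZt hWt hZs hWs hμt hμs hlams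
    (K := gaussCurvature J (Φ (t, 0)).1) (by
      rw [hdt]
      exact hK)
  refine ⟨(derivWithin f (z '' U) (z (Φ (t, 0)).1) + m * logDerivFactor J z (Φ (t, 0)).1 *
    f (z (Φ (t, 0)).1)) * W (t, 0) ^ (m + 1), ?_, hmain.1, hmain.2.1, ?_⟩
  · refine hAt.congr_deriv ?_
    erw [g1, g2, g3]
    simp [W, Φ]
  · refine hmain.2.2.congr_deriv ?_
    rw [hx, hy, hψ]

end IsThermostatFlow

end Surface

/-! ### Scalar differential inequalities -/

/-- Grönwall's inequality: `f exp(-∫ c)` is nondecreasing. The coefficient `c` is extended by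
constants outside `[a, b]`, so that its primitive is differentiable everywhere. -/
theorem exists_pos_mul_le_of_deriv_ge {f f' c : ℝ → ℝ} {a b : ℝ} (hab : a ≤ b)
    (hc : ContinuousOn c (Icc a b)) (hf : ∀ t ∈ Icc a b, HasDerivAt f (f' t) t)
    (h : ∀ t ∈ Icc a b, c t * f t ≤ f' t) : ∃ k > 0, k * f a ≤ f b := by
  let C : ℝ → ℝ := IccExtend hab (domRestrict (Icc a b) c)
  have hC : Continuous C := hc.domRestrict.Icc_extend'
  have hCc : ∀ t ∈ Icc a b, C t = c t := fun t ht => IccExtend_of_mem hab _ ht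
  let I : ℝ → ℝ := fun t => ∫ x in a..t, C x
  have hI : ∀ t, HasDerivAt I (C t) t := fun t => hC.integral_hasStrictDerivAt a t |>.hasDerivAt
  have hF : ∀ t ∈ Icc a b, HasDerivAt (fun t => f t * Real.exp (-I t))
      (f' t * Real.exp (-I t) + f t * (Real.exp (-I t) * -C t)) t :=
    fun t ht => (hf t ht).mul (hI t).neg.exp
  have hm : MonotoneOn (fun t => f t * Real.exp (-I t)) (Icc a b) := by
    refine monotoneOn_of_deriv_nonneg (convex_Icc a b)
      (fun t ht => (hF t ht).continuousAt.continuousWithinAt)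
      (fun t ht => (hF t (interior_subset ht)).differentiableAt.differentiableWithinAt) ?_
    intro t ht
    have ht' := interior_subset ht
    rw [(hF t ht').deriv, hCc t ht']
    have := mul_nonneg (sub_nonneg.2 (h t ht')) (Real.exp_pos (-I t)).le
    linarith
  have h1 : f a * Real.exp (-I a) ≤ f b * Real.exp (-I b) :=
    hm (left_mem_Icc.2 hab) (right_mem_Icc.2 hab) hab
  have h2 : I a = 0 := intervalIntegral.integral_same
  rw [h2, neg_zero, Real.exp_zero, mul_one] at h1
  refine ⟨Real.exp (I b), Real.exp_pos _, ?_⟩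
  calc Real.exp (I b) * f a ≤ Real.exp (I b) * (f b * Real.exp (-I b)) := by gcongr
    _ = f b := by rw [mul_comm, mul_assoc, ← Real.exp_add, neg_add_cancel, Real.exp_zero, mul_one]

theorem nonneg_of_deriv_ge {f f' c : ℝ → ℝ} {a b : ℝ} (hab : a ≤ b)
    (hc : ContinuousOn c (Icc a b)) (hf : ∀ t ∈ Icc a b, HasDerivAt f (f' t) t)
    (h : ∀ t ∈ Icc a b, c t * f t ≤ f' t) (ha : 0 ≤ f a) : 0 ≤ f b := by
  obtain ⟨k, hk, hk'⟩ := exists_pos_mul_le_of_deriv_ge hab hc hf h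
  exact (mul_nonneg hk.le ha).trans hk'

theorem pos_of_deriv_ge {f f' c : ℝ → ℝ} {a b : ℝ} (hab : a ≤ b)
    (hc : ContinuousOn c (Icc a b)) (hf : ∀ t ∈ Icc a b, HasDerivAt f (f' t) t)
    (h : ∀ t ∈ Icc a b, c t * f t ≤ f' t) (ha : 0 < f a) : 0 < f b := by
  obtain ⟨k, hk, hk'⟩ := exists_pos_mul_le_of_deriv_ge hab hc hf h
  exact (mul_pos hk ha).trans_le hk'

/-- Solutions of `d' = c d` grow and decay at most exponentially. -/
theorem abs_le_exp_mul_abs {d c : ℝ → ℝ} {a B : ℝ} (hB : ∀ t ≥ a, |c t| ≤ B)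
    (hd : ∀ t ≥ a, HasDerivAt d (c t * d t) t) {s t : ℝ} (hs : a ≤ s) (ht : a ≤ t) :
    |d t| ≤ Real.exp (B * |t - s|) * |d s| := by
  -- Squares are used so that the monotonicity arguments do not depend on the sign of `d`.
  have key : ∀ b : ℝ, ∀ x ≥ a, HasDerivAt (fun x => (d x * Real.exp (b * x)) ^ 2)
      (2 * (c x + b) * (d x * Real.exp (b * x)) ^ 2) x := by
    intro b x hx
    have h1 : HasDerivAt (fun x => Real.exp (b * x)) (Real.exp (b * x) * b) x := by
      simpa using ((hasDerivAt_id x).const_mul b).exp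
    refine (((hd x hx).mul h1).pow 2).congr_deriv ?_
    simp only [Pi.mul_apply]
    push_cast
    ring
  have hsq : ∀ b x y : ℝ, (d x * Real.exp (b * x)) ^ 2 ≤ (d y * Real.exp (b * y)) ^ 2 →
      |d x| ≤ Real.exp (b * (y - x)) * |d y| := by
    intro b x y h
    have h1 := sq_le_sq.1 h
    rw [abs_mul, abs_mul, abs_of_pos (Real.exp_pos _), abs_of_pos (Real.exp_pos _)] at h1
    have h2 : Real.exp (b * (y - x)) = Real.exp (b * y) * Real.exp (-(b * x)) := by
      rw [← Real.exp_add]; ring_nf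
    calc |d x| = |d x| * Real.exp (b * x) * Real.exp (-(b * x)) := by
          rw [mul_assoc, ← Real.exp_add, add_neg_cancel, Real.exp_zero, mul_one]
      _ ≤ |d y| * Real.exp (b * y) * Real.exp (-(b * x)) := by gcongr
      _ = _ := by rw [h2]; ring
  rcases le_total s t with hst | hst
  · rw [abs_of_nonneg (sub_nonneg.2 hst)]
    have hanti : AntitoneOn (fun x => (d x * Real.exp (-B * x)) ^ 2) (Ici a) := by
      refine antitoneOn_of_deriv_nonpos (convex_Ici a)
        (fun x hx => (key (-B) x hx).continuousAt.continuousWithinAt)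
        (fun x hx => (key (-B) x (interior_subset hx)).differentiableAt.differentiableWithinAt) ?_
      intro x hx
      have hx' := interior_subset hx
      rw [(key (-B) x hx').deriv]
      have := (abs_le.1 (hB x hx')).2
      have h0 := sq_nonneg (d x * Real.exp (-B * x))
      nlinarith
    have := hsq _ _ _ (hanti hs ht hst)
    rwa [show -B * (s - t) = B * (t - s) by ring] at this
  · rw [abs_sub_comm, abs_of_nonneg (sub_nonneg.2 hst)]
    have hmono : MonotoneOn (fun x => (d x * Real.exp (B * x)) ^ 2) (Ici a) := by
      refine monotoneOn_of_deriv_nonneg (convex_Ici a)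
        (fun x hx => (key B x hx).continuousAt.continuousWithinAt)
        (fun x hx => (key B x (interior_subset hx)).differentiableAt.differentiableWithinAt) ?_
      intro x hx
      have hx' := interior_subset hx
      rw [(key B x hx').deriv]
      have := (abs_le.1 (hB x hx')).1
      have h0 := sq_nonneg (d x * Real.exp (B * x))
      nlinarith
    exact hsq _ _ _ (hmono ht hs hst)

theorem eq_mul_exp_integral {y c : ℝ → ℝ} (hc : Continuous c)
    (hy : ∀ t, HasDerivAt y (c t * y t) t) (t : ℝ) :
    y t = y 0 * Real.exp (∫ s in (0 : ℝ)..t, c s) := by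
  have hI : ∀ t, HasDerivAt (fun t => ∫ s in (0 : ℝ)..t, c s) (c t) t :=
    fun t => hc.integral_hasStrictDerivAt 0 t |>.hasDerivAt
  have hF : ∀ t, HasDerivAt (fun t => y t * Real.exp (-∫ s in (0 : ℝ)..t, c s)) 0 t := by
    intro t
    refine ((hy t).mul (hI t).neg.exp).congr_deriv ?_
    simp only [Pi.neg_apply]
    ring
  have h := is_const_of_deriv_eq_zero (fun t => (hF t).differentiableAt)
    (fun t => (hF t).deriv) t 0
  simp only [intervalIntegral.integral_same, neg_zero, Real.exp_zero, mul_one] at h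
  rw [← h, mul_assoc, ← Real.exp_add, neg_add_cancel, Real.exp_zero, mul_one]

/-- On `[ε, ∞)` one has `|log x - log y| ≤ |x - y| / ε`. Through this the term `-r` in `(log r)'`
contracts logarithmic distances at rate at least `ε`. -/
theorem mul_sq_log_sub_log_le {ε x y : ℝ} (hε : 0 < ε) (hx : ε ≤ x) (hy : ε ≤ y) :
    ε * (Real.log x - Real.log y) ^ 2 ≤ (Real.log x - Real.log y) * (x - y) := by
  wlog hxy : y ≤ x generalizing x y
  · have := this hy hx (le_of_not_ge hxy)
    linarith [sq_nonneg (Real.log x - Real.log y)]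
  have hx0 := hε.trans_le hx
  have hy0 := hε.trans_le hy
  have h0 : 0 ≤ Real.log x - Real.log y := sub_nonneg.2 (Real.log_le_log hy0 hxy)
  have h1 := Real.log_le_sub_one_of_pos (div_pos hx0 hy0)
  rw [Real.log_div hx0.ne' hy0.ne'] at h1
  have h2 : x / y - 1 = (x - y) / y := by field_simp
  rw [h2, le_div_iff₀ hy0] at h1
  have h3 : ε * (Real.log x - Real.log y) ≤ x - y :=
    (mul_le_mul_of_nonneg_right hy h0).trans (by linarith)
  nlinarith

/-- The converse bound `|x - y| ≤ L |log x - log y|` on `(0, L]` leads back from logarithms to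
slopes. -/
theorem sq_sub_le_mul_sq_log_sub_log {L x y : ℝ} (hx0 : 0 < x) (hy0 : 0 < y) (hx : x ≤ L)
    (hy : y ≤ L) : (x - y) ^ 2 ≤ L ^ 2 * (Real.log x - Real.log y) ^ 2 := by
  wlog hxy : y ≤ x generalizing x y
  · have := this hy0 hx0 hy hx (le_of_not_ge hxy)
    linarith
  have h0 : 0 ≤ Real.log x - Real.log y := sub_nonneg.2 (Real.log_le_log hy0 hxy)
  have h1 := Real.one_sub_inv_le_log_of_pos (div_pos hx0 hy0)
  rw [Real.log_div hx0.ne' hy0.ne'] at h1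
  have h2 : 1 - (x / y)⁻¹ = (x - y) / x := by field_simp
  rw [h2, div_le_iff₀ hx0] at h1
  have h3 : x - y ≤ L * (Real.log x - Real.log y) := by nlinarith
  rw [← mul_pow]
  exact pow_le_pow_left₀ (sub_nonneg.2 hxy) h3 2

/-! ### Positive linear cocycles over a flow -/

/-- A flow on `S` and the linear system `y' = p y + w`, `w' = P y + q w`, with `P > 0`, along its
orbits. -/
structure PositiveSystem (S : Type*) [TopologicalSpace S] where
  /-- the flow -/
  flow : ℝ → S → S
  flow_zero : ∀ v, flow 0 v = v
  flow_add : ∀ s t v, flow (s + t) v = flow s (flow t v)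
  continuous_flow : Continuous fun x : ℝ × S => flow x.1 x.2
  /-- a coefficient of the system -/
  p : S → ℝ
  /-- a coefficient of the system -/
  q : S → ℝ
  /-- a coefficient of the system -/
  P : S → ℝ
  continuous_p : Continuous p
  continuous_q : Continuous q
  continuous_P : Continuous P
  P_pos : ∀ v, 0 < P v
  exists_solution : ∀ (v : S) (y₀ w₀ : ℝ), ∃ y w : ℝ → ℝ, y 0 = y₀ ∧ w 0 = w₀ ∧
    ∀ t, HasDerivAt y (p (flow t v) * y t + w t) t ∧
      HasDerivAt w (P (flow t v) * y t + q (flow t v) * w t) t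

namespace PositiveSystem

variable {S : Type*} [TopologicalSpace S] (C : PositiveSystem S)

/-- `(y, w)` is a solution of the system along the orbit of `v`. -/
def IsSolution (v : S) (y w : ℝ → ℝ) : Prop :=
  ∀ t, HasDerivAt y (C.p (C.flow t v) * y t + w t) t ∧
    HasDerivAt w (C.P (C.flow t v) * y t + C.q (C.flow t v) * w t) t

/-- `r` is, for `t ≥ a`, a solution with values in `[ε, L]` of the Riccati equation satisfied by
the quotients `w / y`. -/
def IsRiccati (ε L : ℝ) (v : S) (a : ℝ) (r : ℝ → ℝ) : Prop :=
  ∀ t ≥ a, ε ≤ r t ∧ r t ≤ L ∧ HasDerivAt r (C.P (C.flow t v)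
    + (C.q (C.flow t v) - C.p (C.flow t v)) * r t - r t ^ 2) t

theorem continuous_orbit (v : S) : Continuous fun t => C.flow t v :=
  C.continuous_flow.comp (by fun_prop : Continuous fun t : ℝ => (t, v))

/-- `[ε, L]` is invariant under the Riccati equation. -/
def IsTrap (ε L : ℝ) : Prop :=
  0 < ε ∧ ε ≤ 1 ∧ 1 ≤ L ∧ ∀ v, 0 ≤ C.P v + (C.q v - C.p v) * ε - ε ^ 2 ∧
    C.P v + (C.q v - C.p v) * L - L ^ 2 ≤ 0

theorem exists_bound [CompactSpace S] {f : S → ℝ} (hf : Continuous f) :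
    ∃ B, 0 ≤ B ∧ ∀ v, |f v| ≤ B := by
  obtain ⟨B, hB⟩ := isCompact_univ.exists_bound_of_continuousOn hf.continuousOn
  exact ⟨max B 0, le_max_right _ _, fun v => (hB v (mem_univ v)).trans (le_max_left _ _)⟩

theorem exists_pos_le [CompactSpace S] {f : S → ℝ} (hf : Continuous f) (h : ∀ v, 0 < f v) :
    ∃ c > 0, ∀ v, c ≤ f v := by
  rcases isEmpty_or_nonempty S with hS | hS
  · exact ⟨1, one_pos, fun v => isEmptyElim v⟩
  obtain ⟨v₀, -, hv₀⟩ := isCompact_univ.exists_isMinOn univ_nonempty hf.continuousOn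
  exact ⟨f v₀, h v₀, fun v => hv₀ (mem_univ v)⟩

theorem exists_isTrap [CompactSpace S] : ∃ ε L, C.IsTrap ε L := by
  obtain ⟨c, hc, hcP⟩ := exists_pos_le C.continuous_P C.P_pos
  obtain ⟨B₁, h1, hB₁⟩ := exists_bound C.continuous_P
  obtain ⟨B₂, h2, hB₂⟩ := exists_bound (C.continuous_q.sub C.continuous_p)
  set B := B₁ + B₂ + 1 with hB
  have hB0 : 0 < B + 1 := by linarith
  -- At `ε` the bound `ε (B + 1) ≤ c ≤ P` absorbs `B₂ ε + ε²`; at `L = B + 1` the square `L²`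
  -- exceeds `B₁ + B₂ L`. The value `1` is kept between the ends as a common initial slope.
  refine ⟨min 1 (c / (B + 1)), B + 1, lt_min one_pos (div_pos hc hB0), min_le_left _ _,
    by linarith, fun v => ?_⟩
  set ε := min 1 (c / (B + 1)) with hε
  have e0 : 0 < ε := lt_min one_pos (div_pos hc hB0)
  have e1 : ε ≤ 1 := min_le_left _ _
  have e2 : ε * (B + 1) ≤ c := by
    rw [← le_div_iff₀ hB0]; exact min_le_right _ _
  have k1 : -B₂ ≤ C.q v - C.p v ∧ C.q v - C.p v ≤ B₂ := abs_le.1 (hB₂ v)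
  have k2 := abs_le.1 (hB₁ v)
  have k3 := hcP v
  constructor
  · have m1 : -B₂ * ε ≤ (C.q v - C.p v) * ε := mul_le_mul_of_nonneg_right k1.1 e0.le
    have m2 : ε * ε ≤ 1 * ε := mul_le_mul_of_nonneg_right e1 e0.le
    nlinarith [mul_nonneg h1 e0.le]
  · have m1 : (C.q v - C.p v) * (B + 1) ≤ B₂ * (B + 1) := mul_le_mul_of_nonneg_right k1.2 hB0.le
    nlinarith [mul_nonneg h1 h2, mul_nonneg h1 h1]

variable {C} {ε L : ℝ}

theorem IsRiccati.mono {v : S} {a b : ℝ} {r : ℝ → ℝ} (h : C.IsRiccati ε L v a r) (hab : a ≤ b) :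
    C.IsRiccati ε L v b r := fun t ht => h t (hab.trans ht)

theorem IsRiccati.shift {v : S} {a s : ℝ} {r : ℝ → ℝ} (h : C.IsRiccati ε L (C.flow s v) a r) :
    C.IsRiccati ε L v (a + s) (fun t => r (t - s)) := by
  intro t ht
  have h1 := h (t - s) (by linarith)
  rw [← C.flow_add, sub_add_cancel] at h1
  exact ⟨h1.1, h1.2.1, h1.2.2.comp_sub_const t s⟩

theorem exists_isRiccati (hT : C.IsTrap ε L) (v : S) (a : ℝ) :
    ∃ r, C.IsRiccati ε L v a r := by
  suffices h : ∀ v, ∃ r, C.IsRiccati ε L v 0 r by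
    obtain ⟨r, hr⟩ := h (C.flow a v)
    have := hr.shift
    rw [zero_add] at this
    exact ⟨_, this⟩
  clear v a
  intro v
  obtain ⟨he, he1, hL1, hT⟩ := hT
  obtain ⟨y, w, hy0, hw0, hyw⟩ := C.exists_solution v 1 1
  have horb := C.continuous_orbit v
  -- The quadrant is preserved because `(y w)' = (p + q) y w + P y² + w²` with nonnegative last
  -- terms; thus `y` never vanishes and the quotient is defined for all later times.
  have hQ : ∀ t ≥ 0, 0 < y t * w t := by
    intro t ht
    refine pos_of_deriv_ge (f := fun t => y t * w t)
      (c := fun t => C.p (C.flow t v) + C.q (C.flow t v)) ht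
      ((C.continuous_p.comp horb).add (C.continuous_q.comp horb)).continuousOn
      (fun s _ => (hyw s).1.mul (hyw s).2) ?_ (by simp [hy0, hw0])
    intro s _
    have := mul_nonneg (C.P_pos (C.flow s v)).le (sq_nonneg (y s))
    nlinarith [sq_nonneg (w s)]
  have hy : ∀ t ≥ 0, y t ≠ 0 := fun t ht h => by
    have := hQ t ht
    rw [h, zero_mul] at this
    exact lt_irrefl _ this
  have hr : ∀ t ≥ 0, HasDerivAt (fun t => w t / y t) (C.P (C.flow t v)
      + (C.q (C.flow t v) - C.p (C.flow t v)) * (w t / y t) - (w t / y t) ^ 2) t := by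
    intro t ht
    have h0 := hy t ht
    refine ((hyw t).2.div (hyw t).1 h0).congr_deriv ?_
    field_simp
    ring
  have hrc : ∀ b, ContinuousOn (fun t => w t / y t) (Icc 0 b) :=
    fun b t ht => (hr t ht.1).continuousAt.continuousWithinAt
  have hk : Continuous fun t => C.q (C.flow t v) - C.p (C.flow t v) :=
    (C.continuous_q.comp horb).sub (C.continuous_p.comp horb)
  have hr0 : w 0 / y 0 = 1 := by rw [hy0, hw0, div_one]
  refine ⟨fun t => w t / y t, fun t ht => ⟨?_, ?_, hr t ht⟩⟩
  -- The Riccati expressions at `r` and at `ε` differ by `(r - ε) (q - p - r - ε)`, which explains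
  -- the coefficient `c`; the bound at `L` uses the same factorisation.
  · have := nonneg_of_deriv_ge (f := fun t => w t / y t - ε)
      (c := fun t => C.q (C.flow t v) - C.p (C.flow t v) - w t / y t - ε) (show (0 : ℝ) ≤ t from ht)
      ((hk.continuousOn.sub (hrc t)).sub continuousOn_const)
      (fun s hs => (hr s hs.1).sub_const ε) (fun s _ => ?_) (by simp only [hr0]; linarith)
    · linarith
    · have := (hT (C.flow s v)).1
      linarith
  · have := nonneg_of_deriv_ge (f := fun t => L - w t / y t)
      (c := fun t => C.q (C.flow t v) - C.p (C.flow t v) - w t / y t - L) (show (0 : ℝ) ≤ t from ht)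
      ((hk.continuousOn.sub (hrc t)).sub continuousOn_const)
      (fun s hs => (hr s hs.1).const_sub L) (fun s _ => ?_) (by simp only [hr0]; linarith)
    · linarith
    · have := (hT (C.flow s v)).2
      linarith

/-- Riccati solutions along nearby orbits approach each other. -/
theorem sq_sub_le_of_isRiccati (hT : C.IsTrap ε L) : ∃ A, 0 ≤ A ∧ ∀ (v v' : S) (a e : ℝ)
    (r r' : ℝ → ℝ), a ≤ 0 → C.IsRiccati ε L v a r → C.IsRiccati ε L v' a r' →
    (∀ t ∈ Icc a 0, |C.P (C.flow t v) - C.P (C.flow t v')| ≤ e ∧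
      |(C.q (C.flow t v) - C.p (C.flow t v)) - (C.q (C.flow t v') - C.p (C.flow t v'))| ≤ e) →
    (r 0 - r' 0) ^ 2 ≤ A * (e ^ 2 + Real.exp (ε * a)) := by
  obtain ⟨he, he1, hL1, hT⟩ := hT
  -- Coefficients that differ by at most `e` perturb the equation for `log r` by at most `e / ε + e
  -- = D e ε`; `Λ` is the length of `[log ε, log L]` and bounds the initial distance.
  set D := (1 / ε + 1) / ε
  set Λ := Real.log L - Real.log ε
  refine ⟨L ^ 2 * (D ^ 2 + Λ ^ 2), by positivity, ?_⟩
  intro v v' a e r r' ha hr hr' hclose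
  have hpos : ∀ t ≥ a, 0 < r t ∧ 0 < r' t := fun t ht =>
    ⟨he.trans_le (hr t ht).1, he.trans_le (hr' t ht).1⟩
  -- As a function of `r`, the right side of `(log r)' = P / r + (q - p) - r` is decreasing because
  -- `P > 0`. Together with the perturbation bound this gives `(δ²)' ≤ -ε δ² + ε (D e)²`, and the
  -- barrier `(D e)² + Λ² exp(-ε (t - a))` solves the equation with equality.
  let δ : ℝ → ℝ := fun t => Real.log (r t) - Real.log (r' t)
  have hδ : ∀ t ∈ Icc a 0, HasDerivAt (fun t => δ t ^ 2) (2 * δ t *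
      ((C.P (C.flow t v) + (C.q (C.flow t v) - C.p (C.flow t v)) * r t - r t ^ 2) / r t -
      (C.P (C.flow t v') + (C.q (C.flow t v') - C.p (C.flow t v')) * r' t - r' t ^ 2) / r' t))
      t := by
    intro t ht
    obtain ⟨h1, h2⟩ := hpos t ht.1
    have := (((hr t ht.1).2.2.log h1.ne').sub ((hr' t ht.1).2.2.log h2.ne')).pow 2
    refine this.congr_deriv ?_
    simp [δ]
  have hexp : ∀ t, HasDerivAt (fun t => Real.exp (-ε * (t - a))) (Real.exp (-ε * (t - a)) * -ε) t := by
    intro t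
    simpa using (((hasDerivAt_id t).sub_const a).const_mul (-ε)).exp
  have key := nonneg_of_deriv_ge
    (f := fun t => (D * e) ^ 2 + Λ ^ 2 * Real.exp (-ε * (t - a)) - δ t ^ 2) (c := fun _ => -ε) ha
    continuousOn_const
    (fun t ht => (((hexp t).const_mul (Λ ^ 2)).const_add ((D * e) ^ 2)).sub (hδ t ht)) ?_ ?_
  · have h1 := sq_sub_le_mul_sq_log_sub_log (hpos 0 ha).1 (hpos 0 ha).2 (hr 0 ha).2.1 (hr' 0 ha).2.1
    have h2 : δ 0 ^ 2 ≤ (D * e) ^ 2 + Λ ^ 2 * Real.exp (ε * a) := by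
      have : -ε * (0 - a) = ε * a := by ring
      rw [this] at key
      linarith
    refine h1.trans ?_
    rw [mul_assoc]
    refine mul_le_mul_of_nonneg_left (h2.trans ?_) (sq_nonneg L)
    nlinarith [sq_nonneg D, sq_nonneg Λ, mul_nonneg (sq_nonneg D) (Real.exp_pos (ε * a)).le,
      mul_nonneg (sq_nonneg Λ) (sq_nonneg e)]
  · intro t ht
    obtain ⟨h1, h2⟩ := hpos t ht.1
    have hP := C.P_pos (C.flow t v')
    obtain ⟨c1, c2⟩ := hclose t ht
    have e0 : 0 ≤ e := (abs_nonneg _).trans c1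
    set P₁ := C.P (C.flow t v)
    set P₂ := C.P (C.flow t v')
    set k₁ := C.q (C.flow t v) - C.p (C.flow t v)
    set k₂ := C.q (C.flow t v') - C.p (C.flow t v')
    have m1 := mul_sq_log_sub_log_le he (hr t ht.1).1 (hr' t ht.1).1
    have m2 : δ t * (1 / r t - 1 / r' t) ≤ 0 := by
      rcases le_total (r t) (r' t) with h | h
      · exact mul_nonpos_of_nonpos_of_nonneg (sub_nonpos.2 (Real.log_le_log h1 h))
          (sub_nonneg.2 (one_div_le_one_div_of_le h1 h))
      · exact mul_nonpos_of_nonneg_of_nonpos (sub_nonneg.2 (Real.log_le_log h2 h))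
          (sub_nonpos.2 (one_div_le_one_div_of_le h2 h))
    have e1 : (P₁ + k₁ * r t - r t ^ 2) / r t - (P₂ + k₂ * r' t - r' t ^ 2) / r' t
        = ((P₁ - P₂) / r t + (k₁ - k₂)) + P₂ * (1 / r t - 1 / r' t) - (r t - r' t) := by
      field_simp
      ring
    have m3 : |(P₁ - P₂) / r t + (k₁ - k₂)| ≤ D * e * ε := by
      have h3 : |(P₁ - P₂) / r t| ≤ e / ε := by
        rw [abs_div, abs_of_pos h1]
        exact div_le_div₀ e0 c1 he (hr t ht.1).1
      have h4 : D * e * ε = e / ε + e := by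
        simp only [D]
        field_simp
      rw [h4]
      exact (abs_add_le _ _).trans (add_le_add h3 c2)
    have m4 : 2 * δ t * ((P₁ - P₂) / r t + (k₁ - k₂)) ≤ ε * δ t ^ 2 + ε * (D * e) ^ 2 := by
      have h5 : δ t * ((P₁ - P₂) / r t + (k₁ - k₂)) ≤ |δ t| * (D * e * ε) :=
        (le_abs_self _).trans (by rw [abs_mul]; gcongr)
      nlinarith [sq_nonneg (|δ t| - D * e), sq_abs (δ t)]
    have m5 : P₂ * (δ t * (1 / r t - 1 / r' t)) ≤ 0 := mul_nonpos_of_nonneg_of_nonpos hP.le m2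
    rw [e1]
    have m1' : ε * δ t ^ 2 ≤ δ t * (r t - r' t) := m1
    nlinarith
  · have l1 := Real.log_le_log he (hr a le_rfl).1
    have l2 := Real.log_le_log (hpos a le_rfl).1 (hr a le_rfl).2.1
    have l3 := Real.log_le_log he (hr' a le_rfl).1
    have l4 := Real.log_le_log (hpos a le_rfl).2 (hr' a le_rfl).2.1
    have : δ a ^ 2 ≤ Λ ^ 2 := by
      refine sq_le_sq' ?_ ?_ <;> simp only [δ, Λ] <;> linarith
    simp only [sub_self, mul_zero, Real.exp_zero, mul_one]
    nlinarith [sq_nonneg (D * e)]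

end PositiveSystem

/-! ### Invariant slopes of a positive system. -/

namespace PositiveSystem

open Filter

variable {S : Type*} [TopologicalSpace S] {C : PositiveSystem S} {ε L : ℝ}

/-- Along one orbit the perturbation `e` is zero, so trapped solutions started at time `a ≤ 0` agree
at time `0` up to `A exp(ε a)` in the square. Hence the values for starting times `-n` form a Cauchy
sequence, and every other choice of trapped solutions has the same limit. -/
theorem exists_limit_isRiccati (hT : C.IsTrap ε L) : ∃ (R : S → ℝ) (A : ℝ), 0 ≤ A ∧
    (∀ v, ε ≤ R v ∧ R v ≤ L) ∧
    (∀ v a r, a ≤ 0 → C.IsRiccati ε L v a r → (r 0 - R v) ^ 2 ≤ A * Real.exp (ε * a)) := by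
  obtain ⟨A, hA, hcomp⟩ := sq_sub_le_of_isRiccati hT
  have hself : ∀ (v : S) (a : ℝ) (r r' : ℝ → ℝ), a ≤ 0 → C.IsRiccati ε L v a r →
      C.IsRiccati ε L v a r' → (r 0 - r' 0) ^ 2 ≤ A * Real.exp (ε * a) := by
    intro v a r r' ha hr hr'
    have := hcomp v v a 0 r r' ha hr hr' (by simp)
    simpa using this
  choose r hr using fun (v : S) (n : ℕ) => exists_isRiccati hT v (-(n : ℝ))
  have hn0 : ∀ n : ℕ, -(n : ℝ) ≤ 0 := fun n => by simp
  have htend : Tendsto (fun n : ℕ => √(A * Real.exp (ε * -(n : ℝ)))) atTop (𝓝 0) := by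
    have h1 : Tendsto (fun n : ℕ => ε * -(n : ℝ)) atTop atBot :=
      (tendsto_neg_atTop_atBot.comp tendsto_natCast_atTop_atTop).const_mul_atBot hT.1
    have h2 := ((Real.tendsto_exp_atBot.comp h1).const_mul A).sqrt
    simpa using h2
  have hcau : ∀ v, CauchySeq fun n => r v n 0 := by
    intro v
    refine cauchySeq_of_le_tendsto_0 _ (fun n m N hn hm => ?_) htend
    have hn' : -(n : ℝ) ≤ -(N : ℝ) := neg_le_neg (by exact_mod_cast hn)
    have hm' : -(m : ℝ) ≤ -(N : ℝ) := neg_le_neg (by exact_mod_cast hm)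
    exact Real.abs_le_sqrt (hself v _ _ _ (hn0 N) ((hr v n).mono hn') ((hr v m).mono hm'))
  choose R hR using fun v => cauchySeq_tendsto_of_complete (hcau v)
  refine ⟨R, A, hA, fun v => ⟨ge_of_tendsto' (hR v) fun n => (hr v n 0 (hn0 n)).1,
    le_of_tendsto' (hR v) fun n => (hr v n 0 (hn0 n)).2.1⟩, ?_⟩
  intro v a s ha hs
  refine le_of_tendsto ((tendsto_const_nhds.sub (hR v)).pow 2) ?_
  obtain ⟨N, hN⟩ := exists_nat_ge (-a)
  filter_upwards [eventually_ge_atTop N] with n hn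
  have : -(n : ℝ) ≤ a := by
    have : (N : ℝ) ≤ n := by exact_mod_cast hn
    linarith
  exact hself v a s _ ha hs ((hr v n).mono this)

/-- Orbits depend continuously on the initial point, uniformly over a compact time interval. -/
theorem eventually_close {f : S → ℝ} (hf : Continuous f) (C : PositiveSystem S) (v₀ : S) (a : ℝ)
    {e : ℝ} (he : 0 < e) :
    ∀ᶠ v in 𝓝 v₀, ∀ t ∈ Icc a 0, |f (C.flow t v) - f (C.flow t v₀)| ≤ e := by
  refine isCompact_Icc.eventually_forall_of_forall_eventually fun t _ => ?_
  have hc : Continuous fun x : S × ℝ => |f (C.flow x.2 x.1) - f (C.flow x.2 v₀)| := by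
    have h1 : Continuous fun x : S × ℝ => f (C.flow x.2 x.1) :=
      hf.comp (C.continuous_flow.comp (continuous_snd.prodMk continuous_fst))
    have h2 : Continuous fun x : S × ℝ => f (C.flow x.2 v₀) :=
      hf.comp ((C.continuous_orbit v₀).comp continuous_snd)
    exact (h1.sub h2).abs
  have h0 : (fun x : S × ℝ => |f (C.flow x.2 x.1) - f (C.flow x.2 v₀)|) (v₀, t) < e := by
    simpa using he
  exact (hc.continuousAt.eventually_lt_const h0).mono fun x hx => hx.le

/-- The slope of the unstable line of a positive system. -/
theorem exists_unstable_slope [CompactSpace S] (C : PositiveSystem S) :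
    ∃ (R : S → ℝ) (ε L : ℝ), 0 < ε ∧ Continuous R ∧ (∀ v, ε ≤ R v ∧ R v ≤ L) ∧
      ∀ v y w, C.IsSolution v y w → w 0 = R v * y 0 → ∀ t, w t = R (C.flow t v) * y t := by
  obtain ⟨ε, L, hT⟩ := C.exists_isTrap
  obtain ⟨R, A, hA, hRb, hR⟩ := exists_limit_isRiccati hT
  obtain ⟨A', hA', hcomp⟩ := sq_sub_le_of_isRiccati hT
  refine ⟨R, ε, L, hT.1, ?_, hRb, ?_⟩
  · rw [continuous_iff_continuousAt]
    intro v₀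
    rw [Metric.continuousAt_iff']
    intro η hη
    have htend : Tendsto (fun a : ℝ => 2 * √(A * Real.exp (ε * a)) +
        √(A' * (Real.exp (ε * a) ^ 2 + Real.exp (ε * a)))) atBot (𝓝 0) := by
      have h1 : Tendsto (fun a : ℝ => Real.exp (ε * a)) atBot (𝓝 0) :=
        Real.tendsto_exp_atBot.comp (tendsto_id.const_mul_atBot hT.1)
      have h2 := ((h1.const_mul A).sqrt.const_mul 2).add (((h1.pow 2).add h1).const_mul A').sqrt
      simpa using h2
    -- With `e = exp(ε a)` one parameter controls all three errors: the two distances from the limit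
    -- slopes, and the distance between the Riccati solutions along the two orbits.
    obtain ⟨a, ha, ha0⟩ := ((htend.eventually (gt_mem_nhds hη)).and
      (eventually_le_atBot (0 : ℝ))).exists
    filter_upwards [eventually_close C.continuous_P C v₀ a (Real.exp_pos (ε * a)),
      eventually_close (C.continuous_q.sub C.continuous_p) C v₀ a (Real.exp_pos (ε * a))]
      with v h1 h2
    obtain ⟨r, hr⟩ := exists_isRiccati hT v a
    obtain ⟨r₀, hr₀⟩ := exists_isRiccati hT v₀ a
    have k1 := Real.abs_le_sqrt (hR v a r ha0 hr)
    have k2 := Real.abs_le_sqrt (hR v₀ a r₀ ha0 hr₀)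
    have k3 := Real.abs_le_sqrt (hcomp v v₀ a _ r r₀ ha0 hr hr₀ fun t ht => ⟨h1 t ht, h2 t ht⟩)
    rw [Real.dist_eq]
    calc |R v - R v₀| = |-(r 0 - R v) + (r 0 - r₀ 0) + (r₀ 0 - R v₀)| := by congr 1; ring
      _ ≤ |r 0 - R v| + |r 0 - r₀ 0| + |r₀ 0 - R v₀| := by
        refine (abs_add_le _ _).trans (add_le_add ((abs_add_le _ _).trans ?_) le_rfl)
        rw [abs_neg]
      _ < η := by linarith
  · intro v y w hyw h0 t
    obtain ⟨Bp, hBp, hp⟩ := exists_bound C.continuous_q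
    -- For a Riccati solution `r` started at `-n`, the defect `w - r y` obeys `d' = (q - r) d`, so
    -- from time `0` to the fixed time `t` it grows by a factor independent of `n`. As `n → ∞`, `r`
    -- tends to `R` at both times, and the defect of `R` must vanish.
    have hbound : ∀ n : ℕ, |t| ≤ n → |w t - R (C.flow t v) * y t| ≤
        Real.exp ((Bp + L) * |t|) * (√(A * Real.exp (ε * -(n : ℝ))) * |y 0|) +
          √(A * Real.exp (ε * (-(n : ℝ) - t))) * |y t| := by
      intro n hn
      obtain ⟨n1, n2⟩ := abs_le.1 hn
      have hn0 : -(n : ℝ) ≤ 0 := by simp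
      obtain ⟨r, hr⟩ := exists_isRiccati hT v (-(n : ℝ))
      have hd : ∀ s ≥ -(n : ℝ), HasDerivAt (fun s => w s - r s * y s)
          ((C.q (C.flow s v) - r s) * (w s - r s * y s)) s := by
        intro s hs
        refine ((hyw s).2.sub ((hr s hs).2.2.mul (hyw s).1)).congr_deriv ?_
        ring
      have hc : ∀ s ≥ -(n : ℝ), |C.q (C.flow s v) - r s| ≤ Bp + L := by
        intro s hs
        have h1 := abs_le.1 (hp (C.flow s v))
        have h2 := hr s hs
        have := hT.1
        rw [abs_le]
        constructor <;> linarith [h2.1, h2.2.1]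
      have h1 := abs_le_exp_mul_abs hc hd hn0 n1
      rw [sub_zero] at h1
      have h2 : |w 0 - r 0 * y 0| ≤ √(A * Real.exp (ε * -(n : ℝ))) * |y 0| := by
        rw [h0, ← sub_mul, abs_mul, abs_sub_comm]
        exact mul_le_mul_of_nonneg_right (Real.abs_le_sqrt (hR v _ r hn0 hr)) (abs_nonneg _)
      have h3 : C.IsRiccati ε L (C.flow t v) (-(n : ℝ) - t) (fun s => r (s + t)) := by
        have : C.IsRiccati ε L (C.flow (-t) (C.flow t v)) (-(n : ℝ)) r := by
          rw [← C.flow_add, neg_add_cancel, C.flow_zero]; exact hr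
        have := this.shift
        simpa [sub_neg_eq_add, sub_eq_add_neg] using this
      have h4 := Real.abs_le_sqrt (hR _ _ _ (by linarith) h3)
      simp only [zero_add] at h4
      calc |w t - R (C.flow t v) * y t|
          = |(w t - r t * y t) + (r t - R (C.flow t v)) * y t| := by congr 1; ring
        _ ≤ |w t - r t * y t| + |r t - R (C.flow t v)| * |y t| := by
          rw [← abs_mul]; exact abs_add_le _ _
        _ ≤ _ := by gcongr; exact h1.trans (by gcongr)
    have hl : Tendsto (fun n : ℕ => Real.exp ((Bp + L) * |t|) *
        (√(A * Real.exp (ε * -(n : ℝ))) * |y 0|) +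
          √(A * Real.exp (ε * (-(n : ℝ) - t))) * |y t|) atTop (𝓝 0) := by
      have h1 : Tendsto (fun n : ℕ => -(n : ℝ)) atTop atBot :=
        tendsto_neg_atTop_atBot.comp tendsto_natCast_atTop_atTop
      have h2 : Tendsto (fun n : ℕ => ε * -(n : ℝ)) atTop atBot := h1.const_mul_atBot hT.1
      have h3 : Tendsto (fun n : ℕ => ε * (-(n : ℝ) - t)) atTop atBot :=
        (tendsto_atBot_add_const_right _ (-t) h1).const_mul_atBot hT.1
      have h4 := ((((Real.tendsto_exp_atBot.comp h2).const_mul A).sqrt.mul_const |y 0|).const_mul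
        (Real.exp ((Bp + L) * |t|))).add
        (((Real.tendsto_exp_atBot.comp h3).const_mul A).sqrt.mul_const |y t|)
      simpa using h4
    obtain ⟨N, hN⟩ := exists_nat_ge |t|
    have h5 : |w t - R (C.flow t v) * y t| ≤ 0 := by
      refine ge_of_tendsto hl ?_
      filter_upwards [eventually_ge_atTop N] with n hn
      exact hbound n (hN.trans (by exact_mod_cast hn))
    exact sub_eq_zero.1 (abs_nonpos_iff.1 h5)

/-- The system with time reversed. -/
def reverse (C : PositiveSystem S) : PositiveSystem S where
  flow t v := C.flow (-t) v
  flow_zero v := by rw [neg_zero, C.flow_zero]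
  flow_add s t v := by rw [neg_add, C.flow_add]
  continuous_flow := C.continuous_flow.comp
    (by fun_prop : Continuous fun x : ℝ × S => (-x.1, x.2))
  p v := -C.p v
  q v := -C.q v
  P := C.P
  continuous_p := C.continuous_p.neg
  continuous_q := C.continuous_q.neg
  continuous_P := C.continuous_P
  P_pos := C.P_pos
  exists_solution v y₀ w₀ := by
    obtain ⟨y, w, hy, hw, h⟩ := C.exists_solution v y₀ (-w₀)
    -- Changing the sign of `w` along with that of time keeps the coefficient of `w` in the first
    -- equation equal to `1` and leaves `P` unchanged.
    refine ⟨fun t => y (-t), fun t => -w (-t), by simpa using hy, by simp [hw], fun t => ?_⟩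
    refine ⟨((h (-t)).1.scomp t (hasDerivAt_neg t)).congr_deriv ?_,
      ((h (-t)).2.scomp t (hasDerivAt_neg t)).neg.congr_deriv ?_⟩
    · simp; ring
    · simp

theorem IsSolution.reverse {v : S} {y w : ℝ → ℝ} (h : C.IsSolution v y w) :
    C.reverse.IsSolution v (fun t => y (-t)) (fun t => -w (-t)) := by
  intro t
  refine ⟨((h (-t)).1.scomp t (hasDerivAt_neg t)).congr_deriv ?_,
      ((h (-t)).2.scomp t (hasDerivAt_neg t)).neg.congr_deriv ?_⟩
  · simp [PositiveSystem.reverse]; ring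
  · simp [PositiveSystem.reverse]

/-- The slope of the stable line of a positive system. -/
theorem exists_stable_slope [CompactSpace S] (C : PositiveSystem S) :
    ∃ (R : S → ℝ) (ε L : ℝ), 0 < ε ∧ Continuous R ∧ (∀ v, ε ≤ -R v ∧ -R v ≤ L) ∧
      ∀ v y w, C.IsSolution v y w → w 0 = R v * y 0 → ∀ t, w t = R (C.flow t v) * y t := by
  obtain ⟨R, ε, L, hε, hc, hb, h⟩ := C.reverse.exists_unstable_slope
  refine ⟨fun v => -R v, ε, L, hε, hc.neg, fun v => by simpa using hb v, ?_⟩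
  intro v y w hyw h0 t
  have := h v _ _ hyw.reverse (by simp [h0]) (-t)
  simp only [neg_neg] at this
  have h2 : C.reverse.flow (-t) v = C.flow t v := by simp [PositiveSystem.reverse]
  rw [h2] at this
  linarith

end PositiveSystem

/-! ### Domination and contraction along the invariant lines. -/

namespace PositiveSystem

open Filter

variable {S : Type*} [TopologicalSpace S] {C : PositiveSystem S} {ε L : ℝ}

theorem IsSolution.shift {v : S} {t : ℝ} {y w : ℝ → ℝ} (h : C.IsSolution (C.flow t v) y w) :
    C.IsSolution v (fun s => y (s - t)) (fun s => w (s - t)) := by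
  intro s
  have h1 := h (s - t)
  rw [← C.flow_add, sub_add_cancel] at h1
  exact ⟨h1.1.comp_sub_const s t, h1.2.comp_sub_const s t⟩

theorem IsSolution.hasDerivAt_fst {R : S → ℝ} {v : S} {y w : ℝ → ℝ} (h : C.IsSolution v y w)
    (hR : ∀ t, w t = R (C.flow t v) * y t) (t : ℝ) :
    HasDerivAt y ((C.p (C.flow t v) + R (C.flow t v)) * y t) t := by
  refine (h t).1.congr_deriv ?_
  rw [hR t]
  ring

/-- The unstable line dominates the stable line. -/
theorem abs_mul_abs_le {Ru Rs : S → ℝ} (hRu : Continuous Ru) (hRs : Continuous Rs)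
    {κ : ℝ} (hκ : ∀ v, Rs v - Ru v ≤ -κ) {v : S} {t : ℝ} (ht : 0 ≤ t) {y w y' w' : ℝ → ℝ}
    (h : C.IsSolution v y w) (h' : C.IsSolution (C.flow t v) y' w')
    (hs : ∀ s, w s = Rs (C.flow s v) * y s)
    (hu : ∀ s, w' s = Ru (C.flow s (C.flow t v)) * y' s) :
    |y t| * |y' (-t)| ≤ Real.exp (-κ * t) * (|y 0| * |y' 0|) := by
  have horb := C.continuous_orbit v
  have hcs : Continuous fun s => C.p (C.flow s v) + Rs (C.flow s v) :=
    (C.continuous_p.comp horb).add (hRs.comp horb)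
  have hcu : Continuous fun s => C.p (C.flow s v) + Ru (C.flow s v) :=
    (C.continuous_p.comp horb).add (hRu.comp horb)
  have e1 := eq_mul_exp_integral hcs (h.hasDerivAt_fst hs) t
  have hu' : ∀ s, w' (s - t) = Ru (C.flow s v) * y' (s - t) := by
    intro s
    have := hu (s - t)
    rwa [← C.flow_add, sub_add_cancel] at this
  have e2 := eq_mul_exp_integral hcu (h'.shift.hasDerivAt_fst hu') t
  simp only [sub_self, zero_sub] at e2
  rw [e1, e2, abs_mul, abs_mul, Real.abs_exp, Real.abs_exp]
  have hint : (∫ s in (0 : ℝ)..t, (C.p (C.flow s v) + Rs (C.flow s v))) ≤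
      -κ * t + ∫ s in (0 : ℝ)..t, (C.p (C.flow s v) + Ru (C.flow s v)) := by
    have h1 : -κ * t = ∫ _ in (0 : ℝ)..t, -κ := by simp [mul_comm]
    rw [h1, ← intervalIntegral.integral_add (by simp) (hcu.intervalIntegrable _ _)]
    refine intervalIntegral.integral_mono_on ht (hcs.intervalIntegrable _ _)
      ((continuous_const.add hcu).intervalIntegrable _ _) fun s _ => ?_
    linarith [hκ (C.flow s v)]
  have h3 := Real.exp_le_exp.2 hint
  rw [Real.exp_add] at h3
  calc _ = Real.exp (∫ s in (0 : ℝ)..t, (C.p (C.flow s v) + Rs (C.flow s v))) *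
        (|y 0| * |y' (-t)|) := by ring
    _ ≤ (Real.exp (-κ * t) * Real.exp (∫ s in (0 : ℝ)..t, (C.p (C.flow s v) + Ru (C.flow s v)))) *
        (|y 0| * |y' (-t)|) := by gcongr
    _ = _ := by ring

/-- If the coefficients satisfy a discriminant condition, then the stable line is contracted. -/
theorem exists_stable_decay {R : S → ℝ} (hε : 0 < ε) (hRc : Continuous R)
    (hR : ∀ v, ε ≤ -R v ∧ -R v ≤ L)
    (hinv : ∀ v y w, C.IsSolution v y w → w 0 = R v * y 0 → ∀ t, w t = R (C.flow t v) * y t)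
    {k : ℝ} (hk : 0 < k) (hq : ∀ v, C.q v = C.p v) (hP : ∀ v, C.p v ^ 2 + k ≤ C.P v) :
    ∃ K κ : ℝ, 0 < K ∧ 0 < κ ∧ ∀ v, ∀ t ≥ 0,
      Real.exp (∫ s in (0 : ℝ)..t, (C.p (C.flow s v) + R (C.flow s v))) ≤
        K * Real.exp (-κ * t) := by
  rcases isEmpty_or_nonempty S with hS | ⟨⟨v₀⟩⟩
  · exact ⟨1, 1, one_pos, one_pos, fun v => isEmptyElim v⟩
  have hL : 0 < L := hε.trans_le ((hR v₀).1.trans (hR v₀).2)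
  refine ⟨√(L / ε), k / L / 2, Real.sqrt_pos.2 (by positivity), by positivity, fun v t ht => ?_⟩
  -- The solution on the stable line with `y(0) = 1` is itself the exponential to be estimated. The
  -- inequality `-y w ≤ L exp(-(k / L) t)` and `-y w ≥ ε y²` then give the constants `√(L / ε)` and
  -- `k / L / 2`.
  obtain ⟨y, w, hy0, hw0, hyw⟩ := C.exists_solution v 1 (R v)
  have hw := hinv v y w hyw (by rw [hy0, hw0, mul_one])
  have horb := C.continuous_orbit v
  have e1 := eq_mul_exp_integral ((C.continuous_p.comp horb).add (hRc.comp horb))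
    (IsSolution.hasDerivAt_fst hyw hw) t
  rw [hy0, one_mul] at e1
  simp only [Pi.add_apply, Function.comp] at e1
  rw [← e1]
  have hexp : ∀ s, HasDerivAt (fun s => Real.exp (-(k / L) * s))
      (Real.exp (-(k / L) * s) * -(k / L)) s := by
    intro s
    simpa using ((hasDerivAt_id s).const_mul (-(k / L))).exp
  have hQ : ∀ s, y s * w s = R (C.flow s v) * y s ^ 2 := fun s => by rw [hw s]; ring
  have key := nonneg_of_deriv_ge (f := fun s => L * Real.exp (-(k / L) * s) + y s * w s)
    (c := fun _ => -(k / L)) ht continuousOn_const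
    (fun s _ => ((hexp s).const_mul L).add ((hyw s).1.mul (hyw s).2)) ?_ ?_
  · have h1 : ε * y t ^ 2 ≤ L * Real.exp (-(k / L) * t) := by
      rw [hQ t] at key
      nlinarith [(hR (C.flow t v)).1, sq_nonneg (y t)]
    have h2 : y t ^ 2 ≤ (√(L / ε) * Real.exp (-(k / L / 2) * t)) ^ 2 := by
      rw [mul_pow, Real.sq_sqrt (by positivity), ← Real.exp_nat_mul]
      have : ((2 : ℕ) : ℝ) * (-(k / L / 2) * t) = -(k / L) * t := by push_cast; ring
      rw [this, div_mul_eq_mul_div, le_div_iff₀ hε]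
      linarith
    exact (abs_le_of_sq_le_sq' h2 (by positivity)).2
  · intro s _
    have h1 := hP (C.flow s v)
    rw [hq]
    set p := C.p (C.flow s v)
    set P := C.P (C.flow s v)
    -- Since `q = p`, the right side is `(p y + w)² + (P - p²) y²`.
    have h2 : k * y s ^ 2 ≤ (p * y s + w s) * w s + y s * (P * y s + p * w s) := by
      nlinarith [sq_nonneg (p * y s + w s), mul_nonneg (sub_nonneg.2 h1) (sq_nonneg (y s))]
    have h3 : -(y s * w s) ≤ L * y s ^ 2 := by
      rw [hQ s]
      nlinarith [(hR (C.flow s v)).2, sq_nonneg (y s)]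
    have h4 : -(k / L) * (y s * w s) ≤ k * y s ^ 2 := by
      have := mul_le_mul_of_nonneg_left h3 (div_pos hk hL).le
      calc -(k / L) * (y s * w s) = k / L * -(y s * w s) := by ring
        _ ≤ k / L * (L * y s ^ 2) := this
        _ = k * y s ^ 2 := by field_simp
    linarith
  · rw [mul_zero, Real.exp_zero, hy0, hw0]
    linarith [(hR v).2]

/-- Graph of the stable line over the reduced system, for an additional equation `x' = a y`. -/
theorem exists_stable_lift [CompactSpace S] (C : PositiveSystem S) {a c : S → ℝ}
    (ha : Continuous a) (hc : Continuous c) {K κ : ℝ} (hK : 0 < K) (hκ : 0 < κ)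
    (hdecay : ∀ v, ∀ t ≥ 0, Real.exp (∫ s in (0 : ℝ)..t, c (C.flow s v)) ≤ K * Real.exp (-κ * t)) :
    ∃ ℓ : S → ℝ, Continuous ℓ ∧ ∀ v (x y : ℝ → ℝ),
      (∀ t, HasDerivAt x (a (C.flow t v) * y t) t) →
      (∀ t, HasDerivAt y (c (C.flow t v) * y t) t) → x 0 = ℓ v * y 0 →
      ∀ t, x t = ℓ (C.flow t v) * y t := by
  obtain ⟨B, hB0, hB⟩ := exists_bound ha
  -- If `y' = c y` and `x' = a y`, then `y = y(0) E` and `x = x(0) + y(0) F`. The decay of `E` makes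
  -- `F` converge uniformly in `v`, which is why the limit is continuous.
  let E : S → ℝ → ℝ := fun v t => Real.exp (∫ s in (0 : ℝ)..t, c (C.flow s v))
  let F : S → ℝ → ℝ := fun v t => ∫ s in (0 : ℝ)..t, a (C.flow s v) * E v s
  have hflow : Continuous fun x : S × ℝ => C.flow x.2 x.1 :=
    C.continuous_flow.comp (continuous_snd.prodMk continuous_fst)
  have hE : Continuous fun x : S × ℝ => E x.1 x.2 := by
    refine Real.continuous_exp.comp ?_
    refine intervalIntegral.continuous_parametric_intervalIntegral_of_continuous
      (f := fun (x : S × ℝ) s => c (C.flow s x.1)) ?_ continuous_snd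
    exact hc.comp (hflow.comp (by fun_prop : Continuous fun x : (S × ℝ) × ℝ => (x.1.1, x.2)))
  have hf : Continuous fun x : S × ℝ => a (C.flow x.2 x.1) * E x.1 x.2 :=
    (ha.comp hflow).mul hE
  have hfv : ∀ v, Continuous fun s => a (C.flow s v) * E v s := fun v =>
    hf.comp (by fun_prop : Continuous fun s : ℝ => (v, s))
  have hF : ∀ t, Continuous fun v => F v t := fun t =>
    intervalIntegral.continuous_parametric_intervalIntegral_of_continuous'
      (f := fun v s => a (C.flow s v) * E v s) hf 0 t
  set D := B * K / κ with hD
  have hD0 : 0 ≤ D := by positivity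
  have htail : ∀ v s t, 0 ≤ s → s ≤ t → |F v t - F v s| ≤ D * Real.exp (-κ * s) := by
    intro v s t hs hst
    have hexp : ∀ r, HasDerivAt (fun r => -D * Real.exp (-κ * r)) (B * K * Real.exp (-κ * r)) r := by
      intro r
      have := (((hasDerivAt_id r).const_mul (-κ)).exp).const_mul (-D)
      refine this.congr_deriv ?_
      simp only [hD, id]
      field_simp
    have h1 : F v t - F v s = ∫ r in s..t, a (C.flow r v) * E v r :=
      intervalIntegral.integral_interval_sub_left ((hfv v).intervalIntegrable _ _)
        ((hfv v).intervalIntegrable _ _)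
    have hcont : Continuous fun r => B * K * Real.exp (-κ * r) := by fun_prop
    rw [h1, ← Real.norm_eq_abs]
    refine (intervalIntegral.norm_integral_le_of_norm_le hst
      (g := fun r => B * K * Real.exp (-κ * r)) (Filter.Eventually.of_forall ?_)
      (hcont.intervalIntegrable _ _)).trans ?_
    · intro r hr
      rw [Real.norm_eq_abs, abs_mul, Real.abs_exp, mul_assoc]
      exact mul_le_mul (hB _) (hdecay v r (hs.trans hr.1.le)) (Real.exp_pos _).le hB0
    · rw [intervalIntegral.integral_eq_sub_of_hasDerivAt (fun r _ => hexp r)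
        (hcont.intervalIntegrable _ _)]
      have := mul_nonneg hD0 (Real.exp_pos (-κ * t)).le
      linarith
  have hlim0 : Tendsto (fun t : ℝ => D * Real.exp (-κ * t)) atTop (𝓝 0) := by
    have h1 : Tendsto (fun t : ℝ => -κ * t) atTop atBot :=
      tendsto_id.const_mul_atTop_of_neg (neg_lt_zero.2 hκ)
    simpa using (Real.tendsto_exp_atBot.comp h1).const_mul D
  have hcau : ∀ v, CauchySeq fun n : ℕ => F v n := by
    intro v
    refine cauchySeq_of_le_tendsto_0' (fun n : ℕ => D * Real.exp (-κ * n)) (fun n m hnm => ?_)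
      (hlim0.comp tendsto_natCast_atTop_atTop)
    rw [dist_comm]
    exact htail v n m (Nat.cast_nonneg n) (by exact_mod_cast hnm)
  choose ℓ hℓ using fun v => cauchySeq_tendsto_of_complete (hcau v)
  have hbound : ∀ v t, 0 ≤ t → |ℓ v - F v t| ≤ D * Real.exp (-κ * t) := by
    intro v t ht
    refine le_of_tendsto ((hℓ v).sub_const (F v t)).abs ?_
    obtain ⟨N, hN⟩ := exists_nat_ge t
    filter_upwards [eventually_ge_atTop N] with n hn
    exact htail v t n ht (hN.trans (by exact_mod_cast hn))
  have hℓc : Continuous ℓ := by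
    have hu : TendstoUniformly (fun (n : ℕ) v => F v n) ℓ atTop := by
      rw [Metric.tendstoUniformly_iff]
      intro e he
      filter_upwards [(hlim0.comp tendsto_natCast_atTop_atTop).eventually (gt_mem_nhds he)]
        with n hn v
      exact (hbound v n (Nat.cast_nonneg n)).trans_lt hn
    exact hu.continuous (Filter.Eventually.of_forall fun n : ℕ => hF n).frequently
  have hℓt : ∀ v, Tendsto (F v) atTop (𝓝 (ℓ v)) := by
    intro v
    rw [tendsto_iff_dist_tendsto_zero]
    refine squeeze_zero' (Filter.Eventually.of_forall fun t => dist_nonneg) ?_ hlim0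
    filter_upwards [eventually_ge_atTop 0] with t ht
    rw [dist_comm]
    exact hbound v t ht
  have hx : ∀ v (x y : ℝ → ℝ), (∀ t, HasDerivAt x (a (C.flow t v) * y t) t) →
      (∀ t, HasDerivAt y (c (C.flow t v) * y t) t) →
      Tendsto x atTop (𝓝 (x 0 + y 0 * ℓ v)) := by
    intro v x y hx hy
    have hy' := eq_mul_exp_integral (hc.comp (C.continuous_orbit v)) hy
    have h1 : x = fun t => x 0 + y 0 * F v t := by
      funext t
      have hfc : Continuous fun t => a (C.flow t v) * y t :=
        (ha.comp (C.continuous_orbit v)).mul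
          (continuous_iff_continuousAt.2 fun t => (hy t).continuousAt)
      have h2 := intervalIntegral.integral_eq_sub_of_hasDerivAt (fun t _ => hx t)
        (hfc.intervalIntegrable 0 t)
      have h3 : y 0 * F v t = ∫ s in (0 : ℝ)..t, a (C.flow s v) * y s := by
        rw [← intervalIntegral.integral_const_mul]
        refine intervalIntegral.integral_congr fun s _ => ?_
        rw [hy' s]
        simp only [E, Function.comp]
        ring
      rw [h3, h2]
      ring
    rw [h1]
    have h4 : F v 0 = 0 := intervalIntegral.integral_same
    simp only [h4, mul_zero, add_zero]
    exact ((hℓt v).const_mul (y 0)).const_add (x 0)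
  -- The limit of `x` is `x(0) + y(0) ℓ(v)`, so the line with slope `-ℓ` consists of the solutions
  -- with `x → 0`. Shifting time does not change the limit; this is the invariance.
  refine ⟨fun v => -ℓ v, hℓc.neg, fun v x y hxd hyd h0 t => ?_⟩
  have h1 := hx v x y hxd hyd
  have h2 := hx (C.flow t v) (fun s => x (s + t)) (fun s => y (s + t))
    (fun s => by
      have := (hxd (s + t)).comp_add_const s t
      rwa [C.flow_add] at this)
    (fun s => by
      have := (hyd (s + t)).comp_add_const s t
      rwa [C.flow_add] at this)
  have h3 := h1.comp (tendsto_atTop_add_const_right atTop t tendsto_id)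
  have h4 := tendsto_nhds_unique h2 h3
  simp only [zero_add] at h4
  linarith

end PositiveSystem

namespace PositiveSystem

variable {S : Type*} [TopologicalSpace S]

/-- If the coefficients satisfy a discriminant condition, then the stable line is contracted, also
after adding an equation `x' = a y`. -/
theorem exists_contracted_line [CompactSpace S] (C : PositiveSystem S) {a : S → ℝ}
    (ha : Continuous a) {k : ℝ} (hk : 0 < k) (hq : ∀ v, C.q v = C.p v)
    (hP : ∀ v, C.p v ^ 2 + k ≤ C.P v) :
    ∃ (R ℓ : S → ℝ) (K κ : ℝ), Continuous R ∧ Continuous ℓ ∧ (∀ v, R v < 0) ∧ 0 < K ∧ 0 < κ ∧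
      ∀ v (x y w : ℝ → ℝ), C.IsSolution v y w → (∀ t, HasDerivAt x (a (C.flow t v) * y t) t) →
      x 0 = ℓ v * y 0 → w 0 = R v * y 0 → ∀ t, x t = ℓ (C.flow t v) * y t ∧
        w t = R (C.flow t v) * y t ∧ (0 ≤ t → |y t| ≤ K * Real.exp (-κ * t) * |y 0|) := by
  obtain ⟨R, ε, L, hε, hRc, hR, hinv⟩ := C.exists_stable_slope
  obtain ⟨K, κ, hK, hκ, hdecay⟩ := exists_stable_decay hε hRc hR hinv hk hq hP
  obtain ⟨ℓ, hℓ, hlift⟩ := C.exists_stable_lift ha (C.continuous_p.add hRc) hK hκ hdecay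
  refine ⟨R, ℓ, K, κ, hRc, hℓ, fun v => by linarith [(hR v).1], hK, hκ, ?_⟩
  intro v x y w hyw hx hx0 hw0 t
  have hw := hinv v y w hyw hw0
  have hy := IsSolution.hasDerivAt_fst hyw hw
  refine ⟨hlift v x y hx hy hx0 t, hw t, fun ht => ?_⟩
  rw [eq_mul_exp_integral ((C.continuous_p.add hRc).comp (C.continuous_orbit v)) hy t, abs_mul,
    Real.abs_exp, mul_comm]
  exact mul_le_mul_of_nonneg_right (hdecay v t ht) (abs_nonneg _)

end PositiveSystem

/-! ### Lines in coordinate spaces -/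

theorem mem_span_slope {s : ℝ} {x : EuclideanSpace ℝ (Fin 2)} :
    x ∈ Submodule.span ℝ {(!₂[1, s] : EuclideanSpace ℝ (Fin 2))} ↔ x 1 = s * x 0 := by
  rw [Submodule.mem_span_singleton]
  constructor
  · rintro ⟨c, rfl⟩
    simp [mul_comm]
  · intro h
    refine ⟨x 0, ?_⟩
    ext i
    fin_cases i
    · simp
    · simp [h, mul_comm]

theorem isCompl_span_slope {s s' : ℝ} (h : s ≠ s') :
    IsCompl (Submodule.span ℝ {(!₂[1, s] : EuclideanSpace ℝ (Fin 2))})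
      (Submodule.span ℝ {(!₂[1, s'] : EuclideanSpace ℝ (Fin 2))}) := by
  have h' : s - s' ≠ 0 := sub_ne_zero.2 h
  constructor
  · rw [Submodule.disjoint_def]
    intro x hx hx'
    rw [mem_span_slope] at hx hx'
    have h0 : x 0 = 0 := by
      have : (s - s') * x 0 = 0 := by linarith
      exact (mul_eq_zero.1 this).resolve_left h'
    ext i
    fin_cases i
    · simpa using h0
    · simp [hx, h0]
  · rw [codisjoint_iff, eq_top_iff]
    intro x _
    set β := (x 1 - s * x 0) / (s' - s) with hβ
    have hβ' : β * (s' - s) = x 1 - s * x 0 := div_mul_cancel₀ _ (sub_ne_zero.2 h.symm)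
    refine Submodule.mem_sup.2 ⟨(x 0 - β) • !₂[1, s],
      Submodule.smul_mem _ _ (Submodule.mem_span_singleton_self _), β • !₂[1, s'],
      Submodule.smul_mem _ _ (Submodule.mem_span_singleton_self _), ?_⟩
    ext i
    fin_cases i
    · simp
    · simp
      linarith

theorem norm_le_of_slope {s B : ℝ} (hB : |s| ≤ B) {x : EuclideanSpace ℝ (Fin 2)}
    (hx : x 1 = s * x 0) : ‖x‖ ≤ (1 + B) * |x 0| := by
  have hB0 : 0 ≤ B := (abs_nonneg s).trans hB
  refine abs_le_of_sq_le_sq' ?_ (by positivity) |>.2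
  rw [EuclideanSpace.real_norm_sq_eq, Fin.sum_univ_two, hx, mul_pow, mul_pow, sq_abs]
  have : s ^ 2 ≤ B ^ 2 := sq_le_sq' (abs_le.1 hB).1 (abs_le.1 hB).2
  nlinarith [sq_nonneg (x 0), mul_nonneg hB0 (sq_nonneg (x 0)),
    mul_le_mul_of_nonneg_right this (sq_nonneg (x 0))]

theorem mem_span_graph {l s : ℝ} {x : EuclideanSpace ℝ (Fin 3)} :
    x ∈ Submodule.span ℝ {(!₂[l, 1, s] : EuclideanSpace ℝ (Fin 3))} ↔
      x 0 = l * x 1 ∧ x 2 = s * x 1 := by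
  rw [Submodule.mem_span_singleton]
  constructor
  · rintro ⟨c, rfl⟩
    simp [mul_comm]
  · rintro ⟨h, h'⟩
    refine ⟨x 1, ?_⟩
    ext i
    fin_cases i
    · simp [h, mul_comm]
    · simp
    · simp [h', mul_comm]

theorem norm_le_of_graph {l s B B' : ℝ} (hB : |l| ≤ B) (hB' : |s| ≤ B')
    {x : EuclideanSpace ℝ (Fin 3)} (h0 : x 0 = l * x 1) (h2 : x 2 = s * x 1) :
    ‖x‖ ≤ (1 + B + B') * |x 1| := by
  have hB0 : 0 ≤ B := (abs_nonneg l).trans hB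
  have hB0' : 0 ≤ B' := (abs_nonneg s).trans hB'
  refine abs_le_of_sq_le_sq' ?_ (by positivity) |>.2
  rw [EuclideanSpace.real_norm_sq_eq, Fin.sum_univ_three, h0, h2, mul_pow, mul_pow, mul_pow, sq_abs]
  have e1 : l ^ 2 ≤ B ^ 2 := sq_le_sq' (abs_le.1 hB).1 (abs_le.1 hB).2
  have e2 : s ^ 2 ≤ B' ^ 2 := sq_le_sq' (abs_le.1 hB').1 (abs_le.1 hB').2
  have e3 : l ^ 2 + 1 + s ^ 2 ≤ (1 + B + B') ^ 2 := by nlinarith [mul_nonneg hB0 hB0']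
  nlinarith [mul_le_mul_of_nonneg_right e3 (sq_nonneg (x 1))]

theorem span_sup_graph_sup_graph {a l s l' s' : ℝ} (h : s - a * l ≠ s' - a * l') :
    Submodule.span ℝ {(!₂[1, 0, a] : EuclideanSpace ℝ (Fin 3))} ⊔
      Submodule.span ℝ {(!₂[l, 1, s] : EuclideanSpace ℝ (Fin 3))} ⊔
      Submodule.span ℝ {(!₂[l', 1, s'] : EuclideanSpace ℝ (Fin 3))} = ⊤ := by
  rw [eq_top_iff]
  intro x _
  have hne : (s' - a * l') - (s - a * l) ≠ 0 := sub_ne_zero.2 h.symm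
  -- Modulo `(1, 0, a)` the two graph vectors become `(1, s - a l)` and `(1, s' - a l')`; `β` is the
  -- second coefficient in that plane, and the multiple of `(1, 0, a)` corrects the first
  -- coordinate.
  set β := (x 2 - a * x 0 - (s - a * l) * x 1) / ((s' - a * l') - (s - a * l)) with hβ
  have hβ' : β * ((s' - a * l') - (s - a * l)) = x 2 - a * x 0 - (s - a * l) * x 1 :=
    div_mul_cancel₀ _ hne
  refine Submodule.mem_sup.2 ⟨(x 0 - l * (x 1 - β) - l' * β) • !₂[1, 0, a] +
    (x 1 - β) • !₂[l, 1, s], Submodule.add_mem_sup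
      (Submodule.smul_mem _ _ (Submodule.mem_span_singleton_self _))
      (Submodule.smul_mem _ _ (Submodule.mem_span_singleton_self _)), β • !₂[l', 1, s'],
      Submodule.smul_mem _ _ (Submodule.mem_span_singleton_self _), ?_⟩
  ext i
  fin_cases i
  · simp; ring
  · simp
  · simp
    linarith

/-! ### The positive system of the thermostat flow. -/

section Surface

variable {M : Type*} [TopologicalSpace M] [ChartedSpace Plane M] [IsManifold (𝓡 2) ∞ M]
variable {g : Metric M}

theorem exists_coframe_eq (J : Rotation g) {v : TangentBundle (𝓡 2) M} (hv : v ∈ unitTangent g)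
    (x y k : ℝ) : ∃ ξ ∈ tangentUnit g v, coframe J v ξ = !₂[x, y, k] := by
  obtain ⟨γ, O, hO, h0, hγ, hγu, rfl, h⟩ := exists_curve J hv x y k
  exact ⟨_, mfderiv_mem_tangentUnit ((hγ.contMDiffAt (hO.mem_nhds h0)).mdifferentiableAt (by simp))
    (by filter_upwards [hO.mem_nhds h0] with s hs using hγu hs), (coframe_eq_iff J).2 h⟩

/-- The equality is stated in the total space so that `v` and `ξ` can be replaced together, without
transporting `ξ` between tangent spaces. -/
theorem exists_curve_eq (J : Rotation g) {v : TangentBundle (𝓡 2) M} (hv : v ∈ unitTangent g)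
    {ξ : TangentSpace (𝓡 2).tangent v} (hξ : ξ ∈ tangentUnit g v) :
    ∃ (γ : ℝ → TangentBundle (𝓡 2) M) (O : Set ℝ), IsOpen O ∧ (0 : ℝ) ∈ O ∧
      ContMDiffOn 𝓘(ℝ, ℝ) (𝓡 2).tangent ∞ γ O ∧ MapsTo γ O (unitTangent g) ∧
      (⟨v, ξ⟩ : TangentBundle (𝓡 2).tangent (TangentBundle (𝓡 2) M)) =
        ⟨γ 0, mfderiv 𝓘(ℝ, ℝ) (𝓡 2).tangent γ 0 (1 : ℝ)⟩ := by
  obtain ⟨γ, O, hO, h0, hγ, hγu, rfl, h1, h2, h3⟩ :=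
    exists_curve J hv (omega₁ g v ξ) (omega₂ J v ξ) (psi J v ξ)
  have hm := mfderiv_mem_tangentUnit (g := g)
    ((hγ.contMDiffAt (hO.mem_nhds h0)).mdifferentiableAt (by simp))
    (by filter_upwards [hO.mem_nhds h0] with s hs using hγu hs)
  refine ⟨γ, O, hO, h0, hγ, hγu, ?_⟩
  rw [eq_of_coframe_eq J hv hξ hm h1.symm h2.symm h3.symm]

/-- The component `ψ - a ω₁ - b ω₂` of a tangent vector, where `b + i a` represents `A`. -/
def Differential.slopeForm {J : Rotation g} {m : ℕ} (A : Differential J m)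
    (v : TangentBundle (𝓡 2) M) (ξ : TangentSpace (𝓡 2).tangent v) : ℝ :=
  psi J v ξ - A.imPart v * omega₁ g v ξ - (A.value v).re * omega₂ J v ξ

namespace IsThermostatFlow

variable {J : Rotation g} {m : ℕ} {A : Differential J m}
    {φ : ℝ → TangentBundle (𝓡 2) M → TangentBundle (𝓡 2) M}
    (hφ : IsThermostatFlow J A.imPart φ)
include hφ

theorem coframe_dflow_zero {v : TangentBundle (𝓡 2) M} (hv : v ∈ unitTangent g)
    {ξ : TangentSpace (𝓡 2).tangent v} (hξ : ξ ∈ tangentUnit g v) :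
    coframe J (φ 0 v) (dflow g φ 0 v ξ) = coframe J v ξ := by
  obtain ⟨γ, O, hO, h0, hγ, hγu, h⟩ := exists_curve_eq J hv hξ
  cases h
  rw [hφ.dflow_velocity hO hγ hγu h0]
  exact coframe_velocity_congr J (γ₁ := fun s => φ 0 (γ s))
    (by filter_upwards [hO.mem_nhds h0] with s hs using hφ.zero _ (hγu hs))

/-- Along the orbit `a' = Im D + m a b` and `b' = Re D - m a²`, while `ψ'` contains `Im (D (x + i
y)) + m b ψ`. In the derivative of `ψ - a x - b y` all terms in `D` cancel, and `ψ - a x = w + b y`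
closes the system. -/
theorem hasDerivAt_dflow (hA : A.IsHolomorphic)
    {v : TangentBundle (𝓡 2) M} (hv : v ∈ unitTangent g)
    {ξ : TangentSpace (𝓡 2).tangent v} (hξ : ξ ∈ tangentUnit g v) (t : ℝ) :
    HasDerivAt (fun t => omega₁ g (φ t v) (dflow g φ t v ξ))
      (A.imPart (φ t v) * omega₂ J (φ t v) (dflow g φ t v ξ)) t ∧
    HasDerivAt (fun t => omega₂ J (φ t v) (dflow g φ t v ξ))
      ((A.value (φ t v)).re * omega₂ J (φ t v) (dflow g φ t v ξ) +
        A.slopeForm (φ t v) (dflow g φ t v ξ)) t ∧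
    HasDerivAt (fun t => A.slopeForm (φ t v) (dflow g φ t v ξ))
      ((- gaussCurvature J (φ t v).1 + (m - 1) * Complex.normSq (A.value (φ t v))) *
          omega₂ J (φ t v) (dflow g φ t v ξ) +
        (m - 1) * (A.value (φ t v)).re * A.slopeForm (φ t v) (dflow g φ t v ξ)) t := by
  obtain ⟨γ, O, hO, h0, hγ, hγu, h⟩ := exists_curve_eq J hv hξ
  cases h
  have hd := hφ.dflow_velocity hO hγ hγu h0
  obtain ⟨D, hval, hx, hy, hψ⟩ := hφ.hasDerivAt_variation hA hO h0 hγ hγu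
    (x := fun t => omega₁ g (φ t (γ 0)) (dflow g φ t (γ 0)
      (mfderiv 𝓘(ℝ, ℝ) (𝓡 2).tangent γ 0 (1 : ℝ))))
    (y := fun t => omega₂ J (φ t (γ 0)) (dflow g φ t (γ 0)
      (mfderiv 𝓘(ℝ, ℝ) (𝓡 2).tangent γ 0 (1 : ℝ))))
    (ψ := fun t => psi J (φ t (γ 0)) (dflow g φ t (γ 0)
      (mfderiv 𝓘(ℝ, ℝ) (𝓡 2).tangent γ 0 (1 : ℝ))))
    (fun t => by rw [hd]) (fun t => by rw [hd]) (fun t => by rw [hd]) t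
  set x := fun t => omega₁ g (φ t (γ 0)) (dflow g φ t (γ 0)
      (mfderiv 𝓘(ℝ, ℝ) (𝓡 2).tangent γ 0 (1 : ℝ)))
  set y := fun t => omega₂ J (φ t (γ 0)) (dflow g φ t (γ 0)
      (mfderiv 𝓘(ℝ, ℝ) (𝓡 2).tangent γ 0 (1 : ℝ)))
  set ψ := fun t => psi J (φ t (γ 0)) (dflow g φ t (γ 0)
      (mfderiv 𝓘(ℝ, ℝ) (𝓡 2).tangent γ 0 (1 : ℝ)))
  have ha : HasDerivAt (fun t => A.imPart (φ t (γ 0))) _ t := hasDerivAt_im hval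
  have hb := hasDerivAt_re hval
  have hsl : ∀ t, A.slopeForm (φ t (γ 0)) (dflow g φ t (γ 0)
      (mfderiv 𝓘(ℝ, ℝ) (𝓡 2).tangent γ 0 (1 : ℝ))) =
      ψ t - A.imPart (φ t (γ 0)) * x t - (A.value (φ t (γ 0))).re * y t := fun t => rfl
  have him : A.imPart (φ t (γ 0)) = (A.value (φ t (γ 0))).im := rfl
  refine ⟨hx, hy.congr_deriv ?_, ((hψ.sub (ha.mul hx)).sub (hb.mul hy)).congr_deriv ?_⟩
  · rw [hsl]
    ring
  · rw [hsl, him, Complex.normSq_apply]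
    set c := A.value (φ t (γ 0))
    have hn1 : ((m : ℂ)).re = m := Complex.natCast_re m
    have hn2 : ((m : ℂ)).im = 0 := Complex.natCast_im m
    simp only [Complex.add_im, Complex.mul_im, Complex.add_re, Complex.mul_re, Complex.I_re,
      Complex.I_im, Complex.ofReal_re, Complex.ofReal_im, hn1, hn2]
    ring

end IsThermostatFlow

theorem Differential.continuous_value {J : Rotation g} {m : ℕ} (A : Differential J m) :
    Continuous A.value :=
  A.smooth.continuous

/-- The system satisfied by the variations of the orbits, on the unit tangent bundle. -/
def IsThermostatFlow.system {J : Rotation g} {m : ℕ} (hm : 2 ≤ m) {A : Differential J m}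
    (hA : A.IsHolomorphic) (hK : ∀ x : M, gaussCurvature J x < 0)
    {φ : ℝ → TangentBundle (𝓡 2) M → TangentBundle (𝓡 2) M}
    (hφ : IsThermostatFlow J A.imPart φ) : PositiveSystem (unitTangent g) where
  flow t v := ⟨φ t v, hφ.mapsTo t v.2⟩
  flow_zero v := Subtype.ext (hφ.zero v v.2)
  flow_add s t v := Subtype.ext (hφ.add s t v v.2)
  continuous_flow := by
    refine Continuous.subtype_mk ?_ _
    exact hφ.smooth.continuousOn.comp_continuous
      (by fun_prop : Continuous fun x : ℝ × unitTangent g => (x.1, (x.2 : TangentBundle (𝓡 2) M)))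
      fun x => ⟨mem_univ _, x.2.2⟩
  p v := (A.value v).re
  q v := (m - 1) * (A.value v).re
  P v := - gaussCurvature J v.1.1 + (m - 1) * Complex.normSq (A.value v)
  continuous_p := Complex.continuous_re.comp (A.continuous_value.comp continuous_subtype_val)
  continuous_q := continuous_const.mul
    (Complex.continuous_re.comp (A.continuous_value.comp continuous_subtype_val))
  continuous_P := by
    refine Continuous.add ?_ (continuous_const.mul
      (Complex.continuous_normSq.comp (A.continuous_value.comp continuous_subtype_val)))
    exact (hA.continuous_gaussCurvature.comp
      ((contMDiff_proj_tangent (M := M)).continuous.comp continuous_subtype_val)).neg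
  P_pos v := by
    have h1 : (2 : ℝ) ≤ m := by exact_mod_cast hm
    have h2 := mul_nonneg (by linarith : (0 : ℝ) ≤ m - 1) (Complex.normSq_nonneg (A.value v))
    linarith [hK v.1.1]
  exists_solution v y₀ w₀ := by
    -- With `x = 0`, the vector must have `ψ = w₀ + b y₀` in order that `w = ψ - a x - b y` equals
    -- `w₀`.
    obtain ⟨ξ, hξ, h⟩ := exists_coframe_eq J v.2 0 y₀ (w₀ + (A.value v).re * y₀)
    have h0 := hφ.coframe_dflow_zero v.2 hξ
    rw [h] at h0
    obtain ⟨h1, h2, h3⟩ := (coframe_eq_iff J).1 h0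
    have hz : φ 0 v = v := hφ.zero v v.2
    refine ⟨_, _, h2, ?_, fun t => ⟨(hφ.hasDerivAt_dflow hA v.2 hξ t).2.1,
      (hφ.hasDerivAt_dflow hA v.2 hξ t).2.2⟩⟩
    simp only [Differential.slopeForm]
    rw [h1, h2, h3, hz]
    ring

end Surface

/-! ### Line subbundles spanned by slopes and graphs. -/

theorem exists_continuousOn_extension {X : Type*} [TopologicalSpace X] {S : Set X} {R : S → ℝ}
    (hR : Continuous R) : ∃ R' : X → ℝ, ContinuousOn R' S ∧ ∀ v : S, R' v = R v := by
  have h : ∀ v : S, Function.extend Subtype.val R 0 (v : X) = R v :=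
    fun v => Subtype.val_injective.extend_apply R 0 v
  -- The values off `S` are arbitrary, since continuity is only required relative to `S`.
  refine ⟨Function.extend Subtype.val R 0, ?_, h⟩
  rw [continuousOn_iff_continuous_domRestrict]
  exact hR.congr fun v => (h v).symm

theorem isLineSubbundle_span {X W : Type*} [TopologicalSpace X] [NormedAddCommGroup W]
    [NormedSpace ℝ W] {S : Set X} {σ : X → W} (hσ : ContinuousOn σ S) (h0 : ∀ w, σ w ≠ 0) :
    IsLineSubbundle S fun w => Submodule.span ℝ {σ w} :=
  fun _ _ => ⟨univ, σ, Filter.univ_mem, hσ.mono inter_subset_left, fun w _ => ⟨h0 w, rfl⟩⟩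

theorem isLineSubbundle_slope {X : Type*} [TopologicalSpace X] {S : Set X} {s : X → ℝ}
    (hs : ContinuousOn s S) :
    IsLineSubbundle S fun w => Submodule.span ℝ {(!₂[1, s w] : EuclideanSpace ℝ (Fin 2))} := by
  refine isLineSubbundle_span ?_ fun w h => one_ne_zero (congrArg (fun x => x 0) h)
  refine (PiLp.continuous_toLp 2 _).comp_continuousOn (continuousOn_pi.2 fun i => ?_)
  fin_cases i
  · exact continuousOn_const
  · exact hs

theorem isLineSubbundle_graph {X : Type*} [TopologicalSpace X] {S : Set X} {l s : X → ℝ}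
    (hl : ContinuousOn l S) (hs : ContinuousOn s S) :
    IsLineSubbundle S fun w => Submodule.span ℝ {(!₂[l w, 1, s w] : EuclideanSpace ℝ (Fin 3))} := by
  refine isLineSubbundle_span ?_ fun w h => one_ne_zero (congrArg (fun x => x 1) h)
  refine (PiLp.continuous_toLp 2 _).comp_continuousOn (continuousOn_pi.2 fun i => ?_)
  fin_cases i
  · exact hl
  · exact continuousOn_const
  · exact hs

/-! ### The two conclusions for the thermostat flow. -/

section Surface

variable {M : Type*} [TopologicalSpace M] [ChartedSpace Plane M] [IsManifold (𝓡 2) ∞ M]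
variable {g : Metric M} [T2Space M] [CompactSpace M]
  {J : Rotation g} {m : ℕ} {A : Differential J m}
  {φ : ℝ → TangentBundle (𝓡 2) M → TangentBundle (𝓡 2) M}

theorem IsThermostatFlow.hasDominatedSplitting (hm : 2 ≤ m) (hA : A.IsHolomorphic)
    (hK : ∀ x : M, gaussCurvature J x < 0) (hφ : IsThermostatFlow J A.imPart φ) :
    HasDominatedSplitting J A.imPart φ := by
  have : CompactSpace (unitTangent g) := isCompact_iff_compactSpace.1 (isCompact_unitTangent J)
  set C := hφ.system hm hA hK with hC
  obtain ⟨Ru, εu, Lu, hεu, hRuc, hRu, hu⟩ := C.exists_unstable_slope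
  obtain ⟨Rs, εs, Ls, hεs, hRsc, hRs, hs⟩ := C.exists_stable_slope
  have hpc : Continuous fun v : unitTangent g => (A.value v).re := C.continuous_p
  obtain ⟨Bu, hBu0, hBu⟩ := PositiveSystem.exists_bound (hpc.add hRuc)
  obtain ⟨Bs, hBs0, hBs⟩ := PositiveSystem.exists_bound (hpc.add hRsc)
  obtain ⟨Ru', hRuc', hRu'⟩ := exists_continuousOn_extension hRuc
  obtain ⟨Rs', hRsc', hRs'⟩ := exists_continuousOn_extension hRsc
  have hre : Continuous fun v => (A.value v).re := Complex.continuous_re.comp A.continuous_value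
  have hmem : ∀ (R : TangentBundle (𝓡 2) M → ℝ) (v : TangentBundle (𝓡 2) M)
      (ξ : TangentSpace (𝓡 2).tangent v), quotientClass J A.imPart v ξ ∈
        Submodule.span ℝ {(!₂[1, (A.value v).re + R v] : EuclideanSpace ℝ (Fin 2))} ↔
      A.slopeForm v ξ = R v * omega₂ J v ξ := by
    intro R v ξ
    rw [mem_span_slope]
    simp only [quotientClass, Differential.slopeForm]
    simp only [Matrix.cons_val_zero, Matrix.cons_val_one]
    constructor <;> intro h <;> linarith
  have hsol : ∀ (v : unitTangent g) (ξ : TangentSpace (𝓡 2).tangent v.1), ξ ∈ tangentUnit g v.1 →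
      C.IsSolution v (fun t => omega₂ J (φ t v) (dflow g φ t v ξ))
        (fun t => A.slopeForm (φ t v) (dflow g φ t v ξ)) := fun v ξ hξ t =>
    (hφ.hasDerivAt_dflow hA v.2 hξ t).2
  have hzero : ∀ (v : unitTangent g) (ξ : TangentSpace (𝓡 2).tangent v.1), ξ ∈ tangentUnit g v.1 →
      omega₂ J (φ 0 v) (dflow g φ 0 v ξ) = omega₂ J v ξ ∧
      A.slopeForm (φ 0 v) (dflow g φ 0 v ξ) = A.slopeForm v ξ := by
    intro v ξ hξ
    obtain ⟨h1, h2, h3⟩ := (coframe_eq_iff J).1 (hφ.coframe_dflow_zero v.2 hξ)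
    refine ⟨h2, ?_⟩
    simp only [Differential.slopeForm]
    rw [h1, h2, h3, hφ.zero v v.2]
  have hinv : ∀ (R : unitTangent g → ℝ) (R' : TangentBundle (𝓡 2) M → ℝ), (∀ v, R' v.1 = R v) →
      (∀ v y w, C.IsSolution v y w → w 0 = R v * y 0 → ∀ t, w t = R (C.flow t v) * y t) →
      ∀ (v : unitTangent g) (ξ : TangentSpace (𝓡 2).tangent v.1), ξ ∈ tangentUnit g v.1 →
      A.slopeForm v.1 ξ = R' v * omega₂ J v.1 ξ → ∀ t, A.slopeForm (φ t v) (dflow g φ t v ξ) =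
        R (C.flow t v) * omega₂ J (φ t v) (dflow g φ t v ξ) := by
    intro R R' hR h v ξ hξ hv
    obtain ⟨h1, h2⟩ := hzero v ξ hξ
    exact h v _ _ (hsol v ξ hξ) (by rw [h1, h2, hv, hR])
  have hflow : ∀ (t : ℝ) (v : unitTangent g), (C.flow t v).1 = φ t v.1 := fun t v => rfl
  -- The second coordinate of the quotient class is `ψ - a ω₁ = w + b y`, so the line `w = R y` has
  -- slope `b + R` there.
  refine ⟨fun v => Submodule.span ℝ {!₂[1, (A.value v).re + Ru' v]},
    fun v => Submodule.span ℝ {!₂[1, (A.value v).re + Rs' v]},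
    isLineSubbundle_slope (hre.continuousOn.add hRuc'),
    isLineSubbundle_slope (hre.continuousOn.add hRsc'), ?_, ?_, ?_⟩
  · intro v hv
    refine isCompl_span_slope fun h => ?_
    have h1 := hRu' ⟨v, hv⟩
    have h2 := hRs' ⟨v, hv⟩
    have h3 := (hRu ⟨v, hv⟩).1
    have h4 := (hRs ⟨v, hv⟩).1
    simp only at h1 h2
    linarith
  · intro v hv t ξ hξ
    simp only [hmem]
    refine ⟨fun h => ?_, fun h => ?_⟩
    · have := hinv Ru Ru' hRu' hu ⟨v, hv⟩ ξ hξ h t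
      rwa [← hRu', hflow] at this
    · have := hinv Rs Rs' hRs' hs ⟨v, hv⟩ ξ hξ h t
      rwa [← hRs', hflow] at this
  -- The rate is the lower bound `εu + εs` for `Ru - Rs`; the factors `1 + Bs` and `1 + Bu` compare
  -- the norm on each line with `|ω₂|`.
  · refine ⟨(1 + Bs) * (1 + Bu), Real.exp (-(εu + εs)), by positivity, Real.exp_pos _,
      Real.exp_lt_one_iff.2 (by linarith), ?_⟩
    intro v hv t ht ξ hξ η hη h h'
    rw [hmem] at h h'
    have hvt := hφ.mapsTo t hv
    have k1 := hinv Rs Rs' hRs' hs ⟨v, hv⟩ ξ hξ h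
    have k2 := hinv Ru Ru' hRu' hu ⟨φ t v, hvt⟩ η hη h'
    have key := PositiveSystem.abs_mul_abs_le hRuc hRsc (κ := εu + εs) (fun v => by
      have := (hRu v).1
      have := (hRs v).1
      linarith) (v := ⟨v, hv⟩) ht.le (hsol ⟨v, hv⟩ ξ hξ) (hsol ⟨φ t v, hvt⟩ η hη) k1 k2
    simp only [(hzero ⟨v, hv⟩ ξ hξ).1, (hzero ⟨φ t v, hvt⟩ η hη).1] at key
    have n1 : ‖quotientClass J A.imPart (φ t v) (dflow g φ t v ξ)‖ ≤
        (1 + Bs) * |omega₂ J (φ t v) (dflow g φ t v ξ)| := by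
      refine norm_le_of_slope (hBs (C.flow t ⟨v, hv⟩)) ?_
      rw [← mem_span_slope]
      have := k1 t
      rw [← hRs', hflow, ← hmem Rs'] at this
      simpa only [Pi.add_apply, ← hRs', hflow] using this
    have n2 : ‖quotientClass J A.imPart (φ (-t) (φ t v)) (dflow g φ (-t) (φ t v) η)‖ ≤
        (1 + Bu) * |omega₂ J (φ (-t) (φ t v)) (dflow g φ (-t) (φ t v) η)| := by
      refine norm_le_of_slope (hBu (C.flow (-t) ⟨φ t v, hvt⟩)) ?_
      rw [← mem_span_slope]
      have := k2 (-t)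
      rw [← hRu', hflow, ← hmem Ru'] at this
      simpa only [Pi.add_apply, ← hRu', hflow] using this
    have n3 : |omega₂ J v ξ| ≤ ‖quotientClass J A.imPart v ξ‖ :=
      PiLp.norm_apply_le (quotientClass J A.imPart v ξ) 0
    have n4 : |omega₂ J (φ t v) η| ≤ ‖quotientClass J A.imPart (φ t v) η‖ :=
      PiLp.norm_apply_le (quotientClass J A.imPart (φ t v) η) 0
    rw [← Real.exp_mul]
    calc _ ≤ ((1 + Bs) * |omega₂ J (φ t v) (dflow g φ t v ξ)|) *
          ((1 + Bu) * |omega₂ J (φ (-t) (φ t v)) (dflow g φ (-t) (φ t v) η)|) := by gcongr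
      _ = ((1 + Bs) * (1 + Bu)) * (|omega₂ J (φ t v) (dflow g φ t v ξ)| *
          |omega₂ J (φ (-t) (φ t v)) (dflow g φ (-t) (φ t v) η)|) := by ring
      _ ≤ ((1 + Bs) * (1 + Bu)) * (Real.exp (-(εu + εs) * t) *
          (|omega₂ J v ξ| * |omega₂ J (φ t v) η|)) := by gcongr
      _ ≤ ((1 + Bs) * (1 + Bu)) * (Real.exp (-(εu + εs) * t) *
          (‖quotientClass J A.imPart v ξ‖ * ‖quotientClass J A.imPart (φ t v) η‖)) := by gcongr
      _ = _ := by ring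

theorem IsThermostatFlow.isAnosov (hm : m = 2) (hA : A.IsHolomorphic)
    (hK : ∀ x : M, gaussCurvature J x < 0) (hφ : IsThermostatFlow J A.imPart φ) :
    IsAnosov J A.imPart φ := by
  have : CompactSpace (unitTangent g) := isCompact_iff_compactSpace.1 (isCompact_unitTangent J)
  set C := hφ.system hm.ge hA hK with hC
  obtain ⟨k, hk, hkK⟩ := PositiveSystem.exists_pos_le hA.continuous_gaussCurvature.neg
    fun x => neg_pos.2 (hK x)
  have hm1 : (m : ℝ) - 1 = 1 := by rw [hm]; norm_num
  have hq : ∀ v, C.q v = C.p v := fun v => by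
    show ((m : ℝ) - 1) * _ = _
    rw [hm1, one_mul]
    rfl
  -- For `m = 2` the difference `P - p²` is `-K + (Im A)²`, so the discriminant condition holds with
  -- `k` the positive lower bound of `-K`.
  have hP : ∀ v, C.p v ^ 2 + k ≤ C.P v := fun v => by
    show (A.value v).re ^ 2 + k ≤ - gaussCurvature J v.1.1 + ((m : ℝ) - 1) *
      Complex.normSq (A.value v)
    rw [hm1, one_mul, Complex.normSq_apply]
    have h1 : k ≤ - gaussCurvature J v.1.1 := hkK v.1.1
    nlinarith [sq_nonneg (A.value v).im]
  have hac : Continuous A.imPart := Complex.continuous_im.comp A.continuous_value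
  have hre : Continuous fun v => (A.value v).re := Complex.continuous_re.comp A.continuous_value
  have hav : Continuous fun v : unitTangent g => A.imPart v := hac.comp continuous_subtype_val
  have hbv : Continuous fun v : unitTangent g => (A.value v).re := hre.comp continuous_subtype_val
  obtain ⟨Rs, ls, Ks, κs, hRsc, hlsc, hRs, hKs, hκs, hs⟩ := C.exists_contracted_line hav hk hq hP
  -- Reversing time turns `x' = a y` into `x' = -a y` and `w` into `-w`. The contracted line of the
  -- reversed system is therefore the unstable line, with slope `-Ru` and the same `lu`.
  obtain ⟨Ru, lu, Ku, κu, hRuc, hluc, hRu, hKu, hκu, hu⟩ :=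
    C.reverse.exists_contracted_line hav.neg hk (fun v => congrArg Neg.neg (hq v))
      (fun v => by
        show (-C.p v) ^ 2 + k ≤ C.P v
        rw [neg_sq]
        exact hP v)
  obtain ⟨Rs', hRsc', hRs'⟩ := exists_continuousOn_extension hRsc
  obtain ⟨Ru', hRuc', hRu'⟩ := exists_continuousOn_extension hRuc.neg
  replace hRu' : ∀ v : unitTangent g, Ru' v = -Ru v := hRu'
  obtain ⟨ls', hlsc', hls'⟩ := exists_continuousOn_extension hlsc
  obtain ⟨lu', hluc', hlu'⟩ := exists_continuousOn_extension hluc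
  obtain ⟨B₁, hB₁0, hB₁⟩ := PositiveSystem.exists_bound hlsc
  obtain ⟨B₂, hB₂0, hB₂⟩ := PositiveSystem.exists_bound ((hbv.add hRsc).add (hav.mul hlsc))
  obtain ⟨B₃, hB₃0, hB₃⟩ := PositiveSystem.exists_bound hluc
  obtain ⟨B₄, hB₄0, hB₄⟩ := PositiveSystem.exists_bound ((hbv.add hRuc.neg).add (hav.mul hluc))
  have hmem : ∀ (l R : TangentBundle (𝓡 2) M → ℝ) (v : TangentBundle (𝓡 2) M)
      (ξ : TangentSpace (𝓡 2).tangent v), coframe J v ξ ∈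
        Submodule.span ℝ {(!₂[l v, 1, (A.value v).re + R v + A.imPart v * l v] :
          EuclideanSpace ℝ (Fin 3))} ↔
      omega₁ g v ξ = l v * omega₂ J v ξ ∧ A.slopeForm v ξ = R v * omega₂ J v ξ := by
    intro l R v ξ
    rw [mem_span_graph]
    show omega₁ g v ξ = l v * omega₂ J v ξ ∧ psi J v ξ = _ * omega₂ J v ξ ↔ _
    simp only [Differential.slopeForm]
    constructor
    · rintro ⟨h1, h2⟩
      refine ⟨h1, ?_⟩
      rw [h2, h1]
      ring
    · rintro ⟨h1, h2⟩
      refine ⟨h1, ?_⟩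
      rw [h1] at h2
      linear_combination h2
  have hzero : ∀ (v : unitTangent g) (ξ : TangentSpace (𝓡 2).tangent v.1), ξ ∈ tangentUnit g v.1 →
      omega₁ g (φ 0 v) (dflow g φ 0 v ξ) = omega₁ g v ξ ∧
      omega₂ J (φ 0 v) (dflow g φ 0 v ξ) = omega₂ J v ξ ∧
      A.slopeForm (φ 0 v) (dflow g φ 0 v ξ) = A.slopeForm v ξ := by
    intro v ξ hξ
    obtain ⟨h1, h2, h3⟩ := (coframe_eq_iff J).1 (hφ.coframe_dflow_zero v.2 hξ)
    refine ⟨h1, h2, ?_⟩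
    simp only [Differential.slopeForm]
    rw [h1, h2, h3, hφ.zero v v.2]
  have hflow : ∀ (t : ℝ) (v : unitTangent g), (C.flow t v).1 = φ t v.1 := fun t v => rfl
  have hsol : ∀ (v : unitTangent g) (ξ : TangentSpace (𝓡 2).tangent v.1), ξ ∈ tangentUnit g v.1 →
      C.IsSolution v (fun t => omega₂ J (φ t v) (dflow g φ t v ξ))
        (fun t => A.slopeForm (φ t v) (dflow g φ t v ξ)) := fun v ξ hξ t =>
    (hφ.hasDerivAt_dflow hA v.2 hξ t).2
  have stable : ∀ v (hv : v ∈ unitTangent g), ∀ ξ ∈ tangentUnit g v,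
      omega₁ g v ξ = ls' v * omega₂ J v ξ ∧ A.slopeForm v ξ = Rs' v * omega₂ J v ξ → ∀ t,
      omega₁ g (φ t v) (dflow g φ t v ξ) = ls' (φ t v) * omega₂ J (φ t v) (dflow g φ t v ξ) ∧
      A.slopeForm (φ t v) (dflow g φ t v ξ) = Rs' (φ t v) * omega₂ J (φ t v) (dflow g φ t v ξ) ∧
      (0 ≤ t → |omega₂ J (φ t v) (dflow g φ t v ξ)| ≤
        Ks * Real.exp (-κs * t) * |omega₂ J v ξ|) := by
    intro v hv ξ hξ h t
    obtain ⟨z1, z2, z3⟩ := hzero ⟨v, hv⟩ ξ hξ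
    have := hs ⟨v, hv⟩ (fun t => omega₁ g (φ t v) (dflow g φ t v ξ)) _ _ (hsol ⟨v, hv⟩ ξ hξ)
      (fun t => (hφ.hasDerivAt_dflow hA hv hξ t).1)
      (by rw [z1, z2, ← hls']; exact h.1) (by rw [z2, z3, ← hRs']; exact h.2) t
    rw [← hls', ← hRs', hflow, z2] at this
    exact this
  have unstable : ∀ v (hv : v ∈ unitTangent g), ∀ ξ ∈ tangentUnit g v,
      omega₁ g v ξ = lu' v * omega₂ J v ξ ∧ A.slopeForm v ξ = Ru' v * omega₂ J v ξ → ∀ t,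
      omega₁ g (φ t v) (dflow g φ t v ξ) = lu' (φ t v) * omega₂ J (φ t v) (dflow g φ t v ξ) ∧
      A.slopeForm (φ t v) (dflow g φ t v ξ) = Ru' (φ t v) * omega₂ J (φ t v) (dflow g φ t v ξ) ∧
      (t ≤ 0 → |omega₂ J (φ t v) (dflow g φ t v ξ)| ≤
        Ku * Real.exp (κu * t) * |omega₂ J v ξ|) := by
    intro v hv ξ hξ h t
    obtain ⟨z1, z2, z3⟩ := hzero ⟨v, hv⟩ ξ hξ
    have := hu ⟨v, hv⟩ (fun t => omega₁ g (φ (-t) v) (dflow g φ (-t) v ξ)) _ _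
      (hsol ⟨v, hv⟩ ξ hξ).reverse
      (fun t => by
        refine ((hφ.hasDerivAt_dflow hA hv hξ (-t)).1.scomp t (hasDerivAt_neg t)).congr_deriv ?_
        show (-1 : ℝ) • (A.imPart (φ (-t) v) * _) = -A.imPart (φ (-t) v) * _
        rw [smul_eq_mul]
        ring)
      (by rw [neg_zero, z1, z2, ← hlu']; exact h.1)
      (by
        rw [neg_zero, z2, z3]
        have h1 := hRu' ⟨v, hv⟩
        simp only at h1
        rw [h.2, h1]
        ring) (-t)
    have hfl : C.reverse.flow (-t) ⟨v, hv⟩ = C.flow t ⟨v, hv⟩ :=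
      congrArg (fun t => C.flow t ⟨v, hv⟩) (neg_neg t)
    have h2 := hRu' (C.flow t ⟨v, hv⟩)
    rw [hflow] at h2
    rw [hfl, ← hlu', hflow] at this
    rw [neg_neg, neg_zero, z2] at this
    refine ⟨this.1, ?_, fun ht => ?_⟩
    · rw [h2]
      linear_combination -this.2.1
    · have h3 := this.2.2 (neg_nonneg.2 ht)
      rwa [neg_mul_neg] at h3
  -- From `x = ℓ y` and `w = R y` one gets `ψ = w + b y + a x = (b + R + a ℓ) y`, the third
  -- coordinate of the spanning vector.
  refine ⟨fun v => Submodule.span ℝ {!₂[ls' v, 1, (A.value v).re + Rs' v + A.imPart v * ls' v]},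
    fun v => Submodule.span ℝ {!₂[lu' v, 1, (A.value v).re + Ru' v + A.imPart v * lu' v]},
    isLineSubbundle_graph hlsc' ((hre.continuousOn.add hRsc').add (hac.continuousOn.mul hlsc')),
    isLineSubbundle_graph hluc' ((hre.continuousOn.add hRuc').add (hac.continuousOn.mul hluc')),
    ?_, ?_, ?_⟩
  · intro v hv
    refine span_sup_graph_sup_graph fun h => ?_
    have h1 := hRu' ⟨v, hv⟩
    have h2 := hRs' ⟨v, hv⟩
    have h3 := hRu ⟨v, hv⟩
    have h4 := hRs ⟨v, hv⟩
    simp only at h1 h2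
    linarith
  · intro v hv t ξ hξ
    simp only [hmem]
    exact ⟨fun h => ⟨(stable v hv ξ hξ h t).1, (stable v hv ξ hξ h t).2.1⟩,
      fun h => ⟨(unstable v hv ξ hξ h t).1, (unstable v hv ξ hξ h t).2.1⟩⟩
  · have hpos : 0 < (1 + B₁ + B₂) * Ks ∧ 0 < (1 + B₃ + B₄) * Ku := ⟨by positivity, by positivity⟩
    refine ⟨(1 + B₁ + B₂) * Ks + (1 + B₃ + B₄) * Ku, Real.exp (-κs), Real.exp κu,
      add_pos hpos.1 hpos.2, Real.exp_pos _, Real.exp_lt_one_iff.2 (by linarith),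
      Real.one_lt_exp_iff.2 hκu, ?_⟩
    intro v hv t ht ξ hξ
    have n0 : |omega₂ J v ξ| ≤ ‖coframe J v ξ‖ := PiLp.norm_apply_le (coframe J v ξ) 1
    simp only [hmem]
    refine ⟨fun h => ?_, fun h => ?_⟩
    · obtain ⟨h1, h2, h3⟩ := stable v hv ξ hξ h t
      have n1 : ‖coframe J (φ t v) (dflow g φ t v ξ)‖ ≤
          (1 + B₁ + B₂) * |omega₂ J (φ t v) (dflow g φ t v ξ)| := by
        have h4 := mem_span_graph.1 ((hmem ls' Rs' _ _).2 ⟨h1, h2⟩)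
        refine norm_le_of_graph ?_ ?_ h4.1 h4.2
        · have := hB₁ (C.flow t ⟨v, hv⟩)
          rwa [← hls', hflow] at this
        · have := hB₂ (C.flow t ⟨v, hv⟩)
          simp only [Pi.add_apply, Pi.mul_apply] at this
          rwa [← hls', ← hRs', hflow] at this
      rw [← Real.exp_mul]
      calc _ ≤ (1 + B₁ + B₂) * (Ks * Real.exp (-κs * t) * |omega₂ J v ξ|) :=
            n1.trans (mul_le_mul_of_nonneg_left (h3 ht.le) (by positivity))
        _ = (1 + B₁ + B₂) * Ks * Real.exp (-κs * t) * |omega₂ J v ξ| := by ring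
        _ ≤ _ := by
          gcongr
          linarith [hpos.2]
    · obtain ⟨h1, h2, h3⟩ := unstable v hv ξ hξ h (-t)
      have n1 : ‖coframe J (φ (-t) v) (dflow g φ (-t) v ξ)‖ ≤
          (1 + B₃ + B₄) * |omega₂ J (φ (-t) v) (dflow g φ (-t) v ξ)| := by
        have h4 := mem_span_graph.1 ((hmem lu' Ru' _ _).2 ⟨h1, h2⟩)
        refine norm_le_of_graph ?_ ?_ h4.1 h4.2
        · have := hB₃ (C.flow (-t) ⟨v, hv⟩)
          rwa [← hlu', hflow] at this
        · have := hB₄ (C.flow (-t) ⟨v, hv⟩)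
          have h5 := hRu' (C.flow (-t) ⟨v, hv⟩)
          simp only [Pi.add_apply, Pi.mul_apply] at this
          rw [← hlu', hflow] at this
          rw [hflow] at h5
          rwa [h5]
      rw [← Real.exp_mul]
      calc _ ≤ (1 + B₃ + B₄) * (Ku * Real.exp (κu * -t) * |omega₂ J v ξ|) :=
            n1.trans (mul_le_mul_of_nonneg_left (h3 (by linarith)) (by positivity))
        _ = (1 + B₃ + B₄) * Ku * Real.exp (κu * -t) * |omega₂ J v ξ| := by ring
        _ ≤ _ := by
          gcongr
          linarith [hpos.1]

end Surface

end Thermostat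

end

theorem mainTheorem9 {M : Type*} [TopologicalSpace M] [T2Space M] [CompactSpace M]
    [ChartedSpace (EuclideanSpace ℝ (Fin 2)) M] [IsManifold (𝓡 2) ∞ M]
    (g : Thermostat.Metric M) (J : Thermostat.Rotation g)
    (m : ℕ) (hm : 2 ≤ m) (A : Thermostat.Differential J m) (hA : A.IsHolomorphic)
    (hK : ∀ x : M, Thermostat.gaussCurvature J x < 0)
    (φ : ℝ → TangentBundle (𝓡 2) M → TangentBundle (𝓡 2) M)
    (hφ : Thermostat.IsThermostatFlow J A.imPart φ) :
    Thermostat.HasDominatedSplitting J A.imPart φ ∧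
      (m = 2 → Thermostat.IsAnosov J A.imPart φ) :=
  ⟨hφ.hasDominatedSplitting hm hA hK, fun h => hφ.isAnosov h hA hK⟩
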